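/- Let $n,m\ge 1$ be integers. A \emph{system} $A$ is a family of functions $A_{ij}\in L_1[0,1]$ (complex-valued), one for each pair of indices $i\ge 0$, $0\le j\le i+1$. \emph{Spaces.} $C_A^n[0,1]$ is the space of continuous $Y=(Y_0,\dots,Y_n)\in C[0,1]^{n+1}$ with $Y_i'=\sum_{j=0}^{i+1}A_{ij}Y_j$ for $i<n$ (generalized derivatives). For $s\in[1,\infty)$, $W^n_{s,A}[0,1]$ is the completion of $C_A^n[0,1]$ in the norm $\sum_{i<n}\|Y_i\|_{C[0,1]}+\bigl(\int_0^1|A_{n-1,n}|\,|Y_n|^s\,dx\bigr)^{1/s}$. Put $Y^\wedge=(Y_0(0),\dots,Y_{n-1}(0),Y_0(1),\dots,Y_{n-1}(1))\in\mathbb C^{2n}$. For $U\in\mathbb C^{2n\times 2n}$ let $C^n_{A,U}[0,1]$ and $W^n_{s,A,U}[0,1]$ be the subspaces given by $UY^\wedge=0$. Let $W^{-n}_{1,A,U}[0,1]$ be the space of conjugate-linear functionals $Y\mapsto\sum_{i=0}^n\int_0^1 f_i\overline{Y_i}\,dx$ on $C^n_{A,U}[0,1]$ with all $f_i\in L_1[0,1]$.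 For $s>1$ and $t=s/(s-1)$, let $W^{-n}_{s,A,U}[0,1]$ be the space of conjugate-linear functionals $$Y\mapsto\sum_{i=0}^{n-1}\int_0^1 f_i\overline{Y_i}\,dx+\int_0^1|A_{n-1,n}|^{1/t}f_n\overline{Y_n}\,dx$$ on $W^n_{t,A,U}[0,1]$ with $f_i\in L_1[0,1]$ for $i<n$, $f_n\in L_s[0,1]$, and $f_n=0$ a.e. where $A_{n-1,n}=0$. Both are normed as spaces of bounded functionals. \emph{Assumptions.} Let $A,B$ be systems such that the primitives of $|A_{i,i+1}|$ ($i<n$) and of $|B_{j,j+1}|$ ($j<m$) are strictly monotone on $[0,1]$, and such that for almost all $x$ the equalities $A_{n-1,n}(x)=0$ and $B_{m-1,m}(x)=0$ are equivalent. Let $s\in[1,\infty)$; if $s=1$, suppose also that $A_{n-1,n}\ne 0$ a.e. Let $U\in\mathbb C^{2n\times2n}$, $V\in\mathbb C^{2m\times 2m}$, $Q\in\mathbb C^{2m\times 2n}$, and let $p_{ij}$ ($0\le i\le n$, $0\le j\le m$) be measurable complex functions on $[0,1]$ such that - $p_{nm}\neq 0$ a.e. and $p_{nm},\,p_{nm}^{-1}\in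 L_\infty[0,1]$; - for $i<n$: $p_{im}\in L_s[0,1]$ and, if $s\ne1$, $p_{im}=0$ a.e. where $B_{m-1,m}=0$; - for $j<m$: $p_{nj}\in L_{s/(s-1)}[0,1]$ ($L_\infty[0,1]$ if $s=1$) and $p_{nj}=0$ a.e. where $A_{n-1,n}=0$; - $p_{ij}\in L_1[0,1]$ for $i<n$, $j<m$. \emph{Claim.} There is a bounded linear operator $T\colon W^n_{s,A,U}[0,1]\to W^{-m}_{s,B,V}[0,1]$ such that for all $Y\in W^n_{s,A,U}[0,1]$ and all $Z$ in the space on which the functionals act ($C^m_{B,V}[0,1]$ if $s=1$, $W^m_{s/(s-1),B,V}[0,1]$ if $s>1$) $$\langle TY,Z\rangle=\int_0^1|A_{n-1,n}|^{1/s}|B_{m-1,m}|^{(s-1)/s}p_{nm}Y_n\overline{Z_m}\,dx+\sum_{i<n}\int_0^1|B_{m-1,m}|^{(s-1)/s}p_{im}Y_i\overline{Z_m}\,dx$$ $$+\sum_{j<m}\int_0^1|A_{n-1,n}|^{1/s}p_{nj}Y_n\overline{Z_j}\,dx+\sum_{i<n}\sum_{j<m}\int_0^1p_{ij}Y_i\overline{Z_j}\,dx+\langle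 QY^\wedge,Z^\wedge\rangle,$$ and every bounded operator $T$ of this form is Fredholm, of index $n-m-\operatorname{rank}U+\operatorname{rank}V$. -/

import Mathlib

open MeasureTheory Set
open scoped ENNReal unitInterval ComplexConjugate Matrix

noncomputable section

namespace QuasiSobolev

/-- A system `A` of functions of class `L₁[0,1]`: for every pair of natural indices `i` and
`j ≤ i + 1` a summable function `A i j`. (Values for `j > i + 1` are never used.) -/
structure CoeffSystem where
  /-- the functions of the system -/
  coeff : ℕ → ℕ → I → ℂ
  integrable_coeff : ∀ i j, j ≤ i + 1 → Integrable (coeff i j) volume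

instance : CoeFun CoeffSystem (fun _ => ℕ → ℕ → I → ℂ) := ⟨CoeffSystem.coeff⟩

variable (A : CoeffSystem) (n : ℕ)

/-- For every `i < n` the primitive of `|A_{i,i+1}|` is strictly monotone on `[0,1]`. -/
def CoeffSystem.StrictMonoUpTo : Prop :=
  ∀ i < n, StrictMono (fun x : I => ∫ t in Iic x, ‖A i (i + 1) t‖)

/-- The measure `|A_{n-1,n}| dx` on `[0,1]`. -/
def CoeffSystem.weight : Measure I :=
  (volume : Measure I).withDensity (fun x => ‖A (n - 1) n x‖ₑ)

instance : IsFiniteMeasure (A.weight n) :=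
  isFiniteMeasure_withDensity (A.integrable_coeff (n - 1) n (by omega)).hasFiniteIntegral.ne

/-- The equations `Y_i' = ∑_{j ≤ i+1} A_{ij} Y_j`, `i < n`, for a continuous vector function with
`n + 1` components. As the right-hand side is summable and `Y_i` is continuous, the equation in
the sense of generalized derivatives means that `Y_i` is the absolutely continuous function with
this derivative, that is, a primitive of the right-hand side. -/
def IsSolution (Y : Fin (n + 1) → C(I, ℂ)) : Prop :=
  ∀ i : Fin n, ∀ x : I, Y i.castSucc x = Y i.castSucc 0 +
    ∫ t in Iic x, ∑ j : Fin (n + 1), if (j : ℕ) ≤ i + 1 then A i j t * Y j t else 0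

variable {A n} in
theorem integrable_rhs (Y : Fin (n + 1) → C(I, ℂ)) (i : ℕ) :
    Integrable (fun t => ∑ j : Fin (n + 1), if (j : ℕ) ≤ i + 1 then A i j t * Y j t else 0)
      (volume : Measure I) := by
  refine integrable_finsetSum _ fun j _ => ?_
  by_cases h : (j : ℕ) ≤ i + 1
  · simp only [h, if_true]
    refine (A.integrable_coeff i j h).mul_bdd (c := ‖Y j‖)
      (Y j).continuous.aestronglyMeasurable (ae_of_all _ fun t => (Y j).norm_coe_le_norm t)
  · simp [h]

/-- The space `C_A^n[0,1]`, with the norm of `C[0,1]^{n+1}`. -/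
def CSpace : Submodule ℂ (Fin (n + 1) → C(I, ℂ)) where
  carrier := {Y | IsSolution A n Y}
  zero_mem' := by intro i x; simp
  add_mem' := by
    intro Y Z hY hZ i x
    have h := integral_add (integrable_rhs (A := A) Y i).restrict
      (integrable_rhs (A := A) Z i).restrict (μ := volume.restrict (Iic x))
    have e : (fun t => ∑ j : Fin (n + 1),
        if (j : ℕ) ≤ i + 1 then A i j t * (Y + Z) j t else 0) =
      fun t => (∑ j : Fin (n + 1), if (j : ℕ) ≤ i + 1 then A i j t * Y j t else 0) +
        ∑ j : Fin (n + 1), if (j : ℕ) ≤ i + 1 then A i j t * Z j t else 0 := by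
      funext t
      rw [← Finset.sum_add_distrib]
      refine Finset.sum_congr rfl fun j _ => ?_
      split_ifs <;> simp [mul_add]
    rw [e, h]
    simp only [Pi.add_apply, ContinuousMap.add_apply]
    rw [hY i x, hZ i x]
    ring
  smul_mem' := by
    intro c Y hY i x
    have e : (fun t => ∑ j : Fin (n + 1),
        if (j : ℕ) ≤ i + 1 then A i j t * (c • Y) j t else 0) =
      fun t => c * (∑ j : Fin (n + 1), if (j : ℕ) ≤ i + 1 then A i j t * Y j t else 0) := by
      funext t
      rw [Finset.mul_sum]
      refine Finset.sum_congr rfl fun j _ => ?_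
      split_ifs <;> simp [mul_left_comm]
    rw [e, integral_const_mul]
    simp only [Pi.smul_apply, ContinuousMap.smul_apply, smul_eq_mul]
    rw [hY i x]
    ring

/-- The boundary values `Y^∧ = (Y_0(0), …, Y_{n-1}(0), Y_0(1), …, Y_{n-1}(1))` of a vector function;
the left summand of the index type stands for the endpoint `0`, the right one for `1`. -/
def boundary {n : ℕ} (Y : Fin n → C(I, ℂ)) : Fin n ⊕ Fin n → ℂ :=
  Sum.elim (fun k => Y k 0) (fun k => Y k 1)

/-- The elements of `C_A^n[0,1]` with `U Y^∧ = 0`, as a subspace of `C[0,1]^{n+1}`. -/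
def CSubmoduleBC (U : Matrix (Fin n ⊕ Fin n) (Fin n ⊕ Fin n) ℂ) :
    Submodule ℂ (Fin (n + 1) → C(I, ℂ)) where
  carrier := {Y | Y ∈ CSpace A n ∧ U *ᵥ boundary (fun k : Fin n => Y k.castSucc) = 0}
  zero_mem' := by
    refine ⟨zero_mem _, ?_⟩
    have : boundary (fun k : Fin n => (0 : Fin (n + 1) → C(I, ℂ)) k.castSucc) = 0 := by
      ext (k | k) <;> simp [boundary]
    rw [this, Matrix.mulVec_zero]
  add_mem' := by
    rintro Y Z ⟨hY, hY'⟩ ⟨hZ, hZ'⟩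
    refine ⟨add_mem hY hZ, ?_⟩
    have : boundary (fun k : Fin n => (Y + Z) k.castSucc) =
        boundary (fun k : Fin n => Y k.castSucc) + boundary (fun k : Fin n => Z k.castSucc) := by
      ext (k | k) <;> simp [boundary]
    rw [this, Matrix.mulVec_add, hY', hZ', add_zero]
  smul_mem' := by
    rintro c Y ⟨hY, hY'⟩
    refine ⟨Submodule.smul_mem _ c hY, ?_⟩
    have : boundary (fun k : Fin n => (c • Y) k.castSucc) =
        c • boundary (fun k : Fin n => Y k.castSucc) := by
      ext (k | k) <;> simp [boundary]
    rw [this, Matrix.mulVec_smul, hY', smul_zero]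

/-- The space `C_{A,U}^n[0,1]`. -/
def CSpaceBC (U : Matrix (Fin n ⊕ Fin n) (Fin n ⊕ Fin n) ℂ) : Type := CSubmoduleBC A n U

instance (U : Matrix (Fin n ⊕ Fin n) (Fin n ⊕ Fin n) ℂ) : NormedAddCommGroup (CSpaceBC A n U) :=
  Submodule.normedAddCommGroup (CSubmoduleBC A n U)

instance (U : Matrix (Fin n ⊕ Fin n) (Fin n ⊕ Fin n) ℂ) : NormedSpace ℂ (CSpaceBC A n U) :=
  Submodule.normedSpace (CSubmoduleBC A n U)

/-- The Banach space `C[0,1]^n × L_s([0,1]; |A_{n-1,n}|)`, with the norm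
`∑_{i<n} ‖Y_i‖_C + (∫ |A_{n-1,n}| |Y_n|^s)^{1/s}`. -/
abbrev Ambient (s : ℝ≥0∞) [Fact (1 ≤ s)] : Type :=
  WithLp 1 (PiLp 1 (fun _ : Fin n => C(I, ℂ)) × Lp ℂ s (A.weight n))

/-- A continuous vector function with `n + 1` components as an element of `Ambient A n s`. -/
def toAmbient (s : ℝ≥0∞) [Fact (1 ≤ s)] (Y : Fin (n + 1) → C(I, ℂ)) : Ambient A n s :=
  WithLp.toLp 1 (WithLp.toLp 1 (fun i : Fin n => Y i.castSucc),
    ContinuousMap.toLp s (A.weight n) ℂ (Y (Fin.last n)))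

/-- `toAmbient` as a linear map on `C_A^n[0,1]`. -/
def toAmbientₗ (s : ℝ≥0∞) [Fact (1 ≤ s)] : CSpace A n →ₗ[ℂ] Ambient A n s where
  toFun Y := toAmbient A n s Y
  map_add' Y Z := by
    refine (WithLp.ofLp_injective 1) (Prod.ext ?_ ?_)
    · rfl
    · exact map_add (ContinuousMap.toLp s (A.weight n) ℂ) _ _
  map_smul' c Y := by
    refine (WithLp.ofLp_injective 1) (Prod.ext ?_ ?_)
    · rfl
    · exact map_smul (ContinuousMap.toLp s (A.weight n) ℂ) c _

/-- The space `W_{s,A}^n[0,1]`: the completion of `C_A^n[0,1]` with respect to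
`∑_{i<n} ‖Y_i‖_C + (∫ |A_{n-1,n}| |Y_n|^s)^{1/s}`, realized as the closure of the image of
`C_A^n[0,1]` in the Banach space `Ambient A n s`, whose norm restricts to the given one. -/
def WSpace (s : ℝ≥0∞) [Fact (1 ≤ s)] : Submodule ℂ (Ambient A n s) :=
  (LinearMap.range (toAmbientₗ A n s)).topologicalClosure

/-- The elements of `W_{s,A}^n[0,1]` with `U Y^∧ = 0`, as a subspace of `Ambient A n s`. -/
def WSubmoduleBC (s : ℝ≥0∞) [Fact (1 ≤ s)] (U : Matrix (Fin n ⊕ Fin n) (Fin n ⊕ Fin n) ℂ) :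
    Submodule ℂ (Ambient A n s) where
  carrier := {Y | Y ∈ WSpace A n s ∧ U *ᵥ boundary (fun k : Fin n => Y.fst k) = 0}
  zero_mem' := by
    refine ⟨zero_mem _, ?_⟩
    have : boundary (fun k : Fin n => (0 : Ambient A n s).fst k) = 0 := by
      ext (k | k) <;> simp [boundary]
    rw [this, Matrix.mulVec_zero]
  add_mem' := by
    rintro Y Z ⟨hY, hY'⟩ ⟨hZ, hZ'⟩
    refine ⟨add_mem hY hZ, ?_⟩
    have : boundary (fun k : Fin n => (Y + Z).fst k) =
        boundary (fun k : Fin n => Y.fst k) + boundary (fun k : Fin n => Z.fst k) := by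
      ext (k | k) <;> simp [boundary]
    rw [this, Matrix.mulVec_add, hY', hZ', add_zero]
  smul_mem' := by
    rintro c Y ⟨hY, hY'⟩
    refine ⟨Submodule.smul_mem _ c hY, ?_⟩
    have : boundary (fun k : Fin n => (c • Y).fst k) =
        c • boundary (fun k : Fin n => Y.fst k) := by
      ext (k | k) <;> simp only [boundary] <;> rfl
    rw [this, Matrix.mulVec_smul, hY', smul_zero]

/-- The space `W_{s,A,U}^n[0,1]`. -/
def WSpaceBC (s : ℝ≥0∞) [Fact (1 ≤ s)] (U : Matrix (Fin n ⊕ Fin n) (Fin n ⊕ Fin n) ℂ) : Type :=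
  WSubmoduleBC A n s U

instance (s : ℝ≥0∞) [Fact (1 ≤ s)] (U : Matrix (Fin n ⊕ Fin n) (Fin n ⊕ Fin n) ℂ) :
    NormedAddCommGroup (WSpaceBC A n s U) :=
  Submodule.normedAddCommGroup (WSubmoduleBC A n s U)

instance (s : ℝ≥0∞) [Fact (1 ≤ s)] (U : Matrix (Fin n ⊕ Fin n) (Fin n ⊕ Fin n) ℂ) :
    NormedSpace ℂ (WSpaceBC A n s U) :=
  Submodule.normedSpace (WSubmoduleBC A n s U)

variable {A n} in
theorem integrable_weighted {s q : ℝ≥0∞} [Fact (1 ≤ s)] [s.HolderConjugate q] {g : I → ℂ}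
    (hg : MemLp g q volume) (hg0 : ∀ᵐ x : I, A (n - 1) n x = 0 → g x = 0)
    (z : Lp ℂ s (A.weight n)) :
    Integrable (fun x => ((‖A (n - 1) n x‖ ^ (1 / s.toReal) : ℝ) : ℂ) * g x * conj (z x))
      (volume : Measure I) := by
  have hA := A.integrable_coeff (n - 1) n (by omega)
  have hAm : AEMeasurable (fun x => ‖A (n - 1) n x‖ₑ) (volume : Measure I) :=
    hA.aestronglyMeasurable.enorm
  have hz := Lp.stronglyMeasurable z
  rcases eq_or_ne s ∞ with rfl | hs
  · have hq : q = 1 := by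
      have h := ENNReal.HolderConjugate.conj_eq (p := ∞) (q := q)
      simpa using h
    subst hq
    have hb : ∀ᵐ x ∂(A.weight n), ‖z x‖ₑ ≤ eLpNorm z ∞ (A.weight n) := by
      rw [eLpNorm_exponent_top]; exact ae_le_eLpNormEssSup
    have hb' : ∀ᵐ x ∂(A.weight n), ‖z x‖ ≤ (eLpNorm z ∞ (A.weight n)).toReal := by
      filter_upwards [hb] with x hx
      have := ENNReal.toReal_mono (Lp.eLpNorm_ne_top z) hx
      simpa using this
    replace hb' := (ae_withDensity_iff' hAm).1 hb'
    have hg1 : Integrable g volume := memLp_one_iff_integrable.1 hg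
    refine (hg1.norm.mul_const (eLpNorm z ∞ (A.weight n)).toReal).mono' ?_ ?_
    · simp only [ENNReal.toReal_top, div_zero, Real.rpow_zero, Complex.ofReal_one, one_mul]
      exact hg1.aestronglyMeasurable.mul
        (Complex.continuous_conj.comp_aestronglyMeasurable hz.aestronglyMeasurable)
    · filter_upwards [hb', hg0] with x hx h0
      by_cases h : A (n - 1) n x = 0
      · simp [h0 h]
      · simp only [ENNReal.toReal_top, div_zero, Real.rpow_zero, Complex.ofReal_one, one_mul,
          norm_mul, RCLike.norm_conj]
        exact mul_le_mul_of_nonneg_left (hx (by simpa using h)) (norm_nonneg _)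
  · have hs0 : s ≠ 0 := (zero_lt_one.trans_le (Fact.out : 1 ≤ s)).ne'
    have hspos : 0 < s.toReal := ENNReal.toReal_pos hs0 hs
    have hm : AEStronglyMeasurable
        (fun x => ((‖A (n - 1) n x‖ ^ (1 / s.toReal) : ℝ) : ℂ) * conj (z x))
        (volume : Measure I) := by
      refine AEStronglyMeasurable.mul ?_
        (Complex.continuous_conj.comp_aestronglyMeasurable hz.aestronglyMeasurable)
      exact (Complex.measurable_ofReal.comp_aemeasurable
        (hA.aestronglyMeasurable.norm.aemeasurable.pow_const _)).aestronglyMeasurable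
    have hL : MemLp (fun x => ((‖A (n - 1) n x‖ ^ (1 / s.toReal) : ℝ) : ℂ) * conj (z x)) s
        (volume : Measure I) := by
      refine ⟨hm, ?_⟩
      have hz2 := Lp.eLpNorm_lt_top z
      rw [eLpNorm_lt_top_iff_lintegral_rpow_enorm_lt_top hs0 hs] at hz2 ⊢
      have hz3 := lintegral_withDensity_eq_lintegral_mul₀ hAm
        (hz.enorm.pow_const s.toReal).aemeasurable
      refine lt_of_eq_of_lt ((lintegral_congr fun x => ?_).trans hz3.symm) hz2
      simp only [Pi.mul_apply]
      rw [enorm_mul, ENNReal.mul_rpow_of_nonneg _ _ hspos.le]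
      have e1 : ‖((‖A (n - 1) n x‖ ^ (1 / s.toReal) : ℝ) : ℂ)‖ₑ =
          ‖A (n - 1) n x‖ₑ ^ (1 / s.toReal) := by
        rw [← ofReal_norm, ← ofReal_norm, Complex.norm_real,
          Real.norm_of_nonneg (by positivity),
          ENNReal.ofReal_rpow_of_nonneg (norm_nonneg _) (by positivity)]
      have e2 : ‖conj (z x)‖ₑ = ‖z x‖ₑ := by
        rw [← ofReal_norm, ← ofReal_norm, RCLike.norm_conj]
      rw [e1, e2, ← ENNReal.rpow_mul, one_div, inv_mul_cancel₀ hspos.ne', ENNReal.rpow_one]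
    have := hL.integrable_mul hg
    refine this.congr (ae_of_all _ fun x => ?_)
    simp only [Pi.mul_apply]
    ring

theorem integrable_mul_conj {f : I → ℂ} (hf : Integrable f volume) (z : C(I, ℂ)) :
    Integrable (fun x => f x * conj (z x)) (volume : Measure I) :=
  hf.mul_bdd (c := ‖z‖) (Complex.continuous_conj.comp z.continuous).aestronglyMeasurable
    (ae_of_all _ fun t => by
      rw [RCLike.norm_conj]
      exact z.norm_coe_le_norm t)

/-- The functionals `Z ↦ ∑_{i ≤ n} ∫ f_i conj(Z_i)` on
`C_{A,U}^n[0,1]` with `f_i ∈ L_1[0,1]`, as a subspace of the space of continuous conjugate-linear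
functionals. -/
def NegCSubmoduleBC (U : Matrix (Fin n ⊕ Fin n) (Fin n ⊕ Fin n) ℂ) :
    Submodule ℂ (CSpaceBC A n U →L⋆[ℂ] ℂ) where
  carrier := {F | ∃ f : Fin (n + 1) → I → ℂ, (∀ i, Integrable (f i) volume) ∧
    ∀ Z : CSpaceBC A n U, F Z = ∑ i, ∫ x, f i x * conj (Z.1 i x)}
  zero_mem' := ⟨0, fun i => integrable_zero _ _ _, fun Z => by simp⟩
  add_mem' := by
    rintro F G ⟨f, hf, hF⟩ ⟨g, hg, hG⟩
    refine ⟨f + g, fun i => (hf i).add (hg i), fun Z => ?_⟩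
    rw [add_apply, hF, hG, ← Finset.sum_add_distrib]
    refine Finset.sum_congr rfl fun i _ => ?_
    rw [← integral_add (integrable_mul_conj (hf i) _) (integrable_mul_conj (hg i) _)]
    simp [add_mul]
  smul_mem' := by
    rintro c F ⟨f, hf, hF⟩
    refine ⟨c • f, fun i => (hf i).smul c, fun Z => ?_⟩
    rw [smul_apply, hF, smul_eq_mul, Finset.mul_sum]
    refine Finset.sum_congr rfl fun i _ => ?_
    rw [← integral_const_mul]
    simp [mul_assoc]

/-- The space `W_{1,A,U}^{-n}[0,1]` of functionals on `C_{A,U}^n[0,1]`, with the operator norm. -/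
def NegCSpaceBC (U : Matrix (Fin n ⊕ Fin n) (Fin n ⊕ Fin n) ℂ) : Type := NegCSubmoduleBC A n U

instance (U : Matrix (Fin n ⊕ Fin n) (Fin n ⊕ Fin n) ℂ) : NormedAddCommGroup (NegCSpaceBC A n U) :=
  Submodule.normedAddCommGroup (NegCSubmoduleBC A n U)

instance (U : Matrix (Fin n ⊕ Fin n) (Fin n ⊕ Fin n) ℂ) : NormedSpace ℂ (NegCSpaceBC A n U) :=
  Submodule.normedSpace (NegCSubmoduleBC A n U)

/-- For conjugate exponents `s` and `q`, the functionals
`Z ↦ ∑_{i < n} ∫ f_i conj(Z_i) + ∫ |A_{n-1,n}|^{1/s} g conj(Z_n)` on `W_{s,A,U}^n[0,1]`, where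
`f_i ∈ L_1[0,1]`, `g ∈ L_q[0,1]` and `g` vanishes almost everywhere on the zero set of
`A_{n-1,n}`, as a subspace of the space of continuous conjugate-linear functionals. -/
def NegWSubmoduleBC (s q : ℝ≥0∞) [Fact (1 ≤ s)] [s.HolderConjugate q]
    (U : Matrix (Fin n ⊕ Fin n) (Fin n ⊕ Fin n) ℂ) :
    Submodule ℂ (WSpaceBC A n s U →L⋆[ℂ] ℂ) where
  carrier := {F | ∃ (f : Fin n → I → ℂ) (g : I → ℂ), (∀ i, Integrable (f i) volume) ∧
    MemLp g q volume ∧ (∀ᵐ x : I, A (n - 1) n x = 0 → g x = 0) ∧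
    ∀ Z : WSpaceBC A n s U, F Z = (∑ i, ∫ x, f i x * conj (Z.1.fst i x)) +
      ∫ x, ((‖A (n - 1) n x‖ ^ (1 / s.toReal) : ℝ) : ℂ) * g x * conj (Z.1.snd x)}
  zero_mem' := ⟨0, 0, fun i => integrable_zero _ _ _, MemLp.zero, by simp, fun Z => by simp⟩
  add_mem' := by
    rintro F G ⟨f, g, hf, hg, hg0, hF⟩ ⟨f', g', hf', hg', hg0', hG⟩
    refine ⟨f + f', g + g', fun i => (hf i).add (hf' i), hg.add hg', ?_, fun Z => ?_⟩
    · filter_upwards [hg0, hg0'] with x h h' hx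
      simp [h hx, h' hx]
    · have e : (fun x => ((‖A (n - 1) n x‖ ^ (1 / s.toReal) : ℝ) : ℂ) * (g + g') x *
          conj (Z.1.snd x)) = fun x =>
          ((‖A (n - 1) n x‖ ^ (1 / s.toReal) : ℝ) : ℂ) * g x * conj (Z.1.snd x) +
          ((‖A (n - 1) n x‖ ^ (1 / s.toReal) : ℝ) : ℂ) * g' x * conj (Z.1.snd x) := by
        funext x
        simp only [Pi.add_apply]
        ring
      have e' : ∑ i, ∫ x, (f + f') i x * conj (Z.1.fst i x) =
          (∑ i, ∫ x, f i x * conj (Z.1.fst i x)) + ∑ i, ∫ x, f' i x * conj (Z.1.fst i x) := by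
        rw [← Finset.sum_add_distrib]
        refine Finset.sum_congr rfl fun i _ => ?_
        rw [← integral_add (integrable_mul_conj (hf i) _) (integrable_mul_conj (hf' i) _)]
        simp [add_mul]
      rw [add_apply, hF, hG, e, e', integral_add
        (integrable_weighted hg hg0 _) (integrable_weighted hg' hg0' _)]
      ring
  smul_mem' := by
    rintro c F ⟨f, g, hf, hg, hg0, hF⟩
    refine ⟨c • f, c • g, fun i => (hf i).smul c, hg.const_smul c, ?_, fun Z => ?_⟩
    · filter_upwards [hg0] with x h hx
      simp [h hx]
    · rw [smul_apply, hF, smul_eq_mul, mul_add, Finset.mul_sum,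
        ← integral_const_mul]
      congr 1
      · refine Finset.sum_congr rfl fun i _ => ?_
        rw [← integral_const_mul]
        simp [mul_assoc]
      · congr 1
        funext x
        simp only [Pi.smul_apply, smul_eq_mul]
        ring

/-- For conjugate exponents `s` and `q`, the space `W_{q,A,U}^{-n}[0,1]` of functionals on
`W_{s,A,U}^n[0,1]`, with the operator norm. -/
def NegWSpaceBC (s q : ℝ≥0∞) [Fact (1 ≤ s)] [s.HolderConjugate q]
    (U : Matrix (Fin n ⊕ Fin n) (Fin n ⊕ Fin n) ℂ) : Type := NegWSubmoduleBC A n s q U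

instance (s q : ℝ≥0∞) [Fact (1 ≤ s)] [s.HolderConjugate q]
    (U : Matrix (Fin n ⊕ Fin n) (Fin n ⊕ Fin n) ℂ) :
    NormedAddCommGroup (NegWSpaceBC A n s q U) :=
  Submodule.normedAddCommGroup (NegWSubmoduleBC A n s q U)

instance (s q : ℝ≥0∞) [Fact (1 ≤ s)] [s.HolderConjugate q]
    (U : Matrix (Fin n ⊕ Fin n) (Fin n ⊕ Fin n) ℂ) :
    NormedSpace ℂ (NegWSpaceBC A n s q U) :=
  Submodule.normedSpace (NegWSubmoduleBC A n s q U)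

/-- The sesquilinear expression of the quasi-differential operator: for vector functions
`(Y_0, …, Y_{n-1}, y)` and `(Z_0, …, Z_{m-1}, z)`,
`∫ |A_{n-1,n}|^{1/s} |B_{m-1,m}|^{(s-1)/s} p_{nm} y conj(z)
  + ∑_{i<n} ∫ |B_{m-1,m}|^{(s-1)/s} p_{im} Y_i conj(z)
  + ∑_{j<m} ∫ |A_{n-1,n}|^{1/s} p_{nj} y conj(Z_j)
  + ∑_{i<n} ∑_{j<m} ∫ p_{ij} Y_i conj(Z_j) + ⟨Q Y^∧, Z^∧⟩`. -/
def quasiForm (A B : CoeffSystem) {n m : ℕ} (s : ℝ≥0∞) (p : ℕ → ℕ → I → ℂ)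
    (Q : Matrix (Fin m ⊕ Fin m) (Fin n ⊕ Fin n) ℂ)
    (Y : Fin n → C(I, ℂ)) (y : I → ℂ) (Z : Fin m → C(I, ℂ)) (z : I → ℂ) : ℂ :=
  (∫ x, ((‖A (n - 1) n x‖ ^ (1 / s.toReal) : ℝ) : ℂ) *
      ((‖B (m - 1) m x‖ ^ ((s.toReal - 1) / s.toReal) : ℝ) : ℂ) * p n m x * y x * conj (z x)) +
  (∑ i : Fin n, ∫ x, ((‖B (m - 1) m x‖ ^ ((s.toReal - 1) / s.toReal) : ℝ) : ℂ) *
      p i m x * Y i x * conj (z x)) +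
  (∑ j : Fin m, ∫ x, ((‖A (n - 1) n x‖ ^ (1 / s.toReal) : ℝ) : ℂ) *
      p n j x * y x * conj (Z j x)) +
  (∑ i : Fin n, ∑ j : Fin m, ∫ x, p i j x * Y i x * conj (Z j x)) +
  (Q *ᵥ boundary Y) ⬝ᵥ (fun k => conj (boundary Z k))

end QuasiSobolev

end

/-!
Write `a = A_{n-1,n}`, `b = B_{m-1,m}` and `u = |a|^{1/s} Y_n`. The space `W_{s,A,U}^n` consists of
all the solutions of the system with `u` of class `L_s`, `u = 0` where `a = 0`, and `U Y^∧ = 0`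
(`mem_WSpace_iff`); such a solution is determined by `Y(0)` and `u` (`solve`). In the same way
`W_{t,B,V}^m` with `t < ∞` and `C_{B,V}^m`, for which `t = ∞`, are spaces of solutions, and the
proof treats them together (`SolSpace`).

The index is found by comparison on the elements with zero boundary values.

* On the elements `Z` with `Z^∧ = 0`, integration by parts against a solution `H` of the
  inhomogeneous adjoint system (`adjoint_identity`) removes all the terms with `Z_j`, `j < m`, so that
  a functional becomes `∫ g conj(|b|^{1/t} Z_m)` (`SolSpace.functional_test`).
* If `Y^∧ = 0` too, then for the functional of the theorem `g` depends on `u` only. The dependence is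
  `g = p_{nm} u + (a Volterra operator with finitely many states)`, where the states are `Y` and `H`.
  Since `p_{nm}` is invertible, the equation can be solved for `u`, and substitution into the system
  for the states gives another linear system; so `u ↦ g` is bijective on `L_s`
  (`bijective_ioOp`, `bijective_reduction`). As `a` and `b` have the same zeros, it respects the
  condition of vanishing on the zero set (`reduction_mem_vanishing_iff`).
* What remains is finite-dimensional. As the primitives of `|A_{i,i+1}|` are strictly monotone, the
  endpoint values of the solutions with continuous `Y_n` are arbitrary
  (`surjective_endpoint_weighted`, by duality from `adjSolve_eq_zero`). Hence `Y^∧ = 0` has codimension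
  `2n - rank U` in the space, the image of `u ↦ g` on these elements has codimension `n`, the
  functionals `∫ g conj(|b|^{1/t} Z_m)` that vanish for all `Z` with `Z^∧ = 0` form a space of dimension
  `m` (`SolSpace.finrank_ker_reduced`), and the functionals that vanish for all these `Z` are the
  linear forms in the boundary values, a space of dimension `2m - rank V`
  (`SolSpace.finrank_ker_restrict`).
  A count of dimensions (`index_eq_of_factorization`) gives the index
  `m - n + (2n - rank U) - (2m - rank V)`.

For the Fredholm property, the same reduction bounds `‖Y‖` by the norm of the functional on a
subspace of finite codimension (`exists_norm_le_of_finite_conditions`): continuous functions norm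
`L_s`, `s < ∞` (`norm_le_of_forall_sesq_weighted_le`). The target space need not be complete for this
(`isFredholm_of_norm_le`).
-/

noncomputable section

namespace QuasiSobolev

/-! ### Multiplication operators between `Lp` spaces and primitives -/

/-- Multiplication by a function of class `L_q`, as a bounded operator `L_p → L_r`,
`1/q + 1/p = 1/r`. -/
def mulLp {q p r : ℝ≥0∞} [ENNReal.HolderTriple q p r] [Fact (1 ≤ q)] [Fact (1 ≤ p)]
    [Fact (1 ≤ r)] (f : I → ℂ) (hf : MemLp f q volume) :
    Lp ℂ p (volume : Measure I) →L[ℂ] Lp ℂ r (volume : Measure I) :=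
  (ContinuousLinearMap.mul ℂ ℂ).holderL volume q p r (hf.toLp f)

theorem coeFn_mulLp {q p r : ℝ≥0∞} [ENNReal.HolderTriple q p r] [Fact (1 ≤ q)] [Fact (1 ≤ p)]
    [Fact (1 ≤ r)] (f : I → ℂ) (hf : MemLp f q volume) (u : Lp ℂ p (volume : Measure I)) :
    (mulLp (r := r) f hf u : I → ℂ) =ᵐ[volume] fun x => f x * u x := by
  have h := (ContinuousLinearMap.mul ℂ ℂ).coeFn_holder (r := r) (hf.toLp f) u
  filter_upwards [h, hf.coeFn_toLp] with x hx hx'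
  simp only [mulLp, ContinuousLinearMap.holderL_apply_apply]
  rw [hx, hx']
  rfl

/-- Multiplication by a function of class `L_p`, as a bounded operator `C[0,1] → L_p`. -/
def mulC {p : ℝ≥0∞} [Fact (1 ≤ p)] (f : I → ℂ) (hf : MemLp f p volume) :
    C(I, ℂ) →L[ℂ] Lp ℂ p (volume : Measure I) :=
  (mulLp (p := ∞) f hf).comp (ContinuousMap.toLp ∞ volume ℂ)

theorem coeFn_mulC {p : ℝ≥0∞} [Fact (1 ≤ p)] (f : I → ℂ) (hf : MemLp f p volume) (Y : C(I, ℂ)) :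
    (mulC f hf Y : I → ℂ) =ᵐ[volume] fun x => f x * Y x := by
  filter_upwards [coeFn_mulLp (r := p) f hf (ContinuousMap.toLp ∞ volume ℂ Y),
    ContinuousMap.coeFn_toLp (p := ∞) (𝕜 := ℂ) volume Y] with x hx hx'
  simp only [mulC, ContinuousLinearMap.comp_apply]
  rw [hx, hx']

theorem continuous_setIntegral_Iic {E : Type*} [NormedAddCommGroup E] [NormedSpace ℝ E]
    {f : I → E} (hf : Integrable f volume) : Continuous fun x : I => ∫ t in Iic x, f t := by
  have e : (fun x : I => ∫ t in Iic x, f t) = fun x : I => ∫ t, (Iic x).indicator f t := by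
    funext x
    rw [integral_indicator measurableSet_Iic]
  rw [e, continuous_iff_continuousAt]
  intro x₀
  refine continuousAt_of_dominated (bound := fun t => ‖f t‖) ?_ ?_ hf.norm ?_
  · exact .of_forall fun x => hf.aestronglyMeasurable.indicator measurableSet_Iic
  · exact .of_forall fun x => .of_forall fun t => norm_indicator_le_norm_self _ _
  · have : ∀ᵐ t : I, t ≠ x₀ := by simp [ae_iff]
    filter_upwards [this] with t ht
    rcases lt_or_gt_of_ne ht with h | h
    · refine (continuousAt_const (y := f t)).congr ?_
      filter_upwards [lt_mem_nhds h] with x hx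
      rw [indicator_of_mem (show t ∈ Iic x from le_of_lt hx)]
    · refine (continuousAt_const (y := (0 : E))).congr ?_
      filter_upwards [gt_mem_nhds h] with x hx
      rw [indicator_of_notMem (show t ∉ Iic x from not_le.2 hx)]

/-- The primitive `x ↦ ∫_0^x f`, as a bounded operator `L_1 → C[0,1]`. -/
def primitive : Lp ℂ 1 (volume : Measure I) →L[ℂ] C(I, ℂ) :=
  LinearMap.mkContinuous
    { toFun := fun f => ⟨fun x => ∫ t in Iic x, f t,
        continuous_setIntegral_Iic (L1.integrable_coeFn f)⟩
      map_add' := fun f g => by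
        ext x
        simp only [ContinuousMap.coe_mk, ContinuousMap.add_apply]
        rw [← integral_add (L1.integrable_coeFn f).restrict (L1.integrable_coeFn g).restrict]
        exact integral_congr_ae (ae_restrict_of_ae (Lp.coeFn_add f g))
      map_smul' := fun c f => by
        ext x
        simp only [ContinuousMap.coe_mk, ContinuousMap.smul_apply, RingHom.id_apply]
        rw [← integral_smul]
        exact integral_congr_ae (ae_restrict_of_ae (Lp.coeFn_smul c f)) } 1 (fun f => by
    rw [one_mul, ContinuousMap.norm_le _ (norm_nonneg _)]
    intro x
    rw [L1.norm_eq_integral_norm]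
    refine (norm_integral_le_integral_norm _).trans ?_
    exact setIntegral_le_integral (L1.integrable_coeFn f).norm
      (.of_forall fun t => norm_nonneg _))

theorem primitive_apply (f : Lp ℂ 1 (volume : Measure I)) (x : I) :
    primitive f x = ∫ t in Iic x, f t := rfl

theorem setIntegral_Iic_zero {E : Type*} [NormedAddCommGroup E] [NormedSpace ℝ E] (f : I → E) :
    ∫ t in Iic (0 : I), f t = 0 := by
  have : (volume : Measure I).restrict (Iic 0) = 0 := by simp
  rw [this, integral_zero_measure]

theorem setIntegral_Iic_one {E : Type*} [NormedAddCommGroup E] [NormedSpace ℝ E] (f : I → E) :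
    ∫ t in Iic (1 : I), f t = ∫ t, f t := by
  have : Iic (1 : I) = univ := eq_univ_of_forall fun x => x.2.2
  rw [this, setIntegral_univ]

/-- A summable function with vanishing primitive is zero. -/
theorem ae_eq_zero_of_primitive_eq_zero {f : I → ℂ} (hf : Integrable f volume)
    (h : ∀ x : I, ∫ t in Iic x, f t = 0) : f =ᵐ[volume] 0 := by
  refine hf.ae_eq_zero_of_forall_setIntegral_eq_zero fun s hs _ => ?_
  have htot : ∫ t, f t = 0 := by rw [← setIntegral_Iic_one, h]
  induction s, hs using MeasurableSpace.induction_on_inter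
    ((borel_eq_generateFrom_Iic I).symm ▸ BorelSpace.measurable_eq (α := I)) isPiSystem_Iic with
  | empty => simp
  | basic t ht => obtain ⟨x, rfl⟩ := ht; exact h x
  | compl t ht ih =>
    have := integral_add_compl ht hf
    rw [ih (by simp), htot, zero_add] at this
    exact this
  | iUnion g hd hg ih =>
    rw [integral_iUnion hg hd hf.integrableOn]
    simp [ih]

/-- Integration by parts for primitives, over an atomless finite measure. -/
theorem integral_mul_integral_eq {𝕜 : Type*} [RCLike 𝕜] {ν : Measure I} [IsFiniteMeasure ν]
    [NullSingletonClass ν] {f g : I → 𝕜} (hf : Integrable f ν) (hg : Integrable g ν) :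
    (∫ t, f t ∂ν) * ∫ t, g t ∂ν =
      (∫ t, f t * ∫ r in Iic t, g r ∂ν ∂ν) + ∫ t, (∫ r in Iic t, f r ∂ν) * g t ∂ν := by
  have hfg := hf.mul_prod hg
  have hS : MeasurableSet {z : I × I | z.2 ≤ z.1} := measurableSet_le measurable_snd measurable_fst
  rw [← integral_prod_mul, ← integral_add_compl hS hfg]
  congr 1
  · rw [← integral_indicator hS, integral_prod _ (hfg.indicator hS)]
    refine integral_congr_ae (.of_forall fun t => ?_)
    simp only
    rw [← integral_const_mul, ← integral_indicator measurableSet_Iic]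
    refine integral_congr_ae (.of_forall fun r => ?_)
    by_cases h : r ≤ t <;> simp [indicator, h]
  · rw [← integral_indicator hS.compl, integral_prod_symm _ (hfg.indicator hS.compl)]
    refine integral_congr_ae (.of_forall fun r => ?_)
    simp only
    rw [← integral_mul_const, setIntegral_congr_set (Iio_ae_eq_Iic (μ := ν) (a := r)).symm,
      ← integral_indicator measurableSet_Iio]
    refine integral_congr_ae (.of_forall fun t => ?_)
    by_cases h : t < r <;> simp [indicator, h]

theorem integral_mul_primitive_pow {κ : I → ℝ} (hκ : Integrable κ volume) (k : ℕ) (x : I) :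
    ∫ t in Iic x, κ t * (∫ r in Iic t, κ r) ^ k =
      (∫ t in Iic x, κ t) ^ (k + 1) / (k + 1) := by
  induction k generalizing x with
  | zero => simp
  | succ k ih =>
    have hm := continuous_setIntegral_Iic hκ
    obtain ⟨C, hC⟩ := (isCompact_range (hm.pow k)).isBounded.exists_norm_le
    have hint : Integrable (fun t : I => κ t * (∫ r in Iic t, κ r) ^ k) volume :=
      hκ.mul_bdd (c := C) (hm.pow k).aestronglyMeasurable
        (.of_forall fun t => hC _ ⟨t, rfl⟩)
    have h := integral_mul_integral_eq (ν := volume.restrict (Iic x)) hκ.restrict hint.restrict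
    have e1 : ∀ F : I → ℝ, ∀ t ∈ Iic x, ∫ r in Iic t, F r ∂(volume.restrict (Iic x)) =
        ∫ r in Iic t, F r := by
      intro F t ht
      rw [Measure.restrict_restrict measurableSet_Iic, Iic_inter_Iic, min_eq_left ht]
    have h1 : ∫ t in Iic x, κ t * ∫ r in Iic t, κ r * (∫ r' in Iic r, κ r') ^ k
        ∂(volume.restrict (Iic x)) =
        1 / ((k : ℝ) + 1) * ∫ t in Iic x, κ t * (∫ r in Iic t, κ r) ^ (k + 1) := by
      rw [← integral_const_mul]
      refine setIntegral_congr_fun measurableSet_Iic fun t ht => ?_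
      rw [e1 _ t ht, ih t]
      ring
    have h2 : ∫ t in Iic x, (∫ r in Iic t, κ r ∂(volume.restrict (Iic x))) *
        (κ t * (∫ r in Iic t, κ r) ^ k) =
        ∫ t in Iic x, κ t * (∫ r in Iic t, κ r) ^ (k + 1) := by
      refine setIntegral_congr_fun measurableSet_Iic fun t ht => ?_
      rw [e1 _ t ht]
      ring
    rw [h1, h2, ih x] at h
    have hk : (k : ℝ) + 1 ≠ 0 := by positivity
    have hk' : ((k + 1 : ℕ) : ℝ) + 1 ≠ 0 := by positivity
    field_simp at h ⊢
    push_cast at h ⊢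
    linear_combination -h

/-! ### Volterra operators -/

/-- An operator on `C[0,1]^ι` dominated by integration over `[0,x]` with a summable density
differs from the identity by an invertible operator: the `k`-th power has norm `O(C^k / k!)`. -/
theorem isUnit_one_sub_of_volterra {ι : Type*} [Fintype ι]
    (K : (ι → C(I, ℂ)) →L[ℂ] (ι → C(I, ℂ))) {κ : I → ℝ} (hκ : Integrable κ volume)
    (hκ0 : ∀ t, 0 ≤ κ t)
    (h : ∀ X x, ∑ i, ‖K X i x‖ ≤ ∫ t in Iic x, κ t * ∑ i, ‖X i t‖) : IsUnit (1 - K) := by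
  set m : I → ℝ := fun x => ∫ t in Iic x, κ t with hm
  have hmc : Continuous m := continuous_setIntegral_Iic hκ
  have hm0 : ∀ x, 0 ≤ m x := fun x => integral_nonneg hκ0
  have key : ∀ k X x, ∑ i, ‖(K ^ k) X i x‖ ≤
      m x ^ k / k.factorial * (Fintype.card ι * ‖X‖) := by
    intro k
    induction k with
    | zero =>
      intro X x
      simp only [pow_zero, Nat.factorial_zero, Nat.cast_one, div_one, one_mul]
      calc ∑ i, ‖X i x‖ ≤ ∑ _i : ι, ‖X‖ := Finset.sum_le_sum fun i _ =>
            ((X i).norm_coe_le_norm x).trans (norm_le_pi_norm X i)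
        _ = _ := by simp
    | succ k ih =>
      intro X x
      rw [pow_succ']
      refine (h ((K ^ k) X) x).trans ?_
      have hc : Continuous fun t => m t ^ k / k.factorial * (Fintype.card ι * ‖X‖) := by fun_prop
      have hint : ∀ {F : I → ℝ}, Continuous F → Integrable (fun t => κ t * F t) volume := by
        intro F hF
        obtain ⟨C, hC⟩ := (isCompact_range hF).isBounded.exists_norm_le
        exact hκ.mul_bdd (c := C) hF.aestronglyMeasurable (.of_forall fun t => hC _ ⟨t, rfl⟩)
      calc ∫ t in Iic x, κ t * ∑ i, ‖(K ^ k) X i t‖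
          ≤ ∫ t in Iic x, κ t * (m t ^ k / k.factorial * (Fintype.card ι * ‖X‖)) := by
            refine integral_mono (hint ?_).restrict (hint hc).restrict fun t =>
              mul_le_mul_of_nonneg_left (ih X t) (hκ0 t)
            fun_prop
        _ = (∫ t in Iic x, κ t * m t ^ k) * ((Fintype.card ι * ‖X‖) / k.factorial) := by
            rw [← integral_mul_const]
            congr 1
            funext t
            ring
        _ = _ := by
            rw [hm, integral_mul_primitive_pow hκ k x, Nat.factorial_succ]
            push_cast
            field_simp
  set c : ℝ := m 1 with hc
  have hmle : ∀ x, m x ≤ c := by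
    intro x
    simp only [hc, hm]
    rw [setIntegral_Iic_one]
    exact setIntegral_le_integral hκ (.of_forall hκ0)
  have hnorm : ∀ k, ‖K ^ k‖ ≤ Fintype.card ι * (c ^ k / k.factorial) := by
    intro k
    have hck : 0 ≤ c := hm0 1
    refine ContinuousLinearMap.opNorm_le_bound _ (by positivity) fun X => ?_
    rw [pi_norm_le_iff_of_nonneg (by positivity)]
    intro i
    rw [ContinuousMap.norm_le _ (by positivity)]
    intro x
    calc ‖(K ^ k) X i x‖ ≤ ∑ i, ‖(K ^ k) X i x‖ :=
          Finset.single_le_sum (f := fun i => ‖(K ^ k) X i x‖) (fun _ _ => norm_nonneg _)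
            (Finset.mem_univ i)
      _ ≤ m x ^ k / k.factorial * (Fintype.card ι * ‖X‖) := key k X x
      _ ≤ c ^ k / k.factorial * (Fintype.card ι * ‖X‖) := by
          gcongr
          · exact hm0 x
          · exact hmle x
      _ = _ := by ring
  have hlim : Filter.Tendsto (fun k : ℕ => Fintype.card ι * (c ^ k / k.factorial))
      Filter.atTop (nhds 0) := by
    simpa using (FloorSemiring.tendsto_pow_div_factorial_atTop c).const_mul
      (Fintype.card ι : ℝ)
  obtain ⟨k, hk⟩ := (hlim.eventually_lt_const zero_lt_one).exists
  have hu : IsUnit (1 - K ^ k) := (Units.oneSub (K ^ k) ((hnorm k).trans_lt hk)).isUnit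
  rw [← mul_neg_geom_sum K k] at hu
  refine ((Commute.isUnit_mul_iff ?_).1 hu).1
  exact (mul_neg_geom_sum K k).trans (geom_sum_mul_neg K k).symm

/-- The integral operator `X ↦ (∫_0^x ∑_j M_{ij} X_j)_i` of a matrix of summable functions. -/
def volterra {ι : Type*} [Fintype ι] (M : ι → ι → I → ℂ)
    (hM : ∀ i j, MemLp (M i j) 1 volume) : (ι → C(I, ℂ)) →L[ℂ] (ι → C(I, ℂ)) :=
  ContinuousLinearMap.pi fun i => primitive.comp
    (∑ j, (mulC (M i j) (hM i j)).comp (ContinuousLinearMap.proj j))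

theorem volterra_apply {ι : Type*} [Fintype ι] (M : ι → ι → I → ℂ)
    (hM : ∀ i j, MemLp (M i j) 1 volume) (X : ι → C(I, ℂ)) (i : ι) :
    volterra M hM X i = ∑ j, primitive (mulC (M i j) (hM i j) (X j)) := by
  simp [volterra, map_sum]

theorem primitive_mulC_apply (f : I → ℂ) (hf : MemLp f 1 volume) (Y : C(I, ℂ)) (x : I) :
    primitive (mulC f hf Y) x = ∫ t in Iic x, f t * Y t := by
  rw [primitive_apply]
  exact integral_congr_ae (ae_restrict_of_ae (coeFn_mulC f hf Y))

theorem isUnit_one_sub_volterra {ι : Type*} [Fintype ι] (M : ι → ι → I → ℂ)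
    (hM : ∀ i j, MemLp (M i j) 1 volume) : IsUnit (1 - volterra M hM) := by
  have hMi : ∀ i j, Integrable (M i j) volume := fun i j => memLp_one_iff_integrable.1 (hM i j)
  have hint : ∀ i j, ∀ F : C(I, ℂ), Integrable (fun t => M i j t * F t) volume := fun i j F =>
    (hMi i j).mul_bdd (c := ‖F‖) F.continuous.aestronglyMeasurable
      (.of_forall fun t => F.norm_coe_le_norm t)
  have hκ : Integrable (fun t => ∑ i, ∑ j, ‖M i j t‖) volume :=
    integrable_finsetSum _ fun i _ => integrable_finsetSum _ fun j _ => (hMi i j).norm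
  refine isUnit_one_sub_of_volterra _ hκ (fun t => by positivity) fun X x => ?_
  have hF : Continuous fun t => ∑ j, ‖X j t‖ := by fun_prop
  obtain ⟨C, hC⟩ := (isCompact_range hF).isBounded.exists_norm_le
  calc ∑ i, ‖volterra M hM X i x‖
      ≤ ∑ i, ∑ j, ∫ t in Iic x, ‖M i j t * X j t‖ := by
        refine Finset.sum_le_sum fun i _ => ?_
        rw [volterra_apply, ContinuousMap.sum_apply]
        refine (norm_sum_le _ _).trans (Finset.sum_le_sum fun j _ => ?_)
        rw [primitive_mulC_apply]
        exact norm_integral_le_integral_norm _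
    _ = ∫ t in Iic x, ∑ i, ∑ j, ‖M i j t * X j t‖ := by
        rw [integral_finsetSum _ fun i _ => integrable_finsetSum _ fun j _ =>
          (hint i j (X j)).norm.restrict]
        exact Finset.sum_congr rfl fun i _ =>
          (integral_finsetSum _ fun j _ => (hint i j (X j)).norm.restrict).symm
    _ ≤ _ := by
        refine integral_mono (Integrable.restrict (integrable_finsetSum _ fun i _ =>
          integrable_finsetSum _ fun j _ => (hint i j (X j)).norm))
          (hκ.mul_bdd (c := C) hF.aestronglyMeasurable
            (.of_forall fun t => hC _ ⟨t, rfl⟩)).restrict fun t => ?_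
        simp only
        rw [Finset.sum_mul]
        refine Finset.sum_le_sum fun i _ => ?_
        rw [Finset.sum_mul]
        refine Finset.sum_le_sum fun j _ => ?_
        rw [norm_mul]
        exact mul_le_mul_of_nonneg_left (Finset.single_le_sum (f := fun j => ‖X j t‖)
          (fun _ _ => norm_nonneg _) (Finset.mem_univ j)) (norm_nonneg _)

end QuasiSobolev
end

noncomputable section

namespace QuasiSobolev

/-! ### The sesquilinear pairing of `L_s` and `L_t` -/

/-- Pointwise complex conjugation on `L_p`. -/
def conjLp (p : ℝ≥0∞) [Fact (1 ≤ p)] :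
    Lp ℂ p (volume : Measure I) →L⋆[ℂ] Lp ℂ p (volume : Measure I) :=
  ContinuousLinearMap.compLpL p volume (starL ℂ : ℂ ≃L⋆[ℂ] ℂ).toContinuousLinearMap

theorem coeFn_conjLp {p : ℝ≥0∞} [Fact (1 ≤ p)] (u : Lp ℂ p (volume : Measure I)) :
    (conjLp p u : I → ℂ) =ᵐ[volume] fun x => conj (u x) :=
  ContinuousLinearMap.coeFn_compLpL _ _

/-- The pairing `⟨u, v⟩ = ∫ u conj(v)` with `v` replaced by the values of a bounded operator `S`. -/
def sesq {s t : ℝ≥0∞} [Fact (1 ≤ s)] [Fact (1 ≤ t)] [t.HolderConjugate s]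
    {W : Type*} [NormedAddCommGroup W] [NormedSpace ℂ W]
    (S : W →L[ℂ] Lp ℂ t (volume : Measure I)) :
    Lp ℂ s (volume : Measure I) →L[ℂ] (W →L⋆[ℂ] ℂ) :=
  haveI : s.HolderConjugate t := ENNReal.HolderConjugate.symm
  ((ContinuousLinearMap.compSL W (Lp ℂ t (volume : Measure I)) ℂ
    (starRingEnd ℂ) (RingHom.id ℂ)).flip ((conjLp t).comp S)).comp
    ((ContinuousLinearMap.mul ℂ ℂ).lpPairing volume s t)

theorem sesq_apply {s t : ℝ≥0∞} [Fact (1 ≤ s)] [Fact (1 ≤ t)] [t.HolderConjugate s]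
    {W : Type*} [NormedAddCommGroup W] [NormedSpace ℂ W]
    (S : W →L[ℂ] Lp ℂ t (volume : Measure I)) (u : Lp ℂ s (volume : Measure I)) (w : W) :
    sesq S u w = ∫ x, u x * conj (S w x) := by
  have : s.HolderConjugate t := ENNReal.HolderConjugate.symm
  have : sesq S u w = (ContinuousLinearMap.mul ℂ ℂ).lpPairing volume s t u (conjLp t (S w)) := rfl
  rw [this, ContinuousLinearMap.lpPairing_eq_integral]
  refine integral_congr_ae ?_
  filter_upwards [coeFn_conjLp (S w)] with x hx
  rw [hx]
  rfl

/-! ### Weights -/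

/-- The function `|a|^{1/p}`; it is identically `1` for `p = ∞`. -/
def wpow (a : I → ℂ) (p : ℝ≥0∞) (x : I) : ℂ := ((‖a x‖ ^ (1 / p.toReal) : ℝ) : ℂ)

theorem wpow_top (a : I → ℂ) : wpow a ∞ = fun _ => 1 := by
  funext x
  simp [wpow]

theorem wpow_ne_zero {a : I → ℂ} {p : ℝ≥0∞} {x : I} (h : a x ≠ 0) : wpow a p x ≠ 0 := by
  have : 0 < ‖a x‖ ^ (1 / p.toReal) := Real.rpow_pos_of_pos (norm_pos_iff.2 h) _
  simpa [wpow] using this.ne'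

theorem wpow_eq_zero {a : I → ℂ} {p : ℝ≥0∞} [Fact (1 ≤ p)] (hp : p ≠ ∞) {x : I} (h : a x = 0) :
    wpow a p x = 0 := by
  have hp0 : p ≠ 0 := (zero_lt_one.trans_le (Fact.out : 1 ≤ p)).ne'
  have : 0 < p.toReal := ENNReal.toReal_pos hp0 hp
  simp only [wpow, h, norm_zero]
  rw [Real.zero_rpow (by positivity)]
  simp

theorem enorm_wpow_rpow (a : I → ℂ) {p : ℝ≥0∞} [Fact (1 ≤ p)] (hp : p ≠ ∞) (x : I) :
    ‖wpow a p x‖ₑ ^ p.toReal = ‖a x‖ₑ := by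
  have hp0 : p ≠ 0 := (zero_lt_one.trans_le (Fact.out : 1 ≤ p)).ne'
  have hpos : 0 < p.toReal := ENNReal.toReal_pos hp0 hp
  have e1 : ‖wpow a p x‖ₑ = ‖a x‖ₑ ^ (1 / p.toReal) := by
    rw [wpow, ← ofReal_norm, ← ofReal_norm, Complex.norm_real,
      Real.norm_of_nonneg (by positivity),
      ENNReal.ofReal_rpow_of_nonneg (norm_nonneg _) (by positivity)]
  rw [e1, ← ENNReal.rpow_mul, one_div, inv_mul_cancel₀ hpos.ne', ENNReal.rpow_one]

theorem aestronglyMeasurable_wpow {a : I → ℂ} (ha : Integrable a volume) (p : ℝ≥0∞) :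
    AEStronglyMeasurable (wpow a p) (volume : Measure I) :=
  (Complex.measurable_ofReal.comp_aemeasurable
    (ha.aestronglyMeasurable.norm.aemeasurable.pow_const _)).aestronglyMeasurable

theorem eLpNorm_wpow_mul {a : I → ℂ} (ha : Integrable a volume) {p : ℝ≥0∞} [Fact (1 ≤ p)]
    (hp : p ≠ ∞) {f : I → ℂ} (hf : AEStronglyMeasurable f (volume : Measure I)) :
    eLpNorm (fun x => wpow a p x * f x) p volume =
      eLpNorm f p (volume.withDensity fun x => ‖a x‖ₑ) := by
  have hp0 : p ≠ 0 := (zero_lt_one.trans_le (Fact.out : 1 ≤ p)).ne'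
  have hpos : 0 < p.toReal := ENNReal.toReal_pos hp0 hp
  rw [eLpNorm_eq_lintegral_rpow_enorm_toReal hp0 hp, eLpNorm_eq_lintegral_rpow_enorm_toReal hp0 hp,
    lintegral_withDensity_eq_lintegral_mul₀ ha.aestronglyMeasurable.enorm
      (hf.enorm.pow_const p.toReal)]
  congr 1
  refine lintegral_congr fun x => ?_
  simp only [Pi.mul_apply]
  rw [enorm_mul, ENNReal.mul_rpow_of_nonneg _ _ hpos.le, enorm_wpow_rpow a hp]

theorem memLp_wpow {a : I → ℂ} (ha : Integrable a volume) (p : ℝ≥0∞) [Fact (1 ≤ p)] :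
    MemLp (wpow a p) p volume := by
  rcases eq_or_ne p ∞ with rfl | hp
  · rw [wpow_top]
    exact memLp_const 1
  · refine ⟨aestronglyMeasurable_wpow ha p, ?_⟩
    have h := eLpNorm_wpow_mul ha hp (aestronglyMeasurable_const (b := (1 : ℂ)))
    simp only [mul_one] at h
    rw [h]
    have : IsFiniteMeasure ((volume : Measure I).withDensity fun x => ‖a x‖ₑ) :=
      isFiniteMeasure_withDensity ha.hasFiniteIntegral.ne
    exact (memLp_const (1 : ℂ)).2

theorem memLp_wpow_mul {a : I → ℂ} (ha : Integrable a volume) {p : ℝ≥0∞} [Fact (1 ≤ p)]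
    (hp : p ≠ ∞) {f : I → ℂ} (hf : StronglyMeasurable f)
    (hf' : MemLp f p (volume.withDensity fun x => ‖a x‖ₑ)) :
    MemLp (fun x => wpow a p x * f x) p volume :=
  ⟨(aestronglyMeasurable_wpow ha p).mul hf.aestronglyMeasurable, by
    rw [eLpNorm_wpow_mul ha hp hf.aestronglyMeasurable]; exact hf'.2⟩

theorem ae_wpow_mul_congr {a : I → ℂ} (ha : Integrable a volume) {p : ℝ≥0∞} [Fact (1 ≤ p)]
    (hp : p ≠ ∞) {f g : I → ℂ} (h : f =ᵐ[volume.withDensity fun x => ‖a x‖ₑ] g) :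
    (fun x => wpow a p x * f x) =ᵐ[volume] fun x => wpow a p x * g x := by
  filter_upwards [(ae_withDensity_iff' ha.aestronglyMeasurable.enorm).1 h] with x hx
  by_cases h0 : a x = 0
  · simp [wpow_eq_zero hp h0]
  · rw [hx (by simpa using h0)]

/-- Multiplication by `|a|^{1/p}`, as an isometry of `L_p([0,1]; |a|)` into `L_p[0,1]`. -/
def weightIso {a : I → ℂ} (ha : Integrable a volume) (p : ℝ≥0∞) [Fact (1 ≤ p)] (hp : p ≠ ∞) :
    Lp ℂ p ((volume : Measure I).withDensity fun x => ‖a x‖ₑ) →ₗᵢ[ℂ]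
      Lp ℂ p (volume : Measure I) where
  toFun f := (memLp_wpow_mul ha hp (Lp.stronglyMeasurable f) (Lp.memLp f)).toLp _
  map_add' f g := by
    refine Lp.ext ?_
    have h := ae_wpow_mul_congr ha hp (Lp.coeFn_add f g)
    filter_upwards [MemLp.coeFn_toLp (memLp_wpow_mul ha hp (Lp.stronglyMeasurable (f + g))
      (Lp.memLp (f + g))), MemLp.coeFn_toLp (memLp_wpow_mul ha hp (Lp.stronglyMeasurable f)
      (Lp.memLp f)), MemLp.coeFn_toLp (memLp_wpow_mul ha hp (Lp.stronglyMeasurable g)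
      (Lp.memLp g)), h, Lp.coeFn_add (MemLp.toLp _ (memLp_wpow_mul ha hp
      (Lp.stronglyMeasurable f) (Lp.memLp f))) (MemLp.toLp _ (memLp_wpow_mul ha hp
      (Lp.stronglyMeasurable g) (Lp.memLp g)))] with x h1 h2 h3 h4 h5
    rw [h1, h4, h5]
    simp only [Pi.add_apply]
    rw [h2, h3, mul_add]
  map_smul' c f := by
    refine Lp.ext ?_
    have h := ae_wpow_mul_congr ha hp (Lp.coeFn_smul c f)
    filter_upwards [MemLp.coeFn_toLp (memLp_wpow_mul ha hp (Lp.stronglyMeasurable (c • f))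
      (Lp.memLp (c • f))), MemLp.coeFn_toLp (memLp_wpow_mul ha hp (Lp.stronglyMeasurable f)
      (Lp.memLp f)), h, Lp.coeFn_smul c (MemLp.toLp _ (memLp_wpow_mul ha hp
      (Lp.stronglyMeasurable f) (Lp.memLp f)))] with x h1 h2 h4 h5
    rw [h1, h4, RingHom.id_apply, h5]
    simp only [Pi.smul_apply, smul_eq_mul]
    rw [h2]
    ring
  norm_map' f := by
    simp only [LinearMap.coe_mk, AddHom.coe_mk]
    rw [Lp.norm_toLp, eLpNorm_wpow_mul ha hp (Lp.stronglyMeasurable f).aestronglyMeasurable,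
      Lp.norm_def]

theorem coeFn_weightIso {a : I → ℂ} (ha : Integrable a volume) {p : ℝ≥0∞} [Fact (1 ≤ p)]
    (hp : p ≠ ∞) (f : Lp ℂ p ((volume : Measure I).withDensity fun x => ‖a x‖ₑ)) :
    (weightIso ha p hp f : I → ℂ) =ᵐ[volume] fun x => wpow a p x * f x :=
  MemLp.coeFn_toLp (memLp_wpow_mul ha hp (Lp.stronglyMeasurable f) (Lp.memLp f))

/-- The range of `weightIso` consists of the functions that vanish where `a` does. -/
theorem exists_weightIso_eq {a : I → ℂ} (ha : Integrable a volume) {p : ℝ≥0∞} [Fact (1 ≤ p)]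
    (hp : p ≠ ∞) (u : Lp ℂ p (volume : Measure I)) (hu : ∀ᵐ x : I, a x = 0 → u x = 0) :
    ∃ f, weightIso ha p hp f = u := by
  have hm : AEStronglyMeasurable (fun x => (wpow a p x)⁻¹ * u x) (volume : Measure I) :=
    (aestronglyMeasurable_wpow ha p).aemeasurable.inv.aestronglyMeasurable.mul
      (Lp.stronglyMeasurable u).aestronglyMeasurable
  have e : (fun x => wpow a p x * ((wpow a p x)⁻¹ * u x)) =ᵐ[volume] u := by
    filter_upwards [hu] with x hx
    by_cases h : a x = 0
    · rw [hx h]; simp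
    · rw [mul_inv_cancel_left₀ (wpow_ne_zero h)]
  have hf : MemLp (fun x => (wpow a p x)⁻¹ * u x) p (volume.withDensity fun x => ‖a x‖ₑ) := by
    refine ⟨hm.mono_ac (withDensity_absolutelyContinuous _ _), ?_⟩
    rw [← eLpNorm_wpow_mul ha hp hm, eLpNorm_congr_ae e]
    exact Lp.eLpNorm_lt_top u
  refine ⟨hf.toLp _, Lp.ext ?_⟩
  exact (coeFn_weightIso ha hp _).trans ((ae_wpow_mul_congr ha hp hf.coeFn_toLp).trans e)

/-- The operator `z ↦ |a|^{1/p} z` from `C[0,1]` to `L_p`. -/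
def weighted {a : I → ℂ} (ha : Integrable a volume) (p : ℝ≥0∞) [Fact (1 ≤ p)] :
    C(I, ℂ) →L[ℂ] Lp ℂ p (volume : Measure I) :=
  mulC (wpow a p) (memLp_wpow ha p)

theorem coeFn_weighted {a : I → ℂ} (ha : Integrable a volume) (p : ℝ≥0∞) [Fact (1 ≤ p)]
    (z : C(I, ℂ)) : (weighted ha p z : I → ℂ) =ᵐ[volume] fun x => wpow a p x * z x :=
  coeFn_mulC _ _ z

theorem weighted_eq_weightIso {a : I → ℂ} (ha : Integrable a volume) {p : ℝ≥0∞} [Fact (1 ≤ p)]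
    (hp : p ≠ ∞) [IsFiniteMeasure ((volume : Measure I).withDensity fun x => ‖a x‖ₑ)]
    (z : C(I, ℂ)) :
    weighted ha p z = weightIso ha p hp (ContinuousMap.toLp p
      ((volume : Measure I).withDensity fun x => ‖a x‖ₑ) ℂ z) := by
  refine Lp.ext ((coeFn_weighted ha p z).trans (Filter.EventuallyEq.symm ?_))
  exact (coeFn_weightIso ha hp _).trans (ae_wpow_mul_congr ha hp (ContinuousMap.coeFn_toLp _ z))

/-- The functions `|a|^{1/p} z` with continuous `z` are dense among the functions of class `L_p`
that vanish where `a` does. -/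
theorem exists_weighted_near {a : I → ℂ} (ha : Integrable a volume) {p : ℝ≥0∞} [Fact (1 ≤ p)]
    (hp : p ≠ ∞) (u : Lp ℂ p (volume : Measure I)) (hu : ∀ᵐ x : I, a x = 0 → u x = 0)
    {ε : ℝ} (hε : 0 < ε) : ∃ z : C(I, ℂ), ‖u - weighted ha p z‖ < ε := by
  have : IsFiniteMeasure ((volume : Measure I).withDensity fun x => ‖a x‖ₑ) :=
    isFiniteMeasure_withDensity ha.hasFiniteIntegral.ne
  obtain ⟨f, rfl⟩ := exists_weightIso_eq ha hp u hu
  have hd := ContinuousMap.toLp_denseRange ℂ ((volume : Measure I).withDensity fun x => ‖a x‖ₑ)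
    ℂ hp
  obtain ⟨z, hz⟩ := Metric.denseRange_iff.1 hd f ε hε
  refine ⟨z, ?_⟩
  rw [weighted_eq_weightIso ha hp, ← map_sub, LinearIsometry.norm_map, ← dist_eq_norm]
  exact hz

end QuasiSobolev
end

noncomputable section

namespace QuasiSobolev

/-! ### Norming functionals -/

/-- Continuous functions of norm at most one norm `L_1`: approximate `g` by a continuous `h` and
test with `h / (|h| + ε)`. -/
theorem norm_le_of_forall_integral_mul_conj_le {g : Lp ℂ 1 (volume : Measure I)} {c : ℝ}
    (h : ∀ z : C(I, ℂ), (∀ x, ‖z x‖ ≤ 1) → ‖∫ x, g x * conj (z x)‖ ≤ c) : ‖g‖ ≤ c := by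
  refine le_of_forall_pos_le_add fun δ hδ => ?_
  set ε : ℝ := δ / 3 with hε
  have hε0 : 0 < ε := by positivity
  obtain ⟨k, hk⟩ := Metric.denseRange_iff.1 (ContinuousMap.toLp_denseRange ℂ
    (volume : Measure I) ℂ ENNReal.one_ne_top) g ε hε0
  rw [dist_eq_norm, L1.norm_eq_integral_norm] at hk
  have hk' : ∫ x, ‖g x - k x‖ < ε := by
    refine lt_of_eq_of_lt (integral_congr_ae ?_) hk
    filter_upwards [Lp.coeFn_sub g (ContinuousMap.toLp 1 volume ℂ k),
      ContinuousMap.coeFn_toLp (p := 1) (𝕜 := ℂ) volume k] with x h1 h2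
    rw [h1, Pi.sub_apply, h2]
  have hpos : ∀ x, 0 < ‖k x‖ + ε := fun x => by positivity
  have hne : ∀ x, ((‖k x‖ + ε : ℝ) : ℂ) ≠ 0 := fun x => by exact_mod_cast (hpos x).ne'
  let z : C(I, ℂ) := ⟨fun x => k x / ((‖k x‖ + ε : ℝ) : ℂ),
    k.continuous.div (Complex.continuous_ofReal.comp (by fun_prop)) hne⟩
  have hzn : ∀ x, ‖z x‖ ≤ 1 := by
    intro x
    change ‖k x / ((‖k x‖ + ε : ℝ) : ℂ)‖ ≤ 1
    rw [norm_div, Complex.norm_real, Real.norm_of_nonneg (hpos x).le, div_le_one (hpos x)]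
    linarith
  have hz := h z hzn
  have hgi : Integrable g volume := L1.integrable_coeFn g
  have hki : ∀ w : C(I, ℂ), Integrable w volume := fun w =>
    (w.continuous.memLp_of_hasCompactSupport (p := 1) (HasCompactSupport.of_compactSpace _)
      ).integrable le_rfl
  have hkz : ∀ x, k x * conj (z x) = ((‖k x‖ ^ 2 / (‖k x‖ + ε) : ℝ) : ℂ) := by
    intro x
    change k x * conj (k x / ((‖k x‖ + ε : ℝ) : ℂ)) = _
    rw [map_div₀, Complex.conj_ofReal, mul_div_assoc', Complex.mul_conj, Complex.normSq_eq_norm_sq]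
    push_cast
    rfl
  have hci : ∀ {F : I → ℝ}, Continuous F → Integrable F volume := fun {F} hF =>
    (hF.memLp_of_hasCompactSupport (p := 1) (HasCompactSupport.of_compactSpace _)).integrable le_rfl
  have h1 : (∫ x, ‖k x‖) - ε ≤ ‖∫ x, k x * conj (z x)‖ := by
    have e : ∫ x, k x * conj (z x) = ((∫ x, ‖k x‖ ^ 2 / (‖k x‖ + ε) : ℝ) : ℂ) := by
      rw [← integral_complex_ofReal]
      exact integral_congr_ae (.of_forall hkz)
    rw [e, Complex.norm_real]
    refine le_trans ?_ (le_abs_self _)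
    have : (∫ x, ‖k x‖) - ε = ∫ x : I, (‖k x‖ - ε) := by
      rw [integral_sub (hki k).norm (integrable_const _)]
      simp
    rw [this]
    refine integral_mono ((hki k).norm.sub (integrable_const _)) (hci ?_) fun x => ?_
    · exact Continuous.div (by fun_prop) (by fun_prop) fun x => (hpos x).ne'
    · simp only
      rw [le_div_iff₀ (hpos x)]
      nlinarith [norm_nonneg (k x)]
  have h2 : ‖∫ x, k x * conj (z x)‖ ≤ ‖∫ x, g x * conj (z x)‖ + ε := by
    have hi1 := integrable_mul_conj hgi z
    have hi2 := integrable_mul_conj (hki k) z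
    have e : ∫ x, k x * conj (z x) = (∫ x, g x * conj (z x)) - ∫ x, (g x - k x) * conj (z x) := by
      rw [← integral_sub hi1 ((hi1.sub hi2).congr (.of_forall fun x => by simp [sub_mul]))]
      refine integral_congr_ae (.of_forall fun x => ?_)
      simp only
      ring
    rw [e]
    refine (norm_sub_le _ _).trans (add_le_add le_rfl ?_)
    refine (norm_integral_le_integral_norm _).trans (le_trans ?_ hk'.le)
    refine integral_mono_of_nonneg (.of_forall fun x => norm_nonneg _) (hgi.sub (hki k)).norm
      (.of_forall fun x => ?_)
    simp only [norm_mul, RCLike.norm_conj]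
    exact mul_le_of_le_one_right (norm_nonneg _) (hzn x)
  have h3 : ‖g‖ ≤ (∫ x, ‖k x‖) + ε := by
    rw [L1.norm_eq_integral_norm]
    have : ∫ x, ‖g x‖ ≤ ∫ x, (‖k x‖ + ‖g x - k x‖) := by
      refine integral_mono hgi.norm ((hki k).norm.add (hgi.sub (hki k)).norm) fun x => ?_
      calc ‖g x‖ = ‖k x + (g x - k x)‖ := by rw [add_sub_cancel]
        _ ≤ _ := norm_add_le _ _
    have h4 := integral_add (hki k).norm (hgi.sub (hki k)).norm
    simp only [Pi.sub_apply] at h4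
    rw [h4] at this
    linarith
  have : δ = 3 * ε := by rw [hε]; ring
  linarith

/-- The dual function `|g|^{s-2} g` of a function of class `L_s`, `1 < s < ∞`. -/
theorem exists_dual_function {s t : ℝ≥0∞} [Fact (1 ≤ s)] [Fact (1 ≤ t)] [t.HolderConjugate s]
    (hs : s ≠ ∞) (ht : t ≠ ∞) (g : Lp ℂ s (volume : Measure I)) :
    ∃ v : Lp ℂ t (volume : Measure I), (∀ᵐ x : I, g x = 0 → v x = 0) ∧
      ∫ x, g x * conj (v x) = ((‖g‖ ^ s.toReal : ℝ) : ℂ) ∧ ‖v‖ = ‖g‖ ^ (s.toReal - 1) := by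
  have hs0 : s ≠ 0 := (zero_lt_one.trans_le (Fact.out : 1 ≤ s)).ne'
  have ht0 : t ≠ 0 := (zero_lt_one.trans_le (Fact.out : 1 ≤ t)).ne'
  have hst : t.toReal.HolderConjugate s.toReal := by
    have := ENNReal.HolderConjugate.toReal_of_ne_top (p := t) (q := s) ht hs
    exact this
  have hspos : 0 < s.toReal := hst.symm.pos
  have htpos : 0 < t.toReal := hst.pos
  have hs1 : 1 < s.toReal := hst.symm.lt
  have hexp : (s.toReal - 1) * t.toReal = s.toReal := by
    have := hst.symm.sub_one_mul_conj
    exact this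
  set f : I → ℂ := fun x => ((‖g x‖ ^ (s.toReal - 2) : ℝ) : ℂ) * g x with hf
  have hgm := Lp.stronglyMeasurable g
  have hfm : AEStronglyMeasurable f (volume : Measure I) := by
    refine AEStronglyMeasurable.mul ?_ hgm.aestronglyMeasurable
    exact (Complex.measurable_ofReal.comp
      (hgm.norm.measurable.pow_const _)).aestronglyMeasurable
  have hfn : ∀ x, ‖f x‖ = ‖g x‖ ^ (s.toReal - 1) := by
    intro x
    simp only [hf, norm_mul, Complex.norm_real]
    rw [Real.norm_of_nonneg (by positivity)]
    rcases eq_or_ne (g x) 0 with h | h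
    · rw [h, norm_zero, mul_zero, Real.zero_rpow (by linarith)]
    · rw [← Real.rpow_add_one (norm_ne_zero_iff.2 h)]
      congr 1
      ring
  have hfn' : ∀ x, ‖f x‖ₑ ^ t.toReal = ‖g x‖ₑ ^ s.toReal := by
    intro x
    rw [← ofReal_norm, ← ofReal_norm, hfn, ENNReal.ofReal_rpow_of_nonneg (by positivity) htpos.le,
      ENNReal.ofReal_rpow_of_nonneg (by positivity) hspos.le, ← Real.rpow_mul (norm_nonneg _), hexp]
  have hnorm : eLpNorm f t volume = (∫⁻ x, ‖g x‖ₑ ^ s.toReal) ^ (1 / t.toReal) := by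
    rw [eLpNorm_eq_lintegral_rpow_enorm_toReal ht0 ht]
    simp only [hfn']
  have hgnorm : eLpNorm g s volume = (∫⁻ x, ‖g x‖ₑ ^ s.toReal) ^ (1 / s.toReal) :=
    eLpNorm_eq_lintegral_rpow_enorm_toReal hs0 hs
  have hfin : ∫⁻ x, ‖g x‖ₑ ^ s.toReal ≠ ∞ :=
    (eLpNorm_lt_top_iff_lintegral_rpow_enorm_lt_top hs0 hs |>.1 (Lp.eLpNorm_lt_top g)).ne
  set J : ℝ≥0∞ := ∫⁻ x, ‖g x‖ₑ ^ s.toReal with hJ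
  have hgJ : ‖g‖ ^ s.toReal = J.toReal := by
    rw [Lp.norm_def, hgnorm, ENNReal.toReal_rpow, ← ENNReal.rpow_mul, one_div,
      inv_mul_cancel₀ hspos.ne', ENNReal.rpow_one]
  have hfL : MemLp f t volume := ⟨hfm, by
    rw [hnorm]; exact ENNReal.rpow_lt_top_of_nonneg (by positivity) hfin⟩
  refine ⟨hfL.toLp f, ?_, ?_, ?_⟩
  · filter_upwards [hfL.coeFn_toLp] with x hx h
    rw [hx, hf]
    simp [h]
  · have e1 : ∫ x, g x * conj (hfL.toLp f x) = ((∫ x, ‖g x‖ ^ s.toReal : ℝ) : ℂ) := by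
      rw [← integral_complex_ofReal]
      refine integral_congr_ae ?_
      filter_upwards [hfL.coeFn_toLp] with x hx
      rw [hx]
      simp only [hf, map_mul, Complex.conj_ofReal]
      rw [mul_left_comm, Complex.mul_conj, Complex.normSq_eq_norm_sq, ← Complex.ofReal_mul]
      congr 1
      rcases eq_or_ne (g x) 0 with h | h
      · rw [h, norm_zero, Real.zero_rpow hspos.ne']; simp
      · rw [← Real.rpow_natCast, ← Real.rpow_add (norm_pos_iff.2 h)]
        congr 1
        push_cast
        ring
    rw [e1, hgJ, hJ, integral_eq_lintegral_of_nonneg_ae (.of_forall fun x => by positivity)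
      ((hgm.norm.measurable.pow_const _).aestronglyMeasurable)]
    congr 2
    refine lintegral_congr fun x => ?_
    rw [← ofReal_norm, ENNReal.ofReal_rpow_of_nonneg (norm_nonneg _) hspos.le]
  · rw [Lp.norm_toLp, hnorm, ← ENNReal.toReal_rpow, ← hgJ, ← Real.rpow_mul (norm_nonneg _)]
    congr 1
    rw [mul_one_div, div_eq_iff htpos.ne', hexp]

/-- The functions `|a|^{1/t} z` with continuous `z` norm the functions of class `L_s`
that vanish where `a` does. -/
theorem norm_le_of_forall_sesq_weighted_le {s t : ℝ≥0∞} [Fact (1 ≤ s)] [Fact (1 ≤ t)]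
    [t.HolderConjugate s] (hs : s ≠ ∞) {a : I → ℂ} (ha : Integrable a volume)
    {g : Lp ℂ s (volume : Measure I)} (hg : ∀ᵐ x : I, a x = 0 → g x = 0) {c : ℝ}
    (hc : 0 ≤ c) (h : ∀ z : C(I, ℂ), ‖sesq (weighted ha t) g z‖ ≤ c * ‖weighted ha t z‖) :
    ‖g‖ ≤ c := by
  rcases eq_or_ne t ∞ with rfl | ht
  · have hs1 : s = 1 := by
      have := ENNReal.HolderConjugate.conj_eq (p := ∞) (q := s)
      simpa using this
    subst hs1
    have hw : ∀ z : C(I, ℂ), (weighted ha ∞ z : I → ℂ) =ᵐ[volume] z := by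
      intro z
      filter_upwards [coeFn_weighted ha ∞ z] with x hx
      rw [hx, wpow_top, one_mul]
    refine norm_le_of_forall_integral_mul_conj_le fun z hz => ?_
    have h1 := h z
    rw [sesq_apply] at h1
    have e : ∫ x, g x * conj (weighted ha ∞ z x) = ∫ x, g x * conj (z x) := by
      refine integral_congr_ae ?_
      filter_upwards [hw z] with x hx
      rw [hx]
    rw [e] at h1
    refine h1.trans (mul_le_of_le_one_right hc ?_)
    refine Lp.norm_le_of_ae_bound zero_le_one ?_ |>.trans (by simp)
    filter_upwards [hw z] with x hx
    rw [hx]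
    exact hz x
  · obtain ⟨v, hv0, hgv, hvn⟩ := exists_dual_function hs ht g
    have hv : ∀ᵐ x : I, a x = 0 → v x = 0 := by
      filter_upwards [hv0, hg] with x h1 h2 h3 using h1 (h2 h3)
    set S := sesq (s := s) (ContinuousLinearMap.id ℂ (Lp ℂ t (volume : Measure I))) g with hS
    have hSz : ∀ z, ‖S (weighted ha t z)‖ ≤ c * ‖weighted ha t z‖ := by
      intro z
      have := h z
      rw [sesq_apply] at this
      rw [hS, sesq_apply]
      exact this
    -- the estimate passes from the dense set of the `weighted ha t z` to `v`
    have hclosed : IsClosed {w : Lp ℂ t (volume : Measure I) | ‖S w‖ ≤ c * ‖w‖} :=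
      isClosed_le (by fun_prop) (by fun_prop)
    have hvS : v ∈ {w : Lp ℂ t (volume : Measure I) | ‖S w‖ ≤ c * ‖w‖} := by
      rw [← hclosed.closure_eq, Metric.mem_closure_iff]
      intro ε hε
      obtain ⟨z, hz⟩ := exists_weighted_near ha ht v hv hε
      exact ⟨weighted ha t z, hSz z, by rwa [dist_eq_norm]⟩
    have hfin : ‖g‖ ^ s.toReal ≤ c * ‖g‖ ^ (s.toReal - 1) := by
      have := hvS
      simp only [mem_ofPred_eq] at this
      rw [hS, sesq_apply, ContinuousLinearMap.id_apply, hgv, Complex.norm_real, hvn,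
        Real.norm_of_nonneg (by positivity)] at this
      exact this
    rcases (norm_nonneg g).eq_or_lt with h0 | h0
    · rwa [← h0]
    · have e : ‖g‖ ^ s.toReal = ‖g‖ * ‖g‖ ^ (s.toReal - 1) := by
        rw [mul_comm, ← Real.rpow_add_one h0.ne']
        congr 1
        ring
      rw [e] at hfin
      exact le_of_mul_le_mul_right hfin (by positivity)

end QuasiSobolev
end

noncomputable section

namespace QuasiSobolev

/-! ### Linear integral equations and integration by parts -/

theorem continuousMap_eq_inverse_iff {ι : Type*} [Fintype ι] {M : ι → ι → I → ℂ}
    {hM : ∀ i j, MemLp (M i j) 1 volume} {X Φ : ι → C(I, ℂ)} :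
    X = Ring.inverse (1 - volterra M hM) Φ ↔ X = volterra M hM X + Φ := by
  have hu := isUnit_one_sub_volterra M hM
  constructor
  · intro h
    have h1 : (1 - volterra M hM) X = Φ := by
      rw [h, ← mul_apply_eq_comp, Ring.mul_inverse_cancel _ hu]
      rfl
    rw [← h1]
    simp
  · intro h
    have h1 : (1 - volterra M hM) X = Φ := by
      have : (1 - volterra M hM) X = X - volterra M hM X := rfl
      rw [this]
      nth_rewrite 1 [h]
      simp
    rw [← h1, ← mul_apply_eq_comp, Ring.inverse_mul_cancel _ hu]
    rfl

theorem primitive_zero (f : Lp ℂ 1 (volume : Measure I)) : primitive f 0 = 0 := by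
  rw [primitive_apply, setIntegral_Iic_zero]

theorem volterra_zero {ι : Type*} [Fintype ι] (M : ι → ι → I → ℂ)
    (hM : ∀ i j, MemLp (M i j) 1 volume) (X : ι → C(I, ℂ)) (i : ι) :
    volterra M hM X i 0 = 0 := by
  rw [volterra_apply, ContinuousMap.sum_apply]
  exact Finset.sum_eq_zero fun j _ => primitive_zero _

/-- The constant functions, as a bounded operator `ℂ^ι → C[0,1]^ι`. -/
def constVec (ι : Type*) [Fintype ι] : (ι → ℂ) →L[ℂ] (ι → C(I, ℂ)) :=
  LinearMap.toContinuousLinearMap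
    { toFun := fun ξ i => ContinuousMap.const I (ξ i)
      map_add' := fun _ _ => rfl
      map_smul' := fun _ _ => rfl }

@[simp] theorem constVec_apply {ι : Type*} [Fintype ι] (ξ : ι → ℂ) (i : ι) (x : I) :
    constVec ι ξ i x = ξ i := rfl

/-- The pairing `∫ f conj(Z)` of `L_1` and `C[0,1]`. -/
def pairing : Lp ℂ 1 (volume : Measure I) →L[ℂ] (C(I, ℂ) →L⋆[ℂ] ℂ) :=
  sesq (ContinuousMap.toLp ∞ volume ℂ)

theorem pairing_apply (f : Lp ℂ 1 (volume : Measure I)) (Z : C(I, ℂ)) :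
    pairing f Z = ∫ x, f x * conj (Z x) := by
  rw [pairing, sesq_apply]
  refine integral_congr_ae ?_
  filter_upwards [ContinuousMap.coeFn_toLp (p := ∞) (𝕜 := ℂ) volume Z] with x hx
  rw [hx]

/-- Integration by parts for the sesquilinear pairing. -/
theorem mul_conj_sub_eq_pairing {f g : Lp ℂ 1 (volume : Measure I)} {F Z : C(I, ℂ)}
    (hF : ∀ x, F x = F 0 + primitive f x) (hZ : ∀ x, Z x = Z 0 + primitive g x) :
    F 1 * conj (Z 1) - F 0 * conj (Z 0) = pairing f Z + conj (pairing g F) := by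
  have hf : Integrable f volume := L1.integrable_coeFn f
  have hg : Integrable g volume := L1.integrable_coeFn g
  have hgc : Integrable (fun t => conj (g t)) (volume : Measure I) :=
    memLp_one_iff_integrable.1 (memLp_one_iff_integrable.2 hg).star
  have h := integral_mul_integral_eq hf hgc
  have e1 : ∀ t : I, ∫ r in Iic t, conj (g r) = conj (Z t) - conj (Z 0) := by
    intro t
    rw [integral_conj, hZ t, map_add, add_sub_cancel_left, primitive_apply]
  have e2 : ∀ t : I, ∫ r in Iic t, f r = F t - F 0 := by
    intro t
    rw [hF t, add_sub_cancel_left, primitive_apply]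
  have e1' := e1 1
  have e2' := e2 1
  rw [setIntegral_Iic_one] at e1' e2'
  simp only [e1, e2] at h
  have i1 := integrable_mul_conj hf Z
  have i2 : Integrable (fun t => F t * conj (g t)) (volume : Measure I) := by
    refine (hgc.mul_bdd (c := ‖F‖) F.continuous.aestronglyMeasurable
      (.of_forall fun t => F.norm_coe_le_norm t)).congr (.of_forall fun t => ?_)
    simp only
    ring
  have h1 : ∫ t, f t * (conj (Z t) - conj (Z 0)) =
      (∫ t, f t * conj (Z t)) - (F 1 - F 0) * conj (Z 0) := by
    rw [← e2', ← integral_mul_const, ← integral_sub i1 (hf.mul_const _)]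
    simp only [mul_sub]
  have h2 : ∫ t, (F t - F 0) * conj (g t) =
      (∫ t, F t * conj (g t)) - F 0 * (conj (Z 1) - conj (Z 0)) := by
    rw [← e1', ← integral_const_mul, ← integral_sub i2 (hgc.const_mul _)]
    simp only [sub_mul]
  have h3 : conj (pairing g F) = ∫ t, F t * conj (g t) := by
    rw [pairing_apply, ← integral_conj]
    refine integral_congr_ae (.of_forall fun t => ?_)
    simp only [map_mul, Complex.conj_conj]
    ring
  rw [h1, h2, e1', e2'] at h
  rw [pairing_apply, h3]
  linear_combination h

/-! ### Solutions of the system -/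

variable (A : CoeffSystem) (n : ℕ)

/-- The leading coefficient `A_{n-1,n}`. -/
abbrev CoeffSystem.top : I → ℂ := A (n - 1) n

theorem integrable_top : Integrable (A.top n) volume :=
  A.integrable_coeff (n - 1) n (by omega)

/-- The function `A_{n-1,n} |A_{n-1,n}|^{-1/p}`, the coefficient of `|A_{n-1,n}|^{1/p} Y_n` in the
equation for `Y_{n-1}`; it is zero where `A_{n-1,n}` is. -/
def lead (p : ℝ≥0∞) (x : I) : ℂ := A.top n x * ((‖A.top n x‖ ^ (-(1 / p.toReal)) : ℝ) : ℂ)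

variable {A n} in
theorem lead_eq_zero {p : ℝ≥0∞} {x : I} (h : A.top n x = 0) : lead A n p x = 0 := by
  simp [lead, h]

variable {A n} in
theorem lead_ne_zero {p : ℝ≥0∞} {x : I} (h : A.top n x ≠ 0) : lead A n p x ≠ 0 := by
  have : 0 < ‖A.top n x‖ ^ (-(1 / p.toReal)) := Real.rpow_pos_of_pos (norm_pos_iff.2 h) _
  have h2 : ((‖A.top n x‖ ^ (-(1 / p.toReal)) : ℝ) : ℂ) ≠ 0 := by exact_mod_cast this.ne'
  exact mul_ne_zero h h2

theorem lead_mul_wpow (p : ℝ≥0∞) (x : I) : lead A n p x * wpow (A.top n) p x = A.top n x := by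
  by_cases h : A.top n x = 0
  · rw [lead_eq_zero h, h, zero_mul]
  · rw [lead, wpow, mul_assoc, ← Complex.ofReal_mul, Real.rpow_neg (norm_nonneg _),
      inv_mul_cancel₀ (Real.rpow_pos_of_pos (norm_pos_iff.2 h) _).ne', Complex.ofReal_one, mul_one]

theorem one_div_toReal_add {p q : ℝ≥0∞} [p.HolderConjugate q] :
    1 / p.toReal + 1 / q.toReal = 1 := by
  have h := ENNReal.HolderConjugate.inv_add_inv_eq_one p q
  have hp : p⁻¹ ≠ ∞ := fun hh => by simp [hh] at h
  have hq : q⁻¹ ≠ ∞ := fun hh => by simp [hh] at h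
  have := congrArg ENNReal.toReal h
  rw [ENNReal.toReal_add hp hq, ENNReal.toReal_inv, ENNReal.toReal_inv] at this
  simpa using this

theorem memLp_lead (p : ℝ≥0∞) {q : ℝ≥0∞} [Fact (1 ≤ q)] [p.HolderConjugate q] :
    MemLp (lead A n p) q volume := by
  have hA := integrable_top A n
  refine (memLp_wpow hA q).of_le ?_ (.of_forall fun x => ?_)
  · exact hA.aestronglyMeasurable.mul (Complex.measurable_ofReal.comp_aemeasurable
      (hA.aestronglyMeasurable.norm.aemeasurable.pow_const _)).aestronglyMeasurable
  · by_cases h : A.top n x = 0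
    · rw [lead_eq_zero h, norm_zero]
      exact norm_nonneg _
    · rw [lead, wpow, norm_mul, Complex.norm_real, Complex.norm_real,
        Real.norm_of_nonneg (by positivity), Real.norm_of_nonneg (by positivity)]
      refine le_of_eq ?_
      nth_rewrite 1 [← Real.rpow_one ‖A.top n x‖]
      rw [← Real.rpow_add (norm_pos_iff.2 h)]
      congr 1
      have := one_div_toReal_add (p := p) (q := q)
      linarith

/-- The square matrix of the coefficients of `Y_0, …, Y_{n-1}` in the system. -/
def sysMat (i j : Fin n) : I → ℂ := if (j : ℕ) ≤ i + 1 then A i j else 0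

theorem memLp_sysMat (i j : Fin n) : MemLp (sysMat A n i j) 1 volume := by
  rw [sysMat]
  split_ifs with h
  · exact memLp_one_iff_integrable.2 (A.integrable_coeff i j h)
  · exact MemLp.zero

/-- The matrix of the adjoint system. -/
def adjMat (i j : Fin n) : I → ℂ := fun x => -conj (sysMat A n j i x)

theorem memLp_adjMat (i j : Fin n) : MemLp (adjMat A n i j) 1 volume :=
  (memLp_sysMat A n j i).star.neg

/-- The integral operator of the system. -/
abbrev sysOp : (Fin n → C(I, ℂ)) →L[ℂ] (Fin n → C(I, ℂ)) :=
  volterra (sysMat A n) (memLp_sysMat A n)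

/-- The integral operator of the adjoint system. -/
abbrev adjOp : (Fin n → C(I, ℂ)) →L[ℂ] (Fin n → C(I, ℂ)) :=
  volterra (adjMat A n) (memLp_adjMat A n)

section

variable (p q : ℝ≥0∞) [Fact (1 ≤ p)] [Fact (1 ≤ q)] [p.HolderConjugate q]

/-- The contribution of `u = |A_{n-1,n}|^{1/p} Y_n` to the integrated system. -/
def forcing : Lp ℂ p (volume : Measure I) →L[ℂ] (Fin n → C(I, ℂ)) :=
  haveI : q.HolderConjugate p := ENNReal.HolderConjugate.symm
  ContinuousLinearMap.pi fun i => if (i : ℕ) + 1 = n then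
    primitive.comp (mulLp (r := 1) (lead A n p) (memLp_lead A n p (q := q))) else 0

variable {q} in
/-- `Y` solves the system with `|A_{n-1,n}|^{1/p} Y_n = u`. -/
def IsSol (u : Lp ℂ p (volume : Measure I)) (Y : Fin n → C(I, ℂ)) : Prop :=
  Y = sysOp A n Y + (constVec (Fin n) (fun i => Y i 0) + forcing A n p q u)

variable {A n p q}

theorem forcing_zero_apply (u : Lp ℂ p (volume : Measure I)) (i : Fin n) :
    forcing A n p q u i 0 = 0 := by
  simp only [forcing, ContinuousLinearMap.coe_pi']
  split_ifs
  · exact primitive_zero _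
  · rfl

variable (A n p q) in
/-- The solution with initial value `ξ`, as a bounded operator. -/
def solve : ((Fin n → ℂ) × Lp ℂ p (volume : Measure I)) →L[ℂ] (Fin n → C(I, ℂ)) :=
  (Ring.inverse (1 - sysOp A n)).comp ((constVec (Fin n)).coprod (forcing A n p q))

theorem solve_eq (ξ : Fin n → ℂ) (u : Lp ℂ p (volume : Measure I)) :
    solve A n p q (ξ, u) = sysOp A n (solve A n p q (ξ, u)) +
      (constVec (Fin n) ξ + forcing A n p q u) :=
  continuousMap_eq_inverse_iff.1 rfl

theorem solve_initial (ξ : Fin n → ℂ) (u : Lp ℂ p (volume : Measure I)) (i : Fin n) :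
    solve A n p q (ξ, u) i 0 = ξ i := by
  rw [solve_eq]
  simp [volterra_zero, forcing_zero_apply]

theorem isSol_solve (ξ : Fin n → ℂ) (u : Lp ℂ p (volume : Measure I)) :
    IsSol A n p (q := q) u (solve A n p q (ξ, u)) := by
  have := solve_eq (A := A) (q := q) ξ u
  simp only [IsSol, solve_initial]
  exact this

theorem IsSol.eq_solve {u : Lp ℂ p (volume : Measure I)} {Y : Fin n → C(I, ℂ)}
    (h : IsSol A n p (q := q) u Y) : Y = solve A n p q (fun i => Y i 0, u) :=
  continuousMap_eq_inverse_iff.2 h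

variable (A n p q) in
/-- The operator `H ↦ conj(a) H_{n-1}`, `a` the coefficient `lead`, which appears in the adjoint
identity. -/
def adjTop : (Fin n → C(I, ℂ)) →L[ℂ] Lp ℂ q (volume : Measure I) :=
  ∑ i : Fin n, if (i : ℕ) + 1 = n then
    (mulC (fun x => conj (lead A n p x)) (memLp_lead A n p (q := q)).star).comp
      (ContinuousLinearMap.proj i) else 0

theorem adjTop_ae (H : Fin n → C(I, ℂ)) : ∀ᵐ x : I, A.top n x = 0 → adjTop A n p q H x = 0 := by
  rcases Nat.eq_zero_or_pos n with rfl | hn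
  · simp only [adjTop, Finset.univ_eq_empty, Finset.sum_empty]
    filter_upwards [Lp.coeFn_zero ℂ q (volume : Measure I)] with x hx _ using hx
  · have e : adjTop A n p q H = mulC (fun x => conj (lead A n p x))
        (memLp_lead A n p (q := q)).star (H ⟨n - 1, by omega⟩) := by
      rw [adjTop, Finset.sum_eq_single ⟨n - 1, by omega⟩]
      · rw [if_pos (by simp; omega)]; rfl
      · intro b _ hb
        rw [if_neg]
        intro hb'
        exact hb (Fin.ext (by simp; omega))
      · simp
    rw [e]
    filter_upwards [coeFn_mulC (fun x => conj (lead A n p x)) (memLp_lead A n p (q := q)).star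
      (H ⟨n - 1, by omega⟩)] with x hx h
    rw [hx]
    simp only [lead_eq_zero h, map_zero, zero_mul]

theorem pairing_mulC_adjMat (i j : Fin n) (H Z : C(I, ℂ)) :
    pairing (mulC (adjMat A n i j) (memLp_adjMat A n i j) H) Z =
      -conj (pairing (mulC (sysMat A n j i) (memLp_sysMat A n j i) Z) H) := by
  rw [pairing_apply, pairing_apply, ← integral_conj, ← integral_neg]
  refine integral_congr_ae ?_
  filter_upwards [coeFn_mulC (adjMat A n i j) (memLp_adjMat A n i j) H,
    coeFn_mulC (sysMat A n j i) (memLp_sysMat A n j i) Z] with x h1 h2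
  rw [h1, h2]
  simp only [adjMat, map_mul, Complex.conj_conj]
  ring

/-- The adjoint identity: integration by parts of a solution `Z` of the system against a
solution `H` of the inhomogeneous adjoint system. -/
theorem adjoint_identity {u : Lp ℂ p (volume : Measure I)} {Z : Fin n → C(I, ℂ)}
    (hZ : IsSol A n p (q := q) u Z) {b : Fin n → Lp ℂ 1 (volume : Measure I)}
    {H : Fin n → C(I, ℂ)}
    (hH : H = adjOp A n H + (constVec (Fin n) (fun i => H i 0) + fun i => primitive (b i))) :
    ∑ i, H i 1 * conj (Z i 1) - ∑ i, H i 0 * conj (Z i 0) =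
      (∑ i, pairing (b i) (Z i)) +
        ∫ x, adjTop A n p q H x * conj (u x) := by
  have : q.HolderConjugate p := ENNReal.HolderConjugate.symm
  set L : Lp ℂ p (volume : Measure I) →L[ℂ] Lp ℂ 1 (volume : Measure I) :=
    mulLp (lead A n p) (memLp_lead A n p (q := q)) with hL
  set f : Fin n → Lp ℂ 1 (volume : Measure I) := fun i =>
    b i + ∑ j, mulC (adjMat A n i j) (memLp_adjMat A n i j) (H j) with hf
  set g : Fin n → Lp ℂ 1 (volume : Measure I) := fun i =>
    (if (i : ℕ) + 1 = n then L u else 0) +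
      ∑ j, mulC (sysMat A n i j) (memLp_sysMat A n i j) (Z j) with hg
  have hHf : ∀ i x, H i x = H i 0 + primitive (f i) x := by
    intro i x
    have h1 := congrArg (fun F => F i x) hH
    simp only [Pi.add_apply, ContinuousMap.add_apply, volterra_apply, constVec_apply] at h1
    rw [h1, hf]
    simp only [map_add, map_sum, ContinuousMap.add_apply]
    ring
  have hZg : ∀ i x, Z i x = Z i 0 + primitive (g i) x := by
    intro i x
    have h1 := congrArg (fun F => F i x) hZ
    simp only [Pi.add_apply, ContinuousMap.add_apply, volterra_apply, constVec_apply] at h1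
    have h2 : forcing A n p q u i = primitive (if (i : ℕ) + 1 = n then L u else 0) := by
      simp only [forcing, ContinuousLinearMap.coe_pi']
      split_ifs
      · rfl
      · simp
    rw [h1, hg, h2]
    simp only [map_add, map_sum, ContinuousMap.add_apply]
    ring
  have key : ∀ i, H i 1 * conj (Z i 1) - H i 0 * conj (Z i 0) =
      pairing (f i) (Z i) + conj (pairing (g i) (H i)) := fun i =>
    mul_conj_sub_eq_pairing (hHf i) (hZg i)
  rw [← Finset.sum_sub_distrib, Finset.sum_congr rfl fun i _ => key i, Finset.sum_add_distrib]
  have e1 : ∑ i, pairing (f i) (Z i) = (∑ i, pairing (b i) (Z i)) -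
      ∑ i, ∑ j, conj (pairing (mulC (sysMat A n i j) (memLp_sysMat A n i j) (Z j)) (H i)) := by
    rw [Finset.sum_comm, ← Finset.sum_sub_distrib]
    refine Finset.sum_congr rfl fun i _ => ?_
    simp only [hf, map_add, map_sum, add_apply, sum_apply]
    rw [sub_eq_add_neg, ← Finset.sum_neg_distrib]
    congr 1
    exact Finset.sum_congr rfl fun j _ => pairing_mulC_adjMat i j (H j) (Z i)
  have e2 : ∑ i, conj (pairing (g i) (H i)) =
      (∫ x, adjTop A n p q H x * conj (u x)) +
      ∑ i, ∑ j, conj (pairing (mulC (sysMat A n i j) (memLp_sysMat A n i j) (Z j)) (H i)) := by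
    simp only [hg, map_add, map_sum, add_apply, sum_apply]
    rw [Finset.sum_add_distrib]
    congr 1
    have e3 := sesq_apply (s := q) (t := p)
      (ContinuousLinearMap.id ℂ (Lp ℂ p (volume : Measure I))) (adjTop A n p q H) u
    simp only [ContinuousLinearMap.id_apply] at e3
    rw [← e3]
    simp only [adjTop, sum_apply, map_sum]
    refine Finset.sum_congr rfl fun i _ => ?_
    split_ifs with hi
    · rw [pairing_apply, ← integral_conj, sesq_apply]
      refine integral_congr_ae ?_
      filter_upwards [coeFn_mulLp (r := 1) (lead A n p) (memLp_lead A n p (q := q)) u,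
        coeFn_mulC (fun x => conj (lead A n p x)) (memLp_lead A n p (q := q)).star (H i)]
        with x h1 h2
      simp only [ContinuousLinearMap.comp_apply, ContinuousLinearMap.proj_apply,
        ContinuousLinearMap.id_apply]
      rw [hL, h1, h2]
      simp only [map_mul, Complex.conj_conj]
      ring
    · simp
  rw [e1, e2]
  ring

end

end QuasiSobolev
end

noncomputable section

namespace QuasiSobolev

/-! ### The adjoint system and controllability -/

variable (A : CoeffSystem) (n : ℕ)

/-- The solution of the adjoint system `H' = b + adjMat H`, `H(0) = h`. -/
def adjSolve : ((Fin n → ℂ) × (Fin n → Lp ℂ 1 (volume : Measure I))) →L[ℂ] (Fin n → C(I, ℂ)) :=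
  (Ring.inverse (1 - adjOp A n)).comp ((constVec (Fin n)).coprod
    (ContinuousLinearMap.pi fun i => primitive.comp (ContinuousLinearMap.proj i)))

variable {A n}

theorem adjSolve_eq' (h : Fin n → ℂ) (b : Fin n → Lp ℂ 1 (volume : Measure I)) :
    adjSolve A n (h, b) = adjOp A n (adjSolve A n (h, b)) +
      (constVec (Fin n) h + fun i => primitive (b i)) :=
  continuousMap_eq_inverse_iff.1 rfl

theorem adjSolve_initial (h : Fin n → ℂ) (b : Fin n → Lp ℂ 1 (volume : Measure I)) (i : Fin n) :
    adjSolve A n (h, b) i 0 = h i := by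
  rw [adjSolve_eq']
  simp [volterra_zero, primitive_zero]

theorem adjSolve_eq (h : Fin n → ℂ) (b : Fin n → Lp ℂ 1 (volume : Measure I)) :
    adjSolve A n (h, b) = adjOp A n (adjSolve A n (h, b)) +
      (constVec (Fin n) (fun i => adjSolve A n (h, b) i 0) + fun i => primitive (b i)) := by
  simp only [adjSolve_initial]
  exact adjSolve_eq' h b

/-- The adjoint identity for solutions of the homogeneous adjoint system. -/
theorem adjoint_identity_homogeneous {p q : ℝ≥0∞} [Fact (1 ≤ p)] [Fact (1 ≤ q)]
    [p.HolderConjugate q] {u : Lp ℂ p (volume : Measure I)} {Z : Fin n → C(I, ℂ)}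
    (hZ : IsSol A n p (q := q) u Z) (h : Fin n → ℂ) :
    ∑ i, adjSolve A n (h, 0) i 1 * conj (Z i 1) - ∑ i, h i * conj (Z i 0) =
      ∫ x, adjTop A n p q (adjSolve A n (h, 0)) x * conj (u x) := by
  have := adjoint_identity hZ (adjSolve_eq h 0)
  simpa [adjSolve_initial] using this

/-- The terminal values of the solutions of the homogeneous adjoint system are arbitrary: as
`∑ H_i conj(Z_i)` is constant for the solutions `Z` of the homogeneous system, the map
`H(0) ↦ H(1)` is injective. -/
theorem exists_adjSolve_terminal (η : Fin n → ℂ) :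
    ∃ h : Fin n → ℂ, ∀ i, adjSolve A n (h, 0) i 1 = η i := by
  let Φ : (Fin n → ℂ) →ₗ[ℂ] (Fin n → ℂ) :=
    { toFun := fun h i => adjSolve A n (h, 0) i 1
      map_add' := fun h h' => by
        funext i
        have : ((h + h', 0) : (Fin n → ℂ) × (Fin n → Lp ℂ 1 (volume : Measure I))) =
          (h, 0) + (h', 0) := by simp
        rw [this, map_add]
        rfl
      map_smul' := fun c h => by
        funext i
        have : ((c • h, 0) : (Fin n → ℂ) × (Fin n → Lp ℂ 1 (volume : Measure I))) =
          c • (h, 0) := by simp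
        rw [this, map_smul]
        rfl }
  have hinj : Function.Injective Φ := by
    rw [← LinearMap.ker_eq_bot, LinearMap.ker_eq_bot']
    intro h hh
    funext i
    have key := adjoint_identity_homogeneous (isSol_solve (A := A) (n := n) (p := 1) (q := ∞)
      (Pi.single i 1) 0) h
    have h1 : ∀ j, adjSolve A n (h, 0) j 1 = 0 := fun j => congrFun hh j
    simp only [h1, zero_mul, Finset.sum_const_zero, solve_initial, zero_sub] at key
    have h2 : ∫ x, adjTop A n 1 ∞ (adjSolve A n (h, 0)) x *
        conj ((0 : Lp ℂ 1 (volume : Measure I)) x) = 0 := by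
      rw [← integral_zero I ℂ (μ := volume)]
      refine integral_congr_ae ?_
      filter_upwards [Lp.coeFn_zero ℂ 1 (volume : Measure I)] with x hx
      rw [hx]
      simp
    rw [h2, neg_eq_zero, Finset.sum_eq_single i (fun j _ hj => by simp [hj]) (by simp)] at key
    simpa using key
  obtain ⟨h, hh⟩ := LinearMap.injective_iff_surjective.1 hinj η
  exact ⟨h, fun i => congrFun hh i⟩

/-- A continuous function that vanishes almost everywhere where `a` does not is zero, if the
primitive of `|a|` is strictly monotone. -/
theorem eq_zero_of_strictMono {a : I → ℂ} (ha : Integrable a volume)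
    (hmono : StrictMono fun x : I => ∫ t in Iic x, ‖a t‖) {F : C(I, ℂ)}
    (hF : ∀ᵐ x : I, a x = 0 ∨ F x = 0) : F = 0 := by
  ext x₀
  by_contra hne
  have hopen : IsOpen {x : I | F x ≠ 0} := isOpen_ne_fun F.continuous continuous_const
  obtain ⟨x, y, hxy, hsub⟩ : ∃ x y : I, x < y ∧ Ioc x y ⊆ {x : I | F x ≠ 0} := by
    have hnhds := hopen.mem_nhds (x := x₀) hne
    rcases eq_or_ne x₀ 0 with rfl | h0
    · obtain ⟨y, hy, hsub⟩ := exists_Ico_subset_of_mem_nhds hnhds ⟨1, zero_lt_one⟩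
      obtain ⟨z, hz1, hz2⟩ := exists_between hy
      exact ⟨0, z, hz1, fun w hw => hsub ⟨hw.1.le, hw.2.trans_lt hz2⟩⟩
    · obtain ⟨x, hx, hsub⟩ := exists_Ioc_subset_of_mem_nhds hnhds
        ⟨0, lt_of_le_of_ne x₀.2.1 fun h => h0 h.symm⟩
      exact ⟨x, x₀, hx, hsub⟩
  have h := hmono hxy
  have hz : ∫ t in Ioc x y, ‖a t‖ = 0 := by
    rw [← integral_zero I ℝ (μ := volume.restrict (Ioc x y))]
    refine setIntegral_congr_ae measurableSet_Ioc ?_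
    filter_upwards [hF] with t ht hts
    rw [ht.resolve_right (hsub hts), norm_zero]
  have hu := setIntegral_union (f := fun t => ‖a t‖) (μ := volume) (s := Iic x) (t := Ioc x y)
    (disjoint_left.2 fun t h1 h2 => not_lt.2 h1 h2.1) measurableSet_Ioc
    ha.norm.integrableOn ha.norm.integrableOn
  rw [Iic_union_Ioc_eq_Iic hxy.le, hz, add_zero] at hu
  simp only [hu, lt_self_iff_false] at h

/-- Observability of the adjoint system: a solution `H` is zero as soon as
`A_{n-1,n} H_{n-1}` is. -/
theorem adjSolve_eq_zero (hA : A.StrictMonoUpTo n) {p q : ℝ≥0∞} [Fact (1 ≤ p)] [Fact (1 ≤ q)]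
    [p.HolderConjugate q] {h : Fin n → ℂ} (hh : adjTop A n p q (adjSolve A n (h, 0)) = 0) :
    h = 0 := by
  set H := adjSolve A n (h, 0) with hH
  have key : ∀ d : ℕ, ∀ i : Fin n, n ≤ i + d → H i = 0 := by
    intro d
    induction d with
    | zero => intro i hi; exact absurd i.2 (by omega)
    | succ d ih =>
      intro i hi
      have hAi := hA i i.2
      rcases Nat.lt_or_ge ((i : ℕ) + 1) n with hlt | hge
      · -- the equation for `H_{i+1} = 0` reduces to `conj(A_{i,i+1}) H_i = 0`
        set k : Fin n := ⟨i + 1, hlt⟩ with hk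
        have hH0 : ∀ l : Fin n, k ≤ l → H l = 0 := fun l hl => ih l (by
          have : (i : ℕ) + 1 ≤ l := hl
          omega)
        have heq := congrArg (fun F => F k) (adjSolve_eq (A := A) h 0)
        have hk0 : adjSolve A n (h, 0) k = 0 := hH0 k le_rfl
        simp only [Pi.add_apply, volterra_apply, hk0, Pi.zero_apply, map_zero, add_zero] at heq
        rw [Finset.sum_eq_single i] at heq
        · have hc : constVec (Fin n) (fun j => adjSolve A n (h, 0) j 0) k = 0 := by
            ext x
            simp [hk0]
          rw [hc, add_zero] at heq
          have hp := ae_eq_zero_of_primitive_eq_zero (L1.integrable_coeFn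
            (mulC (adjMat A n k i) (memLp_adjMat A n k i) (H i))) fun x => by
              rw [← primitive_apply, hH, ← heq]; rfl
          refine eq_zero_of_strictMono (A.integrable_coeff i (i + 1) le_rfl) hAi ?_
          filter_upwards [hp, coeFn_mulC (adjMat A n k i) (memLp_adjMat A n k i) (H i)] with x h1 h2
          rw [h1] at h2
          simp only [adjMat, sysMat, hk, le_refl, if_true, Pi.zero_apply] at h2
          rcases mul_eq_zero.1 h2.symm with h3 | h3
          · left; simpa using h3
          · right; exact h3
        · intro l _ hl
          rcases lt_or_gt_of_ne hl with hl | hl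
          · have h1 : ¬ ((k : ℕ) ≤ l + 1) := by
              have : (l : ℕ) < i := hl
              simp only [hk]
              omega
            have h2 : mulC (adjMat A n k l) (memLp_adjMat A n k l)
                (adjSolve A n (h, 0) l) = 0 := by
              refine Lp.ext ((coeFn_mulC _ _ _).trans ?_)
              filter_upwards [Lp.coeFn_zero ℂ 1 (volume : Measure I)] with x hx
              rw [hx]
              simp [adjMat, sysMat, h1]
            rw [h2, map_zero]
          · have h1 : adjSolve A n (h, 0) l = 0 := hH0 l (by
              have : (i : ℕ) < l := hl
              change (i : ℕ) + 1 ≤ l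
              omega)
            rw [h1, map_zero, map_zero]
        · simp
      · have hi' : (i : ℕ) + 1 = n := by omega
        have e : adjTop A n p q H = mulC (fun x => conj (lead A n p x))
            (memLp_lead A n p (q := q)).star (H i) := by
          rw [adjTop, sum_apply, Finset.sum_eq_single i]
          · rw [if_pos hi']; rfl
          · intro b _ hb
            rw [if_neg]
            · rfl
            · intro hb'
              exact hb (Fin.ext (by omega))
          · simp
        rw [e] at hh
        refine eq_zero_of_strictMono (A.integrable_coeff i (i + 1) le_rfl) hAi ?_
        have h1 := coeFn_mulC (fun x => conj (lead A n p x)) (memLp_lead A n p (q := q)).star (H i)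
        rw [hh] at h1
        have htop : A.top n = A i (i + 1) := by
          rw [CoeffSystem.top, show n - 1 = (i : ℕ) by omega]
          exact congrArg (A.coeff i) hi'.symm
        filter_upwards [h1, Lp.coeFn_zero ℂ q (volume : Measure I)] with x hx h0
        rw [h0] at hx
        rcases mul_eq_zero.1 hx.symm with h3 | h3
        · left
          by_contra hcon
          rw [← htop] at hcon
          exact lead_ne_zero (p := p) hcon (by simpa using h3)
        · right; exact h3
  funext i
  rw [← adjSolve_initial (A := A) h 0 i, ← hH, key n i (by omega)]
  rfl

variable (A n) in
/-- The value at `1` of the solution with `Y(0) = 0` and given `u = |A_{n-1,n}|^{1/p} Y_n`. -/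
def endpoint (p q : ℝ≥0∞) [Fact (1 ≤ p)] [Fact (1 ≤ q)] [p.HolderConjugate q] :
    Lp ℂ p (volume : Measure I) →L[ℂ] (Fin n → ℂ) :=
  (ContinuousLinearMap.pi fun i => (ContinuousMap.evalCLM ℂ (1 : I)).comp
    (ContinuousLinearMap.proj i)).comp
    ((solve A n p q).comp (ContinuousLinearMap.inr ℂ (Fin n → ℂ) (Lp ℂ p (volume : Measure I))))

theorem endpoint_apply {p q : ℝ≥0∞} [Fact (1 ≤ p)] [Fact (1 ≤ q)] [p.HolderConjugate q]
    (u : Lp ℂ p (volume : Measure I)) (i : Fin n) :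
    endpoint A n p q u i = solve A n p q (0, u) i 1 := rfl

/-- If `∫ g conj(|A_{n-1,n}|^{1/p} z) = 0` for all continuous `z`, then `g = 0`. -/
theorem eq_zero_of_sesq_weighted_eq_zero {p q : ℝ≥0∞} [Fact (1 ≤ p)] [Fact (1 ≤ q)]
    [p.HolderConjugate q] {g : Lp ℂ q (volume : Measure I)}
    (hg : ∀ᵐ x : I, A.top n x = 0 → g x = 0)
    (h : ∀ z : C(I, ℂ), ∫ x, g x * conj (weighted (integrable_top A n) p z x) = 0) : g = 0 := by
  have hw : MemLp (fun x => conj (wpow (A.top n) p x)) p volume :=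
    (memLp_wpow (integrable_top A n) p).star
  set f : Lp ℂ 1 (volume : Measure I) := mulLp (fun x => conj (wpow (A.top n) p x)) hw g with hf
  have hfg := coeFn_mulLp (r := 1) (fun x => conj (wpow (A.top n) p x)) hw g
  have hf0 : f = 0 := by
    rw [← norm_le_zero_iff]
    refine norm_le_of_forall_integral_mul_conj_le fun z _ => ?_
    rw [norm_le_zero_iff, ← h z]
    refine integral_congr_ae ?_
    filter_upwards [hfg, coeFn_weighted (integrable_top A n) p z] with x h1 h2
    rw [h1, h2, map_mul]
    ring
  refine Lp.ext ?_
  rw [← hf, hf0] at hfg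
  filter_upwards [hfg, hg, Lp.coeFn_zero ℂ 1 (volume : Measure I),
    Lp.coeFn_zero ℂ q (volume : Measure I)] with x h1 h2 h3 h4
  rw [h4, Pi.zero_apply]
  by_cases hx : A.top n x = 0
  · exact h2 hx
  · rw [h3, Pi.zero_apply] at h1
    refine (mul_eq_zero.1 h1.symm).resolve_left fun h5 => wpow_ne_zero (p := p) hx ?_
    simpa using h5

/-- Controllability: the endpoint values of the solutions with `Y(0) = 0` and continuous `Y_n`
are arbitrary. A linear form that vanishes on them gives, by the adjoint identity, a solution of
the homogeneous adjoint system to which observability applies. -/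
theorem surjective_endpoint_weighted (hA : A.StrictMonoUpTo n) (p : ℝ≥0∞) {q : ℝ≥0∞}
    [Fact (1 ≤ p)] [Fact (1 ≤ q)] [p.HolderConjugate q] :
    Function.Surjective ((endpoint A n p q).comp (weighted (integrable_top A n) p)) := by
  set Φ := (endpoint A n p q).comp (weighted (integrable_top A n) p) with hΦ
  change Function.Surjective Φ.toLinearMap
  rw [← LinearMap.range_eq_top]
  by_contra hcon
  obtain ⟨f, hf0, hf⟩ := Submodule.exists_le_ker_of_lt_top _ (lt_top_iff_ne_top.2 hcon)
  obtain ⟨h, hh⟩ := exists_adjSolve_terminal (A := A) fun i : Fin n => conj (f (Pi.single i 1))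
  have hfΦ : ∀ z, f (Φ z) = 0 := fun z => hf ⟨z, rfl⟩
  have h0 : h = 0 := by
    refine adjSolve_eq_zero hA (p := p) (q := q) ?_
    refine eq_zero_of_sesq_weighted_eq_zero (p := p) (adjTop_ae _) fun z => ?_
    have key := adjoint_identity_homogeneous (isSol_solve (A := A) (n := n) (p := p) (q := q) 0
      (weighted (integrable_top A n) p z)) h
    rw [← key]
    simp only [solve_initial, Pi.zero_apply, map_zero, mul_zero, Finset.sum_const_zero, sub_zero,
      hh]
    have h1 := hfΦ z
    rw [← Finset.univ_sum_single (Φ z), map_sum] at h1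
    have h2 := congrArg conj h1
    rw [map_sum, map_zero] at h2
    rw [← h2]
    refine Finset.sum_congr rfl fun i _ => ?_
    have h3 : Pi.single i (Φ z i) = Φ z i • (Pi.single i 1 : Fin n → ℂ) := by
      rw [← Pi.single_smul]; simp
    rw [h3, map_smul, smul_eq_mul, map_mul, mul_comm]
    rfl
  apply hf0
  refine LinearMap.pi_ext' fun i => LinearMap.ext_ring ?_
  have := hh i
  rw [h0] at this
  have h1 : adjSolve A n ((0 : Fin n → ℂ), 0) = 0 := map_zero _
  rw [h1] at this
  have h2 := congrArg conj this
  simpa using h2.symm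

/-- The system in integral form, with the forcing term written out. -/
theorem isSol_iff {p q : ℝ≥0∞} [Fact (1 ≤ p)] [Fact (1 ≤ q)] [p.HolderConjugate q]
    {u : Lp ℂ p (volume : Measure I)} {Y : Fin n → C(I, ℂ)} :
    IsSol A n p (q := q) u Y ↔ ∀ i x, Y i x = Y i 0 + ∫ t in Iic x,
      ((∑ j, sysMat A n i j t * Y j t) + if (i : ℕ) + 1 = n then lead A n p t * u t else 0) := by
  have : q.HolderConjugate p := ENNReal.HolderConjugate.symm
  have key : ∀ i x, (sysOp A n Y + (constVec (Fin n) (fun i => Y i 0) + forcing A n p q u)) i x =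
      Y i 0 + ∫ t in Iic x, ((∑ j, sysMat A n i j t * Y j t) +
        if (i : ℕ) + 1 = n then lead A n p t * u t else 0) := by
    intro i x
    set L : Lp ℂ p (volume : Measure I) →L[ℂ] Lp ℂ 1 (volume : Measure I) :=
      mulLp (lead A n p) (memLp_lead A n p (q := q)) with hL
    have h2 : forcing A n p q u i = primitive (if (i : ℕ) + 1 = n then L u else 0) := by
      simp only [forcing, ContinuousLinearMap.coe_pi']
      split_ifs
      · rfl
      · simp
    have e1 : ∫ t in Iic x, ∑ j, sysMat A n i j t * Y j t =
        ∑ j, primitive (mulC (sysMat A n i j) (memLp_sysMat A n i j) (Y j)) x := by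
      rw [integral_finsetSum]
      · exact Finset.sum_congr rfl fun j _ => (primitive_mulC_apply _ _ _ _).symm
      · intro j _
        exact ((L1.integrable_coeFn _).congr
          (coeFn_mulC (sysMat A n i j) (memLp_sysMat A n i j) (Y j))).restrict
    have e2 : ∀ᵐ t : I, (if (i : ℕ) + 1 = n then L u else 0 : Lp ℂ 1 (volume : Measure I)) t =
        if (i : ℕ) + 1 = n then lead A n p t * u t else 0 := by
      split_ifs
      · exact coeFn_mulLp _ _ _
      · exact Lp.coeFn_zero ℂ 1 (volume : Measure I)
    simp only [Pi.add_apply, ContinuousMap.add_apply, constVec_apply, volterra_apply, h2,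
      ContinuousMap.sum_apply]
    rw [integral_add, e1, primitive_apply, integral_congr_ae (ae_restrict_of_ae e2)]
    · ring
    · refine (integrable_finsetSum _ fun j _ => ?_)
      exact ((L1.integrable_coeFn _).congr
          (coeFn_mulC (sysMat A n i j) (memLp_sysMat A n i j) (Y j))).restrict
    · exact ((L1.integrable_coeFn _).congr e2).restrict
  constructor
  · intro h i x
    rw [← key i x]
    exact congrArg (fun F => F i x) h
  · intro h
    refine funext fun i => ContinuousMap.ext fun x => ?_
    rw [key i x]
    exact h i x

/-- Membership in `C_A^n[0,1]` in terms of `u = |A_{n-1,n}|^{1/p} Y_n`. -/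
theorem isSolution_iff (p : ℝ≥0∞) {q : ℝ≥0∞} [Fact (1 ≤ p)] [Fact (1 ≤ q)] [p.HolderConjugate q]
    {Y : Fin (n + 1) → C(I, ℂ)} :
    IsSolution A n Y ↔ IsSol A n p (q := q) (weighted (integrable_top A n) p (Y (Fin.last n)))
      fun i => Y i.castSucc := by
  rw [isSol_iff]
  refine forall_congr' fun i => forall_congr' fun x => ?_
  have e : ∫ t in Iic x, (∑ j : Fin (n + 1), if (j : ℕ) ≤ i + 1 then A i j t * Y j t else 0) =
      ∫ t in Iic x, ((∑ j : Fin n, sysMat A n i j t * Y j.castSucc t) +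
      if (i : ℕ) + 1 = n then lead A n p t *
        weighted (integrable_top A n) p (Y (Fin.last n)) t else 0) := by
    refine integral_congr_ae (ae_restrict_of_ae ?_)
    filter_upwards [coeFn_weighted (integrable_top A n) p (Y (Fin.last n))] with t ht
    rw [Fin.sum_univ_castSucc]
    congr 1
    · refine Finset.sum_congr rfl fun j _ => ?_
      simp only [sysMat, Fin.val_castSucc]
      split_ifs <;> simp
    · simp only [Fin.val_last]
      by_cases hi : (i : ℕ) + 1 = n
      · rw [if_pos hi, if_pos (by omega), ht, ← mul_assoc, lead_mul_wpow, CoeffSystem.top]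
        have : n - 1 = i := by omega
        rw [this]
      · rw [if_neg hi, if_neg (by have := i.2; omega)]
  rw [e]

end QuasiSobolev
end

noncomputable section

namespace QuasiSobolev

/-! ### Fredholm operators and the index -/

/-- If `g ∘ f` has finite corank and `g` has finite-dimensional kernel, then `f` has finite
corank. -/
theorem cofg_range_of_comp {E F G : Type*} [AddCommGroup E] [Module ℂ E] [AddCommGroup F]
    [Module ℂ F] [AddCommGroup G] [Module ℂ G] (f : E →ₗ[ℂ] F) (g : F →ₗ[ℂ] G)
    (hgf : (LinearMap.range (g ∘ₗ f)).CoFG) (hg : FiniteDimensional ℂ (LinearMap.ker g)) :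
    (LinearMap.range f).CoFG := by
  have hle : LinearMap.range f ≤ (LinearMap.range (g ∘ₗ f)).comap g := by
    rintro _ ⟨x, rfl⟩
    exact ⟨x, rfl⟩
  set k := (LinearMap.range f).mapQ (LinearMap.range (g ∘ₗ f)) g hle with hk
  have hgf' : FiniteDimensional ℂ (G ⧸ LinearMap.range (g ∘ₗ f)) := hgf
  refine ⟨Submodule.fg_of_fg_map_of_fg_inf_ker k ?_ ?_⟩
  · exact IsNoetherian.noetherian _
  · have : (⊤ : Submodule ℂ (F ⧸ LinearMap.range f)) ⊓ LinearMap.ker k =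
        (LinearMap.ker g).map (LinearMap.range f).mkQ := by
      rw [top_inf_eq]
      ext y
      constructor
      · obtain ⟨y, rfl⟩ := Submodule.mkQ_surjective _ y
        intro hy
        rw [LinearMap.mem_ker, hk, Submodule.mkQ_apply, Submodule.mapQ_apply,
          Submodule.Quotient.mk_eq_zero] at hy
        obtain ⟨x, hx⟩ := hy
        refine ⟨y - f x, ?_, ?_⟩
        · simp only [SetLike.mem_coe, LinearMap.mem_ker, map_sub]
          rw [← hx]
          simp
        · rw [map_sub, sub_eq_self]
          simp
      · rintro ⟨y, hy, rfl⟩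
        rw [LinearMap.mem_ker, hk, Submodule.mkQ_apply, Submodule.mapQ_apply, hy,
          Submodule.Quotient.mk_zero]
    rw [this]
    exact (Submodule.fg_iff_finiteDimensional _).2 hg |>.map _

/-- The index of `T`, computed from a factorization `R ∘ T ∘ ι = q ∘ e` in which `ι` and `e` are
injective and `R` and `q` have equal ranges. -/
theorem index_eq_of_factorization {X₀ X D W G : Type*} [AddCommGroup X₀] [Module ℂ X₀]
    [AddCommGroup X] [Module ℂ X] [AddCommGroup D] [Module ℂ D] [AddCommGroup W] [Module ℂ W]
    [AddCommGroup G] [Module ℂ G] (ι : X₀ →ₗ[ℂ] X) (T : X →ₗ[ℂ] D) (R : D →ₗ[ℂ] W)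
    (e : X₀ →ₗ[ℂ] G) (q : G →ₗ[ℂ] W) (hcomm : ∀ x, R (T (ι x)) = q (e x))
    (hι : Function.Injective ι) (he : Function.Injective e)
    (hRq : LinearMap.range R = LinearMap.range q)
    [FiniteDimensional ℂ (X ⧸ LinearMap.range ι)] [FiniteDimensional ℂ (G ⧸ LinearMap.range e)]
    [FiniteDimensional ℂ (LinearMap.ker R)] [FiniteDimensional ℂ (LinearMap.ker q)] :
    (LinearMap.range T).CoFG ∧ (FiniteDimensional ℂ (LinearMap.ker T) →
      T.index = (Module.finrank ℂ (LinearMap.ker q) - Module.finrank ℂ (G ⧸ LinearMap.range e))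
        + Module.finrank ℂ (X ⧸ LinearMap.range ι) - Module.finrank ℂ (LinearMap.ker R)) := by
  set q' := q.rangeRestrict with hq'
  set R' : D →ₗ[ℂ] LinearMap.range q := R.codRestrict (LinearMap.range q)
    (fun d => hRq ▸ LinearMap.mem_range_self R d) with hR'
  have hq's : Function.Surjective q' := q.surjective_rangeRestrict
  have hR's : Function.Surjective R' := by
    rintro ⟨y, hy⟩
    rw [← hRq] at hy
    obtain ⟨d, rfl⟩ := hy
    exact ⟨d, rfl⟩
  have hkq : LinearMap.ker q' = LinearMap.ker q := LinearMap.ker_rangeRestrict q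
  have hkR : LinearMap.ker R' = LinearMap.ker R := LinearMap.ker_codRestrict _ _ _
  have hfact : R' ∘ₗ (T ∘ₗ ι) = q' ∘ₗ e := LinearMap.ext fun x => Subtype.ext (hcomm x)
  have i1 : FiniteDimensional ℂ (LinearMap.ker q') := hkq ▸ ‹FiniteDimensional ℂ (LinearMap.ker q)›
  have i2 : FiniteDimensional ℂ (LinearMap.ker R') := hkR ▸ ‹FiniteDimensional ℂ (LinearMap.ker R)›
  have i3 : FiniteDimensional ℂ (LinearMap.ker e) := by
    rw [LinearMap.ker_eq_bot.2 he]; infer_instance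
  have i4 : FiniteDimensional ℂ (LinearMap.ker ι) := by
    rw [LinearMap.ker_eq_bot.2 hι]; infer_instance
  have i5 : FiniteDimensional ℂ (LinearMap.range q ⧸ LinearMap.range q') := by
    rw [LinearMap.range_eq_top.2 hq's]; infer_instance
  have i6 : FiniteDimensional ℂ (LinearMap.range q ⧸ LinearMap.range R') := by
    rw [LinearMap.range_eq_top.2 hR's]; infer_instance
  have hind := LinearMap.index_comp (f := e) q'
  have i7 : (LinearMap.range (q' ∘ₗ e)).CoFG := by
    have h1 : LinearMap.range (q' ∘ₗ e) = (LinearMap.range e).map q' := LinearMap.range_comp _ _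
    have hs : Function.Surjective ((LinearMap.range e).mapQ (LinearMap.range (q' ∘ₗ e)) q'
        (Submodule.map_le_iff_le_comap.1 h1.ge)) := by
      intro y
      obtain ⟨y, rfl⟩ := Submodule.mkQ_surjective _ y
      obtain ⟨g, rfl⟩ := hq's y
      exact ⟨Submodule.mkQ _ g, rfl⟩
    exact Module.Finite.of_surjective _ hs
  have i8 : (LinearMap.range (T ∘ₗ ι)).CoFG := by
    refine cofg_range_of_comp (T ∘ₗ ι) R' ?_ i2
    rw [hfact]
    exact i7
  have i9 : (LinearMap.range T).CoFG := i8.of_le (LinearMap.range_comp_le_range ι T)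
  refine ⟨i9, fun i10 => ?_⟩
  have i8' : FiniteDimensional ℂ (D ⧸ LinearMap.range (T ∘ₗ ι)) := i8
  have i9' : FiniteDimensional ℂ (D ⧸ LinearMap.range T) := i9
  have i11 : FiniteDimensional ℂ (LinearMap.ker (T ∘ₗ ι)) := by
    rw [LinearMap.ker_comp]; infer_instance
  have hind2 := LinearMap.index_comp (f := ι) T
  have hind3 := LinearMap.index_comp (f := T ∘ₗ ι) R'
  rw [hfact, hind, hind2, LinearMap.index_of_surjective hq's, LinearMap.index_of_injective he,
    LinearMap.index_of_surjective hR's, LinearMap.index_of_injective hι, hkq, hkR] at hind3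
  linarith

/-- A bounded operator on a Banach space that is bounded below on a closed subspace of finite
codimension and has finite corank is Fredholm. The target need not be complete. -/
theorem isFredholm_of_norm_le {X D W : Type*} [NormedAddCommGroup X] [NormedSpace ℂ X]
    [CompleteSpace X] [NormedAddCommGroup D] [NormedSpace ℂ D] [NormedAddCommGroup W]
    [NormedSpace ℂ W] [FiniteDimensional ℂ W] (T : X →L[ℂ] D) (φ : X →L[ℂ] W) (C : ℝ)
    (hC : ∀ x, φ x = 0 → ‖x‖ ≤ C * ‖T x‖) (hT : (LinearMap.range T.toLinearMap).CoFG) :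
    T.IsFredholm := by
  set E₁ : Submodule ℂ X := LinearMap.ker φ.toLinearMap with hE₁
  set F₁ : Submodule ℂ D := E₁.map T.toLinearMap with hF₁
  have hE₁c : IsClosed (E₁ : Set X) := φ.isClosed_ker
  have hcoE : E₁.CoFG := Submodule.CoFG.ker _
  have hmaps : MapsTo T E₁ F₁ := fun x hx => ⟨x, hx, rfl⟩
  set S : E₁ →L[ℂ] F₁ := T.restrict hmaps with hS
  have hSbij : Function.Bijective S := by
    constructor
    · rw [injective_iff_map_eq_zero]
      intro x hx
      have h0 : T x = 0 := congrArg Subtype.val hx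
      have := hC x x.2
      rw [h0, norm_zero, mul_zero] at this
      exact Subtype.ext (norm_le_zero_iff.1 this)
    · rintro ⟨_, x, hx, rfl⟩
      exact ⟨⟨x, hx⟩, rfl⟩
  let e : E₁ ≃L[ℂ] F₁ := (LinearEquiv.ofBijective S.toLinearMap hSbij
    ).toContinuousLinearEquivOfBounds ‖S‖ C (fun x => S.le_opNorm x) (fun y => by
      obtain ⟨x, rfl⟩ := hSbij.2 y
      have : (LinearEquiv.ofBijective S.toLinearMap hSbij).symm (S x) = x :=
        LinearEquiv.ofBijective_symm_apply_apply _ _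
      rw [this]
      exact hC x x.2)
  have hcE : CompleteSpace E₁ := hE₁c.completeSpace_coe
  have hcF : CompleteSpace F₁ := by
    exact (completeSpace_congr (e := e.toEquiv) e.isUniformEmbedding).1 hcE
  have hF₁c : IsClosed (F₁ : Set D) := (completeSpace_coe_iff_isComplete.1 hcF).isClosed
  have hcoF : F₁.CoFG := by
    have hT' : FiniteDimensional ℂ (D ⧸ LinearMap.range T.toLinearMap) := hT
    have hcoE' : FiniteDimensional ℂ (X ⧸ E₁) := hcoE
    refine ⟨Submodule.fg_of_fg_map_of_fg_inf_ker
      (Submodule.factor (LinearMap.map_le_range : F₁ ≤ LinearMap.range T.toLinearMap)) ?_ ?_⟩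
    · exact IsNoetherian.noetherian _
    · rw [top_inf_eq]
      have : LinearMap.ker (Submodule.factor
          (LinearMap.map_le_range : F₁ ≤ LinearMap.range T.toLinearMap)) =
          LinearMap.range (E₁.mapQ F₁ T.toLinearMap (Submodule.le_comap_map _ _)) := by
        ext y
        obtain ⟨y, rfl⟩ := Submodule.mkQ_surjective _ y
        constructor
        · intro hy
          rw [LinearMap.mem_ker] at hy
          have hy' : Submodule.Quotient.mk (p := LinearMap.range T.toLinearMap) y = 0 := hy
          rw [Submodule.Quotient.mk_eq_zero] at hy'
          obtain ⟨x, rfl⟩ := hy'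
          exact ⟨Submodule.mkQ _ x, rfl⟩
        · rintro ⟨x, hx⟩
          obtain ⟨x, rfl⟩ := Submodule.mkQ_surjective _ x
          rw [← hx, LinearMap.mem_ker]
          change Submodule.Quotient.mk (p := LinearMap.range T.toLinearMap) (T x) = 0
          rw [Submodule.Quotient.mk_eq_zero]
          exact ⟨x, rfl⟩
      rw [this]
      exact (Submodule.fg_iff_finiteDimensional _).2 inferInstance
  exact ContinuousLinearMap.IsFredholm.of_isInvertible_restrict hE₁c hF₁c hmaps ⟨e, by
    ext x; rfl⟩

/-- The annihilator of the kernel of `V` for the standard sesquilinear form has dimension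
`rank V`. -/
theorem finrank_annihilator_ker {ι : Type*} [Fintype ι] [DecidableEq ι] (V : Matrix ι ι ℂ)
    (S : Submodule ℂ (ι → ℂ))
    (hS : ∀ l, l ∈ S ↔ ∀ v, V *ᵥ v = 0 → ∑ k, l k * conj (v k) = 0) :
    Module.finrank ℂ S = V.rank := by
  let L := WithLp.linearEquiv 2 ℂ (ι → ℂ)
  let K : Submodule ℂ (EuclideanSpace ℂ ι) := (LinearMap.ker V.mulVecLin).comap L.toLinearMap
  have e1 : Kᗮ = S.comap L.toLinearMap := by
    ext l
    rw [Submodule.mem_orthogonal, Submodule.mem_comap]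
    refine Iff.trans ?_ (hS _).symm
    constructor
    · intro h v hv
      have := h (L.symm v) (by simpa [K, L] using hv)
      rw [PiLp.inner_apply] at this
      exact this
    · intro h v hv
      have := h (L v) (by simpa [K, L] using hv)
      rw [PiLp.inner_apply]
      exact this
  have e2 : Module.finrank ℂ S = Module.finrank ℂ (Kᗮ : Submodule ℂ (EuclideanSpace ℂ ι)) := by
    rw [e1]
    exact (LinearEquiv.finrank_eq (L.submoduleMap (S.comap L.toLinearMap)).symm).symm ▸ by
      rw [Submodule.map_comap_eq_of_surjective L.surjective]
  have e3 : Module.finrank ℂ K = Module.finrank ℂ (LinearMap.ker V.mulVecLin) := by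
    have hm : K.map L.toLinearMap = LinearMap.ker V.mulVecLin :=
      Submodule.map_comap_eq_of_surjective L.surjective _
    refine (L.submoduleMap K).finrank_eq.trans ?_
    change Module.finrank ℂ (K.map L.toLinearMap) = _
    rw [hm]
  have h1 := K.finrank_add_finrank_orthogonal
  have h2 := LinearMap.finrank_range_add_finrank_ker V.mulVecLin
  have h3 : V.rank = Module.finrank ℂ (LinearMap.range V.mulVecLin) := rfl
  rw [finrank_euclideanSpace] at h1
  rw [Module.finrank_fintype_fun_eq_card] at h2
  omega

theorem finrank_ker_add_rank {ι : Type*} [Fintype ι] (U : Matrix ι ι ℂ) :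
    Module.finrank ℂ (LinearMap.ker U.mulVecLin) + U.rank = Fintype.card ι := by
  have h2 := LinearMap.finrank_range_add_finrank_ker U.mulVecLin
  rw [Module.finrank_fintype_fun_eq_card] at h2
  rw [add_comm]
  exact h2

end QuasiSobolev
end

noncomputable section

namespace QuasiSobolev

/-! ### Invertibility of an input-output operator -/

section StateSpace

variable {ι : Type*} [Fintype ι] {s t : ℝ≥0∞} [Fact (1 ≤ s)] [Fact (1 ≤ t)] [t.HolderConjugate s]

/-- The input operator `u ↦ (∫_0^x β_r u)_r`. -/
def inputOp (β : ι → I → ℂ) (hβ : ∀ r, MemLp (β r) t volume) :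
    Lp ℂ s (volume : Measure I) →L[ℂ] (ι → C(I, ℂ)) :=
  ContinuousLinearMap.pi fun r => primitive.comp (mulLp (r := 1) (β r) (hβ r))

/-- The output operator `X ↦ ∑_c γ_c X_c`. -/
def outputOp (γ : ι → I → ℂ) (hγ : ∀ c, MemLp (γ c) s volume) :
    (ι → C(I, ℂ)) →L[ℂ] Lp ℂ s (volume : Measure I) :=
  ∑ c, (mulC (γ c) (hγ c)).comp (ContinuousLinearMap.proj c)

/-- The operator `u ↦ P u + ∑_c γ_c X_c`, where `X' = M X + β u`, `X(0) = 0`. -/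
def ioOp (M : ι → ι → I → ℂ) (hM : ∀ i j, MemLp (M i j) 1 volume)
    (β : ι → I → ℂ) (hβ : ∀ r, MemLp (β r) t volume) (γ : ι → I → ℂ)
    (hγ : ∀ c, MemLp (γ c) s volume) (P : I → ℂ) (hP : MemLp P ∞ volume) :
    Lp ℂ s (volume : Measure I) →L[ℂ] Lp ℂ s (volume : Measure I) :=
  mulLp P hP + (outputOp γ hγ).comp ((Ring.inverse (1 - volterra M hM)).comp (inputOp β hβ))

/-- The equation `P u + ∑_c γ_c X_c = g` can be solved for `u`, and substitution into
`X' = M X + β u` gives a system of the same kind for `X`, which is uniquely solvable. -/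
theorem bijective_ioOp {M : ι → ι → I → ℂ} {hM : ∀ i j, MemLp (M i j) 1 volume}
    {β : ι → I → ℂ} {hβ : ∀ r, MemLp (β r) t volume} {γ : ι → I → ℂ}
    {hγ : ∀ c, MemLp (γ c) s volume} {P : I → ℂ} {hP : MemLp P ∞ volume}
    (hP0 : ∀ᵐ x : I, P x ≠ 0) (hPinv : MemLp (fun x => (P x)⁻¹) ∞ volume) :
    Function.Bijective (ioOp M hM β hβ γ hγ P hP) := by
  set m : Lp ℂ s (volume : Measure I) →L[ℂ] Lp ℂ s (volume : Measure I) := mulLp P hP with hm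
  set m' : Lp ℂ s (volume : Measure I) →L[ℂ] Lp ℂ s (volume : Measure I) :=
    mulLp (fun x => (P x)⁻¹) hPinv with hm'
  have hmm' : ∀ u, m (m' u) = u := fun u => by
    refine Lp.ext ?_
    filter_upwards [coeFn_mulLp (r := s) P hP (m' u),
      coeFn_mulLp (r := s) (fun x => (P x)⁻¹) hPinv u, hP0] with x h1 h2 h3
    rw [h1, h2, mul_inv_cancel_left₀ h3]
  have hm'm : ∀ u, m' (m u) = u := fun u => by
    refine Lp.ext ?_
    filter_upwards [coeFn_mulLp (r := s) P hP u,
      coeFn_mulLp (r := s) (fun x => (P x)⁻¹) hPinv (m u), hP0] with x h1 h2 h3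
    rw [h2, h1, inv_mul_cancel_left₀ h3]
  have hN : ∀ r c, MemLp (fun x => M r c x - β r x * ((P x)⁻¹ * γ c x)) 1 volume := fun r c => by
    have h1 : MemLp (fun x => (P x)⁻¹ * γ c x) s volume := (hγ c).mul hPinv
    exact (hM r c).sub (h1.mul (hβ r))
  -- the system that results from the substitution
  set N := volterra (fun r c x => M r c x - β r x * ((P x)⁻¹ * γ c x)) hN with hNdef
  have hNX : ∀ X, N X = volterra M hM X - inputOp β hβ (m' (outputOp γ hγ X)) := by
    intro X
    refine funext fun r => ?_
    rw [Pi.sub_apply, hNdef, volterra_apply, volterra_apply]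
    simp only [inputOp, outputOp, ContinuousLinearMap.coe_pi', sum_apply, map_sum,
      ContinuousLinearMap.comp_apply, ContinuousLinearMap.proj_apply]
    rw [Finset.sum_apply, ← Finset.sum_sub_distrib]
    refine Finset.sum_congr rfl fun c _ => ?_
    rw [← map_sub]
    congr 1
    refine Lp.ext ((coeFn_mulC _ _ _).trans ?_)
    filter_upwards [Lp.coeFn_sub (mulC (M r c) (hM r c) (X c))
      (mulLp (r := 1) (β r) (hβ r) (m' (mulC (γ c) (hγ c) (X c)))),
      coeFn_mulC (M r c) (hM r c) (X c), coeFn_mulC (γ c) (hγ c) (X c),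
      coeFn_mulLp (r := s) (fun x => (P x)⁻¹) hPinv (mulC (γ c) (hγ c) (X c)),
      coeFn_mulLp (r := 1) (β r) (hβ r) (m' (mulC (γ c) (hγ c) (X c)))] with x h1 h2 h3 h4 h5
    rw [h1, Pi.sub_apply, h2, h5, h4, h3]
    ring
  have hL : ∀ u, ioOp M hM β hβ γ hγ P hP u =
    m u + outputOp γ hγ (Ring.inverse (1 - volterra M hM) (inputOp β hβ u)) := fun u => rfl
  constructor
  · rw [injective_iff_map_eq_zero]
    intro u hu
    set X := Ring.inverse (1 - volterra M hM) (inputOp β hβ u) with hX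
    have hX' := continuousMap_eq_inverse_iff.1 hX
    rw [hL, ← hX] at hu
    have hu' : u = -m' (outputOp γ hγ X) := by
      rw [← hm'm u, eq_neg_of_add_eq_zero_left hu, map_neg]
    have hX0 : X = Ring.inverse (1 - N) 0 := by
      refine continuousMap_eq_inverse_iff.2 ?_
      rw [add_zero]
      refine hX'.trans (Eq.trans ?_ (hNX X).symm)
      nth_rewrite 1 [hu']
      rw [map_neg, sub_eq_add_neg]
    rw [map_zero] at hX0
    rw [hu', hX0]
    simp
  · intro g
    set X := Ring.inverse (1 - N) (inputOp β hβ (m' g)) with hX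
    have hX' : X = N X + inputOp β hβ (m' g) := continuousMap_eq_inverse_iff.1 hX
    refine ⟨m' (g - outputOp γ hγ X), ?_⟩
    have hXX : X = Ring.inverse (1 - volterra M hM)
        (inputOp β hβ (m' (g - outputOp γ hγ X))) := by
      refine continuousMap_eq_inverse_iff.2 ?_
      refine hX'.trans ?_
      rw [hNX, map_sub, map_sub]
      abel
    rw [hL, ← hXX, hmm']
    abel

end StateSpace

/-! ### Boundary functionals -/

/-- Every linear form in the boundary values of the solutions is an integral functional: test with
`H` affine, `H(0)` and `H(1)` prescribed. -/
theorem exists_boundary_representation {A : CoeffSystem} {n : ℕ} {p q : ℝ≥0∞} [Fact (1 ≤ p)]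
    [Fact (1 ≤ q)] [p.HolderConjugate q] (l : Fin n ⊕ Fin n → ℂ) :
    ∃ (b : Fin n → Lp ℂ 1 (volume : Measure I)) (g : Lp ℂ q (volume : Measure I)),
      (∀ᵐ x : I, A.top n x = 0 → g x = 0) ∧
      ∀ (u : Lp ℂ p (volume : Measure I)) (Z : Fin n → C(I, ℂ)), IsSol A n p (q := q) u Z →
        (∑ i, pairing (b i) (Z i)) + ∫ x, g x * conj (u x) =
          ∑ k, l k * conj (boundary Z k) := by
  set d : Fin n → Lp ℂ 1 (volume : Measure I) := fun i =>
    (memLp_const (l (Sum.inr i) + l (Sum.inl i))).toLp (fun _ : I => _) with hd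
  have hd1 : ∀ i, primitive (d i) 1 = l (Sum.inr i) + l (Sum.inl i) := by
    intro i
    rw [primitive_apply, setIntegral_Iic_one, integral_congr_ae (MemLp.coeFn_toLp _)]
    simp
  set H : Fin n → C(I, ℂ) := fun i => constVec (Fin n) (fun i => -l (Sum.inl i)) i +
    primitive (d i) with hH
  have hH0 : ∀ i, H i 0 = -l (Sum.inl i) := fun i => by simp [hH, primitive_zero]
  have hH1 : ∀ i, H i 1 = l (Sum.inr i) := fun i => by simp [hH, hd1]
  set b : Fin n → Lp ℂ 1 (volume : Measure I) := fun i => d i -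
    ∑ j, mulC (adjMat A n i j) (memLp_adjMat A n i j) (H j) with hb
  have hHeq : H = adjOp A n H + (constVec (Fin n) (fun i => H i 0) + fun i => primitive (b i)) := by
    refine funext fun i => ?_
    simp only [Pi.add_apply, volterra_apply, hb, map_sub, map_sum]
    have : constVec (Fin n) (fun i => H i 0) i = constVec (Fin n) (fun i => -l (Sum.inl i)) i := by
      simp only [hH0]
    rw [this]
    simp only [hH]
    abel
  refine ⟨b, adjTop A n p q H, adjTop_ae H, fun u Z hZ => ?_⟩
  rw [← adjoint_identity hZ hHeq, Fintype.sum_sum_type]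
  simp only [hH0, hH1, boundary, Sum.elim_inl, Sum.elim_inr, neg_mul, Finset.sum_neg_distrib]
  ring

/-! ### Function spaces of solutions -/

/-- The functions of class `L_p` that vanish where `a` does. -/
def vanishing (a : I → ℂ) (p : ℝ≥0∞) : Submodule ℂ (Lp ℂ p (volume : Measure I)) where
  carrier := {u | ∀ᵐ x : I, a x = 0 → u x = 0}
  zero_mem' := by
    filter_upwards [Lp.coeFn_zero ℂ p (volume : Measure I)] with x hx _ using hx
  add_mem' := by
    intro u v hu hv
    change ∀ᵐ x : I, a x = 0 → (u + v : Lp ℂ p (volume : Measure I)) x = 0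
    filter_upwards [Lp.coeFn_add u v, hu, hv] with x h1 h2 h3 h
    rw [h1, Pi.add_apply, h2 h, h3 h, add_zero]
  smul_mem' := by
    intro c u hu
    change ∀ᵐ x : I, a x = 0 → (c • u : Lp ℂ p (volume : Measure I)) x = 0
    filter_upwards [Lp.coeFn_smul c u, hu] with x h1 h2 h
    rw [h1, Pi.smul_apply, h2 h, smul_zero]

theorem mem_vanishing {a : I → ℂ} {p : ℝ≥0∞} {u : Lp ℂ p (volume : Measure I)} :
    u ∈ vanishing a p ↔ ∀ᵐ x : I, a x = 0 → u x = 0 := Iff.rfl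

theorem weighted_mem_vanishing {a : I → ℂ} (ha : Integrable a volume) {p : ℝ≥0∞} [Fact (1 ≤ p)]
    (hp : p ≠ ∞) (z : C(I, ℂ)) : weighted ha p z ∈ vanishing a p := by
  filter_upwards [coeFn_weighted ha p z] with x hx h
  rw [hx, wpow_eq_zero hp h, zero_mul]

theorem mulC_mem_vanishing {a : I → ℂ} {p : ℝ≥0∞} [Fact (1 ≤ p)] {f : I → ℂ}
    (hf : MemLp f p volume) (h0 : ∀ᵐ x : I, a x = 0 → f x = 0) (Y : C(I, ℂ)) :
    mulC f hf Y ∈ vanishing a p := by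
  filter_upwards [coeFn_mulC f hf Y, h0] with x hx h h'
  rw [hx, h h', zero_mul]

theorem mulLp_mem_vanishing {a : I → ℂ} {p : ℝ≥0∞} [Fact (1 ≤ p)] {f : I → ℂ}
    (hf : MemLp f ∞ volume) {u : Lp ℂ p (volume : Measure I)} (hu : u ∈ vanishing a p) :
    (mulLp f hf u : Lp ℂ p (volume : Measure I)) ∈ vanishing a p := by
  rw [mem_vanishing] at hu ⊢
  filter_upwards [coeFn_mulLp (r := p) f hf u, hu] with x hx h h'
  rw [hx, h h', mul_zero]

/-- A normed space of solutions `(Y_0, …, Y_{n-1}, Y_n)` of the system with boundary conditions,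
presented by the bounded operators `comp i : Y ↦ Y_i`, `i < n`, and
`top : Y ↦ |A_{n-1,n}|^{1/p} Y_n`. The norm is dominated by the norms of these, and all the
solutions with continuous `Y_n` belong to the space. Both `W_{p,A,U}^n` with `p < ∞` and
`C_{A,U}^n` with `p = ∞` are of this kind. -/
structure SolSpace (A : CoeffSystem) (n : ℕ) (p q : ℝ≥0∞) [Fact (1 ≤ p)] [Fact (1 ≤ q)]
    [p.HolderConjugate q] (U : Matrix (Fin n ⊕ Fin n) (Fin n ⊕ Fin n) ℂ) (X : Type*)
    [NormedAddCommGroup X] [NormedSpace ℂ X] where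
  /-- the components with numbers less than `n` -/
  comp : Fin n → X →L[ℂ] C(I, ℂ)
  /-- the weighted last component -/
  top : X →L[ℂ] Lp ℂ p (volume : Measure I)
  top_mem : ∀ x, top x ∈ vanishing (A.top n) p
  isSol : ∀ x, IsSol A n p (q := q) (top x) fun i => comp i x
  bc : ∀ x, U *ᵥ boundary (fun i => comp i x) = 0
  norm_le : ∀ x, ‖x‖ ≤ (∑ i, ‖comp i x‖) + ‖top x‖
  exists_of_mem : ∀ Y ∈ CSubmoduleBC A n U, ∃ x, (∀ i, comp i x = Y i.castSucc) ∧
    top x = weighted (integrable_top A n) p (Y (Fin.last n))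

namespace SolSpace

variable {A : CoeffSystem} {n : ℕ} {p q : ℝ≥0∞} [Fact (1 ≤ p)] [Fact (1 ≤ q)]
    [p.HolderConjugate q] {U : Matrix (Fin n ⊕ Fin n) (Fin n ⊕ Fin n) ℂ} {X : Type*}
    [NormedAddCommGroup X] [NormedSpace ℂ X] (S : SolSpace A n p q U X)

include S in
/-- The element with prescribed initial values and prescribed continuous last component. -/
theorem exists_solve (ξ : Fin n → ℂ) (z : C(I, ℂ))
    (hU : U *ᵥ boundary (solve A n p q (ξ, weighted (integrable_top A n) p z)) = 0) :
    ∃ x, (fun i => S.comp i x) = solve A n p q (ξ, weighted (integrable_top A n) p z) ∧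
      S.top x = weighted (integrable_top A n) p z := by
  set Y : Fin (n + 1) → C(I, ℂ) := Fin.snoc (α := fun _ => C(I, ℂ))
    (solve A n p q (ξ, weighted (integrable_top A n) p z)) z with hY
  have h1 : (fun i : Fin n => Y i.castSucc) =
      solve A n p q (ξ, weighted (integrable_top A n) p z) := by
    funext i
    simp [hY]
  have h2 : Y (Fin.last n) = z := by simp [hY]
  have hmem : Y ∈ CSubmoduleBC A n U := by
    refine ⟨(isSolution_iff p (q := q)).2 ?_, ?_⟩
    · rw [h1, h2]
      exact isSol_solve _ _
    · rw [h1]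
      exact hU
  obtain ⟨x, hx1, hx2⟩ := S.exists_of_mem Y hmem
  refine ⟨x, ?_, ?_⟩
  · rw [← h1]
    exact funext hx1
  · rw [hx2, h2]

/-- The boundary values as a bounded operator. -/
def bdry : X →L[ℂ] (Fin n ⊕ Fin n → ℂ) :=
  ContinuousLinearMap.pi (Sum.elim
    (fun i => (ContinuousMap.evalCLM ℂ (0 : I)).comp (S.comp i))
    (fun i => (ContinuousMap.evalCLM ℂ (1 : I)).comp (S.comp i)))

theorem bdry_apply (x : X) : S.bdry x = boundary fun i => S.comp i x := by
  funext k
  rcases k with k | k <;> rfl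

include S in
/-- All the boundary values that satisfy the boundary conditions occur. -/
theorem exists_bdry_eq (hA : A.StrictMonoUpTo n) (v : Fin n ⊕ Fin n → ℂ)
    (hv : U *ᵥ v = 0) : ∃ x, S.bdry x = v := by
  obtain ⟨z, hz⟩ := surjective_endpoint_weighted hA p (q := q)
    (fun i => v (Sum.inr i) - solve A n p q (fun i => v (Sum.inl i), 0) i 1)
  have hb : boundary (solve A n p q (fun i => v (Sum.inl i),
      weighted (integrable_top A n) p z)) = v := by
    funext k
    rcases k with k | k
    · exact solve_initial _ _ _
    · have h1 := congrFun hz k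
      have h2 : ((fun i => v (Sum.inl i), weighted (integrable_top A n) p z) :
          (Fin n → ℂ) × Lp ℂ p (volume : Measure I)) =
          (fun i => v (Sum.inl i), 0) + (0, weighted (integrable_top A n) p z) := by simp
      rw [h2, map_add]
      change solve A n p q _ k 1 + solve A n p q _ k 1 = _
      have h3 : solve A n p q (0, weighted (integrable_top A n) p z) k 1 =
          v (Sum.inr k) - solve A n p q (fun i => v (Sum.inl i), 0) k 1 := h1
      rw [h3]
      ring
  obtain ⟨x, hx, -⟩ := S.exists_solve _ z (by rw [hb]; exact hv)
  exact ⟨x, by rw [S.bdry_apply, hx, hb]⟩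

/-- The functional `∑ ∫ b_i conj(Z_i) + ∫ g conj(|A_{n-1,n}|^{1/p} Z_n)`. -/
def functional : ((Fin n → Lp ℂ 1 (volume : Measure I)) × Lp ℂ q (volume : Measure I)) →L[ℂ]
    (X →L⋆[ℂ] ℂ) :=
  haveI : q.HolderConjugate p := ENNReal.HolderConjugate.symm
  ContinuousLinearMap.coprod
    (∑ i, (sesq ((ContinuousMap.toLp ∞ volume ℂ).comp (S.comp i))).comp
      (ContinuousLinearMap.proj i)) (sesq S.top)

theorem functional_apply (b : Fin n → Lp ℂ 1 (volume : Measure I))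
    (g : Lp ℂ q (volume : Measure I)) (x : X) :
    S.functional (b, g) x =
      (∑ i, pairing (b i) (S.comp i x)) + ∫ y, g y * conj (S.top x y) := by
  have h : S.functional (b, g) x = (∑ i, pairing (b i) (S.comp i x)) + sesq S.top g x := by
    simp only [functional, ContinuousLinearMap.coprod_apply, add_apply, sum_apply,
      ContinuousLinearMap.comp_apply, ContinuousLinearMap.proj_apply]
    rfl
  rw [h, sesq_apply]

/-- Integration by parts reduces a functional to one with `b = 0` and boundary terms. -/
theorem functional_eq (h : Fin n → ℂ) (b : Fin n → Lp ℂ 1 (volume : Measure I))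
    (g : Lp ℂ q (volume : Measure I)) (x : X) :
    S.functional (b, g) x = S.functional (0, g - adjTop A n p q (adjSolve A n (h, b))) x +
      (∑ i, adjSolve A n (h, b) i 1 * conj (S.comp i x 1) -
        ∑ i, h i * conj (S.comp i x 0)) := by
  have key := adjoint_identity (S.isSol x) (adjSolve_eq h b)
  simp only [adjSolve_initial] at key
  have h1 : S.functional (0, g - adjTop A n p q (adjSolve A n (h, b))) x =
      S.functional (0, g) x - S.functional (0, adjTop A n p q (adjSolve A n (h, b))) x := by
    have : ((0, g - adjTop A n p q (adjSolve A n (h, b))) :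
      (Fin n → Lp ℂ 1 (volume : Measure I)) × Lp ℂ q (volume : Measure I)) =
      (0, g) - (0, adjTop A n p q (adjSolve A n (h, b))) := by simp
    rw [this, map_sub, sub_apply]
  rw [h1, functional_apply, functional_apply, functional_apply]
  simp only [Pi.zero_apply, map_zero, zero_apply, Finset.sum_const_zero, zero_add]
  rw [key]
  ring

end SolSpace

end QuasiSobolev
end

noncomputable section

namespace QuasiSobolev

namespace SolSpace

/-! ### Functionals on a space of solutions -/

section Dual

variable {B : CoeffSystem} {m : ℕ} {t s : ℝ≥0∞} [Fact (1 ≤ t)] [Fact (1 ≤ s)]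
  [t.HolderConjugate s] {V : Matrix (Fin m ⊕ Fin m) (Fin m ⊕ Fin m) ℂ} {Z : Type*}
  [NormedAddCommGroup Z] [NormedSpace ℂ Z] (S : SolSpace B m t s V Z)

/-- The functionals `Z ↦ ∑ ∫ b_i conj(Z_i) + ∫ g conj(|B_{m-1,m}|^{1/t} Z_m)` with summable `b_i`
and `g` of class `L_s` that vanishes where `B_{m-1,m}` does. -/
def dual : Submodule ℂ (Z →L⋆[ℂ] ℂ) :=
  ((⊤ : Submodule ℂ (Fin m → Lp ℂ 1 (volume : Measure I))).prod (vanishing (B.top m) s)).map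
    S.functional.toLinearMap

theorem mem_dual {F : Z →L⋆[ℂ] ℂ} :
    F ∈ S.dual ↔ ∃ b, ∃ g ∈ vanishing (B.top m) s, S.functional (b, g) = F := by
  constructor
  · rintro ⟨⟨b, g⟩, ⟨-, hg⟩, rfl⟩
    exact ⟨b, g, hg, rfl⟩
  · rintro ⟨b, g, hg, rfl⟩
    exact ⟨(b, g), ⟨Submodule.mem_top, hg⟩, rfl⟩

/-- The functional `Z ↦ ∑ l_k conj(Z^∧_k)`. -/
def bdryFunctional : (Fin m ⊕ Fin m → ℂ) →L[ℂ] (Z →L⋆[ℂ] ℂ) :=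
  ∑ k, (ContinuousLinearMap.proj k).smulRight
    ((starL ℂ : ℂ ≃L⋆[ℂ] ℂ).toContinuousLinearMap.comp
      ((ContinuousLinearMap.proj k : (Fin m ⊕ Fin m → ℂ) →L[ℂ] ℂ).comp S.bdry))

theorem bdryFunctional_apply (l : Fin m ⊕ Fin m → ℂ) (z : Z) :
    S.bdryFunctional l z = ∑ k, l k * conj (S.bdry z k) := by
  simp only [bdryFunctional, sum_apply]
  rfl

theorem bdryFunctional_mem (l : Fin m ⊕ Fin m → ℂ) : S.bdryFunctional l ∈ S.dual := by
  obtain ⟨b, g, hg, h⟩ := exists_boundary_representation (A := B) (p := t) (q := s) l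
  refine S.mem_dual.2 ⟨b, g, hg, ?_⟩
  ext z
  rw [functional_apply, h _ _ (S.isSol z), bdryFunctional_apply, bdry_apply]

variable (B m t s) in
/-- The continuous `z` for which the solution with `Z(0) = 0` and `Z_m = z` satisfies
`Z(1) = 0`. -/
def nullSpace : Submodule ℂ C(I, ℂ) :=
  LinearMap.ker ((endpoint B m t s).comp (weighted (integrable_top B m) t)).toLinearMap

include S in
theorem exists_test (z : nullSpace B m t s) :
    ∃ x, (fun i => S.comp i x) = solve B m t s (0, weighted (integrable_top B m) t z) ∧
      S.top x = weighted (integrable_top B m) t z ∧ S.bdry x = 0 := by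
  have hb : boundary (solve B m t s (0, weighted (integrable_top B m) t z)) = 0 := by
    funext k
    rcases k with k | k
    · exact solve_initial _ _ _
    · exact congrFun (LinearMap.mem_ker.1 z.2) k
  obtain ⟨x, h1, h2⟩ := S.exists_solve 0 (z : C(I, ℂ)) (by rw [hb, Matrix.mulVec_zero])
  exact ⟨x, h1, h2, by rw [bdry_apply, h1, hb]⟩

/-- The element with zero boundary values and prescribed continuous last component. -/
def test (z : nullSpace B m t s) : Z := (S.exists_test z).choose

theorem comp_test (z : nullSpace B m t s) : (fun i => S.comp i (S.test z)) =
    solve B m t s (0, weighted (integrable_top B m) t z) := (S.exists_test z).choose_spec.1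

theorem top_test (z : nullSpace B m t s) :
    S.top (S.test z) = weighted (integrable_top B m) t z := (S.exists_test z).choose_spec.2.1

theorem bdry_test (z : nullSpace B m t s) : S.bdry (S.test z) = 0 :=
  (S.exists_test z).choose_spec.2.2

theorem norm_test_le (z : nullSpace B m t s) : ‖S.test z‖ ≤
    (m * ‖solve B m t s‖ + 1) * ‖weighted (integrable_top B m) t z‖ := by
  refine (S.norm_le _).trans ?_
  rw [top_test, add_mul, one_mul]
  refine add_le_add ?_ le_rfl
  have h : ∀ i, ‖S.comp i (S.test z)‖ ≤
      ‖solve B m t s‖ * ‖weighted (integrable_top B m) t z‖ := by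
    intro i
    rw [congrFun (S.comp_test z) i]
    refine (norm_le_pi_norm _ i).trans (((solve B m t s).le_opNorm _).trans ?_)
    simp [Prod.norm_def]
  refine (Finset.sum_le_sum fun i _ => h i).trans ?_
  simp [mul_assoc]

variable (B m t s) in
/-- The functionals `z ↦ ∫ g conj(|B_{m-1,m}|^{1/t} z)` on `nullSpace`. -/
def reduced : vanishing (B.top m) s →ₗ[ℂ] (nullSpace B m t s → ℂ) where
  toFun g z := sesq (weighted (integrable_top B m) t) (g : Lp ℂ s (volume : Measure I)) z
  map_add' g g' := by
    funext z
    simp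
  map_smul' c g := by
    funext z
    simp

variable {D : Type*} [NormedAddCommGroup D] [NormedSpace ℂ D] (j : D →ₗᵢ[ℂ] (Z →L⋆[ℂ] ℂ))

/-- Testing functionals with the elements that have zero boundary values. The space of functionals
is represented by an isometric embedding `j` of a normed space `D`. -/
def restrict : D →ₗ[ℂ] (nullSpace B m t s → ℂ) where
  toFun F z := j F (S.test z)
  map_add' _ _ := by
    funext z
    simp
  map_smul' _ _ := by
    funext z
    simp

/-- Integration by parts leaves only the last component of a functional on the elements with zero
boundary values. -/
theorem functional_test (b : Fin m → Lp ℂ 1 (volume : Measure I))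
    (g : Lp ℂ s (volume : Measure I)) (z : nullSpace B m t s) :
    S.functional (b, g) (S.test z) = sesq (weighted (integrable_top B m) t)
      (g - adjTop B m t s (adjSolve B m (0, b))) z := by
  rw [S.functional_eq 0]
  have h0 : ∀ k, S.bdry (S.test z) k = 0 := fun k => by rw [S.bdry_test]; rfl
  have h1 : ∀ i, S.comp i (S.test z) 1 = 0 := fun i => h0 (Sum.inr i)
  simp only [h1, map_zero, mul_zero, Finset.sum_const_zero, Pi.zero_apply, zero_mul, sub_zero,
    add_zero]
  rw [functional_apply, top_test, sesq_apply]
  simp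

theorem sub_adjTop_mem {g : Lp ℂ s (volume : Measure I)} (hg : g ∈ vanishing (B.top m) s)
    (H : Fin m → C(I, ℂ)) : g - adjTop B m t s H ∈ vanishing (B.top m) s :=
  sub_mem hg (adjTop_ae H)

variable {j}

/-- Every functional acts on the elements with zero boundary values as one with `b = 0`. -/
theorem range_restrict (hj : ∀ F, F ∈ S.dual ↔ ∃ d, j d = F) :
    LinearMap.range (S.restrict j) = LinearMap.range (reduced B m t s) := by
  apply le_antisymm
  · rintro _ ⟨F, rfl⟩
    obtain ⟨b, g, hg, hF⟩ := S.mem_dual.1 ((hj _).2 ⟨F, rfl⟩)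
    refine ⟨⟨_, sub_adjTop_mem (t := t) hg (adjSolve B m (0, b))⟩, funext fun z => ?_⟩
    change _ = j F (S.test z)
    rw [← hF]
    exact (S.functional_test b g z).symm
  · rintro _ ⟨g, rfl⟩
    obtain ⟨F, hF⟩ := (hj _).1 (S.mem_dual.2 ⟨0, g, g.2, rfl⟩)
    refine ⟨F, funext fun z => ?_⟩
    change j F (S.test z) = _
    rw [hF]
    have h0 : adjSolve B m ((0 : Fin m → ℂ), (0 : Fin m → Lp ℂ 1 (volume : Measure I))) = 0 :=
      map_zero _
    rw [functional_test, h0, map_zero, sub_zero]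
    rfl

variable (B m t s) in
/-- `h ↦ conj(b) H_{m-1}` for the solutions `H` of the homogeneous adjoint system, `H(0) = h`. -/
def adjTrace : (Fin m → ℂ) →ₗ[ℂ] vanishing (B.top m) s where
  toFun h := ⟨adjTop B m t s (adjSolve B m (h, 0)), adjTop_ae _⟩
  map_add' h h' := by
    refine Subtype.ext ?_
    change adjTop B m t s (adjSolve B m (h + h', 0)) =
      adjTop B m t s (adjSolve B m (h, 0)) + adjTop B m t s (adjSolve B m (h', 0))
    rw [← map_add, ← map_add]
    simp
  map_smul' c h := by
    refine Subtype.ext ?_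
    change adjTop B m t s (adjSolve B m (c • h, 0)) = c • adjTop B m t s (adjSolve B m (h, 0))
    rw [← map_smul, ← map_smul]
    simp

theorem injective_adjTrace (hB : B.StrictMonoUpTo m) :
    Function.Injective (adjTrace B m t s) := by
  rw [injective_iff_map_eq_zero]
  intro h hh
  exact adjSolve_eq_zero hB (congrArg Subtype.val hh)

theorem sesq_adjTrace (h : Fin m → ℂ) (z : C(I, ℂ)) :
    sesq (weighted (integrable_top B m) t) (adjTrace B m t s h : Lp ℂ s (volume : Measure I)) z =
      ∑ i, adjSolve B m (h, 0) i 1 *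
        conj (endpoint B m t s (weighted (integrable_top B m) t z) i) := by
  have key := adjoint_identity_homogeneous (isSol_solve (A := B) (n := m) (p := t) (q := s) 0
    (weighted (integrable_top B m) t z)) h
  simp only [solve_initial, Pi.zero_apply, map_zero, mul_zero, Finset.sum_const_zero,
    sub_zero] at key
  rw [sesq_apply]
  exact key.symm

/-- A functional on `C[0,1]` that vanishes on the null space depends on the endpoint values only,
and the terminal values of the adjoint solutions are arbitrary. -/
theorem ker_reduced (hB : B.StrictMonoUpTo m) :
    LinearMap.ker (reduced B m t s) = LinearMap.range (adjTrace B m t s) := by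
  apply le_antisymm
  · intro g hg
    have hg' : ∀ z : nullSpace B m t s, sesq (weighted (integrable_top B m) t)
      (g : Lp ℂ s (volume : Measure I)) z = 0 := fun z => congrFun (LinearMap.mem_ker.1 hg) z
    set f := sesq (weighted (integrable_top B m) t) (g : Lp ℂ s (volume : Measure I)) with hf
    set Ev := (endpoint B m t s).comp (weighted (integrable_top B m) t) with hEv
    obtain ⟨r, hr⟩ := Ev.toLinearMap.exists_rightInverse_of_surjective
      (LinearMap.range_eq_top.2 (surjective_endpoint_weighted hB t))
    have hr' : ∀ v, Ev (r v) = v := fun v => LinearMap.congr_fun hr v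
    obtain ⟨h, hh⟩ := exists_adjSolve_terminal (A := B) fun k : Fin m => f (r (Pi.single k 1))
    refine ⟨h, ?_⟩
    have hfz : ∀ z, f z = ∑ i, f (r (Pi.single i 1)) * conj (Ev z i) := by
      intro z
      have h1 : f (z - r (Ev z)) = 0 := hg' ⟨z - r (Ev z), by
        change Ev (z - r (Ev z)) = 0
        rw [map_sub, hr', sub_self]⟩
      rw [map_sub, sub_eq_zero] at h1
      rw [h1]
      nth_rewrite 1 [← Finset.univ_sum_single (Ev z)]
      rw [map_sum, map_sum]
      refine Finset.sum_congr rfl fun i _ => ?_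
      have h3 : Pi.single i (Ev z i) = Ev z i • (Pi.single i 1 : Fin m → ℂ) := by
        rw [← Pi.single_smul]; simp
      rw [h3, map_smul, ContinuousLinearMap.map_smulₛₗ, smul_eq_mul, mul_comm]
    symm
    rw [← sub_eq_zero]
    refine Subtype.ext (eq_zero_of_sesq_weighted_eq_zero (p := t)
      (g - adjTrace B m t s h).2 fun z => ?_)
    rw [← sesq_apply, Submodule.coe_sub, map_sub, sub_apply, sesq_adjTrace, ← hf, hfz,
      sub_eq_zero]
    exact Finset.sum_congr rfl fun i _ => by rw [hh]; rfl
  · rintro _ ⟨h, rfl⟩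
    rw [LinearMap.mem_ker]
    funext z
    refine (sesq_adjTrace h (z : C(I, ℂ))).trans ?_
    have hz : endpoint B m t s (weighted (integrable_top B m) t z) = 0 := LinearMap.mem_ker.1 z.2
    simp [hz]

theorem finrank_ker_reduced (hB : B.StrictMonoUpTo m) :
    FiniteDimensional ℂ (LinearMap.ker (reduced B m t s)) ∧
      Module.finrank ℂ (LinearMap.ker (reduced B m t s)) = m := by
  rw [ker_reduced hB]
  refine ⟨inferInstance, ?_⟩
  rw [LinearMap.finrank_range_of_inj (injective_adjTrace hB)]
  simp

/-- The functionals that vanish on the elements with zero boundary values are the linear forms in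
the boundary values; such a form is zero if and only if it vanishes on the kernel of `V`. -/
theorem finrank_ker_restrict (hB : B.StrictMonoUpTo m)
    (hj : ∀ F, F ∈ S.dual ↔ ∃ d, j d = F) :
    FiniteDimensional ℂ (LinearMap.ker (S.restrict j)) ∧
      Module.finrank ℂ (LinearMap.ker (S.restrict j)) + V.rank = 2 * m := by
  choose L hL using fun l => (hj _).1 (S.bdryFunctional_mem l)
  set Λ : (Fin m ⊕ Fin m → ℂ) →ₗ[ℂ] D :=
    { toFun := L
      map_add' := fun l l' => j.injective (by rw [map_add, hL, hL, hL, map_add])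
      map_smul' := fun c l => j.injective (by
        rw [RingHom.id_apply, map_smul, hL, hL, map_smul]) } with hΛ
  have hΛL : ∀ l, j (Λ l) = S.bdryFunctional l := hL
  have hker : LinearMap.ker (S.restrict j) = LinearMap.range Λ := by
    apply le_antisymm
    · intro F hF0
      obtain ⟨b, g, hg, hF⟩ := S.mem_dual.1 ((hj _).2 ⟨F, rfl⟩)
      set H := adjSolve B m (0, b) with hH
      have hker : (⟨_, sub_adjTop_mem (t := t) hg H⟩ : vanishing (B.top m) s) ∈
          LinearMap.ker (reduced B m t s) := by
        rw [LinearMap.mem_ker]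
        funext z
        refine (S.functional_test b g z).symm.trans ?_
        rw [hF]
        exact congrFun (LinearMap.mem_ker.1 hF0) z
      rw [ker_reduced hB] at hker
      obtain ⟨h, hh⟩ := hker
      have hh' : adjTop B m t s (adjSolve B m (h, 0)) = g - adjTop B m t s H :=
        congrArg Subtype.val hh
      refine ⟨Sum.elim (fun i => -h i) (fun i => adjSolve B m (h, 0) i 1 + H i 1),
        j.injective (ContinuousLinearMap.ext fun z => ?_)⟩
      rw [hΛL, ← hF, S.functional_eq 0, ← hH, ← hh', functional_apply,
        ← adjoint_identity_homogeneous (S.isSol z) h, bdryFunctional_apply, Fintype.sum_sum_type]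
      simp only [Sum.elim_inl, Sum.elim_inr, Pi.zero_apply, map_zero, zero_apply,
        Finset.sum_const_zero, zero_mul, sub_zero, zero_add, bdry_apply, boundary, add_mul,
        Finset.sum_add_distrib, neg_mul, Finset.sum_neg_distrib]
      ring
    · rintro _ ⟨l, rfl⟩
      rw [LinearMap.mem_ker]
      funext z
      change j (Λ l) (S.test z) = 0
      rw [hΛL, bdryFunctional_apply, bdry_test]
      simp
  have hann : Module.finrank ℂ (LinearMap.ker Λ) = V.rank := by
    refine finrank_annihilator_ker V _ fun l => ?_
    constructor
    · intro hl v hv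
      obtain ⟨z, rfl⟩ := S.exists_bdry_eq hB v hv
      rw [← bdryFunctional_apply]
      rw [← hΛL, LinearMap.mem_ker.1 hl, map_zero]
      rfl
    · intro h
      refine LinearMap.mem_ker.2 (j.injective (ContinuousLinearMap.ext fun z => ?_))
      rw [hΛL, map_zero, bdryFunctional_apply]
      exact h _ (by rw [bdry_apply]; exact S.bc z)
  rw [hker]
  refine ⟨inferInstance, ?_⟩
  rw [← hann, LinearMap.finrank_range_add_finrank_ker, Module.finrank_fintype_fun_eq_card]
  simp [two_mul]

end Dual

end SolSpace

end QuasiSobolev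
end

noncomputable section

namespace QuasiSobolev

/-! ### The operator of the sesquilinear expression -/

/-- The conditions on the coefficients `p_{ij}` that enter the proof, for conjugate exponents `s`
and `t`, together with the condition that `A_{n-1,n}` and `B_{m-1,m}` have the same zeros. -/
structure Admissible (A B : CoeffSystem) (n m : ℕ) (s t : ℝ≥0∞) (p : ℕ → ℕ → I → ℂ) : Prop where
  main : MemLp (p n m) ∞ volume
  main_ne : ∀ᵐ x : I, p n m x ≠ 0
  main_inv : MemLp (fun x => (p n m x)⁻¹) ∞ volume
  row : ∀ i : Fin n, MemLp (p i m) s volume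
  row_zero : ∀ i : Fin n, ∀ᵐ x : I, B.top m x = 0 → p i m x = 0
  col : ∀ j : Fin m, MemLp (p n j) t volume
  inner : ∀ (i : Fin n) (j : Fin m), MemLp (p i j) 1 volume
  zeros : ∀ᵐ x : I, A.top n x = 0 ↔ B.top m x = 0

section State

variable {A B : CoeffSystem} {n m : ℕ} {s t : ℝ≥0∞} {p : ℕ → ℕ → I → ℂ}

variable (A B n m p) in
/-- The matrix of the system for the pair `(Y, H)` of a solution of the given system and of the
solution of the adjoint of the second system whose right-hand side depends on `Y`. -/
def stateMat : Fin n ⊕ Fin m → Fin n ⊕ Fin m → I → ℂ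
  | .inl i, .inl k => sysMat A n i k
  | .inl _, .inr _ => 0
  | .inr j, .inl i => p i j
  | .inr j, .inr l => adjMat B m j l

variable (A n m s p) in
/-- The coefficients of `u = |A_{n-1,n}|^{1/s} Y_n` in the system for `(Y, H)`. -/
def stateIn : Fin n ⊕ Fin m → I → ℂ
  | .inl i => if (i : ℕ) + 1 = n then lead A n s else 0
  | .inr j => p n j

variable (B n m t p) in
/-- The coefficients of `(Y, H)` in the last component of the reduced functional. -/
def stateOut : Fin n ⊕ Fin m → I → ℂ
  | .inl i => p i m
  | .inr j => if (j : ℕ) + 1 = m then fun x => -conj (lead B m t x) else 0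

variable (h : Admissible A B n m s t p)
include h

theorem memLp_stateMat (k l : Fin n ⊕ Fin m) : MemLp (stateMat A B n m p k l) 1 volume := by
  rcases k with k | k <;> rcases l with l | l
  · exact memLp_sysMat A n k l
  · exact MemLp.zero
  · exact h.inner l k
  · exact memLp_adjMat B m k l

theorem memLp_stateIn [Fact (1 ≤ t)] [t.HolderConjugate s] (k : Fin n ⊕ Fin m) : MemLp (stateIn A n m s p k) t volume := by
  have : s.HolderConjugate t := ENNReal.HolderConjugate.symm
  rcases k with k | k
  · rw [stateIn]
    split_ifs
    · exact memLp_lead A n s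
    · exact MemLp.zero
  · exact h.col k

theorem memLp_stateOut [Fact (1 ≤ s)] [t.HolderConjugate s] (k : Fin n ⊕ Fin m) :
    MemLp (stateOut B n m t p k) s volume := by
  rcases k with k | k
  · exact h.row k
  · rw [stateOut]
    split_ifs
    · exact (memLp_lead B m t (q := s)).star.neg
    · exact MemLp.zero

variable [Fact (1 ≤ s)] [Fact (1 ≤ t)] [t.HolderConjugate s]

/-- The operator that takes `u = |A_{n-1,n}|^{1/s} Y_n`, where `Y(0) = 0`, to the last component
of the functional after all the other components are removed by integration by parts. -/
def reduction : Lp ℂ s (volume : Measure I) →L[ℂ] Lp ℂ s (volume : Measure I) :=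
  ioOp (stateMat A B n m p) (memLp_stateMat h) (stateIn A n m s p) (memLp_stateIn h)
    (stateOut B n m t p) (memLp_stateOut h) (p n m) h.main

theorem bijective_reduction : Function.Bijective (reduction h) :=
  bijective_ioOp h.main_ne h.main_inv

theorem outputOp_mem_vanishing (X : Fin n ⊕ Fin m → C(I, ℂ)) :
    outputOp (stateOut B n m t p) (memLp_stateOut h) X ∈ vanishing (B.top m) s := by
  simp only [outputOp, sum_apply, ContinuousLinearMap.comp_apply, ContinuousLinearMap.proj_apply]
  refine sum_mem fun k _ => mulC_mem_vanishing _ ?_ _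
  rcases k with k | k
  · exact h.row_zero k
  · refine .of_forall fun x hx => ?_
    rw [stateOut]
    split_ifs
    · simp only [lead_eq_zero hx, map_zero, neg_zero]
    · rfl

theorem reduction_mem_vanishing_iff {u : Lp ℂ s (volume : Measure I)} :
    reduction h u ∈ vanishing (B.top m) s ↔ u ∈ vanishing (A.top n) s := by
  have e : reduction h u = mulLp (p n m) h.main u + outputOp (stateOut B n m t p)
    (memLp_stateOut h) (Ring.inverse (1 - volterra (stateMat A B n m p) (memLp_stateMat h))
      (inputOp (stateIn A n m s p) (memLp_stateIn h) u)) := rfl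
  rw [e, Submodule.add_mem_iff_left _ (outputOp_mem_vanishing h _), mem_vanishing, mem_vanishing]
  have h1 := coeFn_mulLp (r := s) (p n m) h.main u
  constructor
  · intro hu
    filter_upwards [h1, h.main_ne, h.zeros, hu] with x h2 h3 h4 h5 h6
    have := h5 (h4.1 h6)
    rw [h2] at this
    exact (mul_eq_zero.1 this).resolve_left h3
  · intro hu
    filter_upwards [h1, h.zeros, hu] with x h2 h4 h5 h6
    rw [h2, h5 (h4.2 h6), mul_zero]

variable [s.HolderConjugate t] {U : Matrix (Fin n ⊕ Fin n) (Fin n ⊕ Fin n) ℂ} {X : Type*}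
  [NormedAddCommGroup X] [NormedSpace ℂ X] (SX : SolSpace A n s t U X)

/-- The coefficient `p_{nm} u + ∑_{i<n} p_{im} Y_i` of `|B_{m-1,m}|^{1/t} conj(Z_m)`. -/
def topCoeff : X →L[ℂ] Lp ℂ s (volume : Measure I) :=
  (mulLp (p n m) h.main).comp SX.top + ∑ i : Fin n, (mulC (p i m) (h.row i)).comp (SX.comp i)

/-- The coefficient `p_{nj} u + ∑_{i<n} p_{ij} Y_i` of `conj(Z_j)`, `j < m`. -/
def lowCoeff : X →L[ℂ] (Fin m → Lp ℂ 1 (volume : Measure I)) :=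
  ContinuousLinearMap.pi fun j =>
    (mulLp (r := 1) (p n j) (h.col j)).comp SX.top + ∑ i : Fin n, (mulC (p i j) (h.inner i j)).comp
      (SX.comp i)

theorem topCoeff_mem_vanishing (x : X) : topCoeff h SX x ∈ vanishing (B.top m) s := by
  simp only [topCoeff, add_apply, sum_apply, ContinuousLinearMap.comp_apply]
  refine add_mem ?_ (sum_mem fun i _ => mulC_mem_vanishing _ (h.row_zero i) _)
  refine mulLp_mem_vanishing h.main ?_
  have h0 := SX.top_mem x
  rw [mem_vanishing] at h0 ⊢
  filter_upwards [h.zeros, h0] with y h1 h2 h3 using h2 (h1.2 h3)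

/-- On the elements with `Y(0) = 0` the operator `reduction` performs the integration by parts: its
states are `Y` and the solution `H` of the inhomogeneous adjoint system with `H(0) = 0`. -/
theorem reduction_top {x : X} (hx : ∀ i, SX.comp i x 0 = 0) :
    reduction h (SX.top x) = topCoeff h SX x -
      adjTop B m t s (adjSolve B m (0, lowCoeff h SX x)) := by
  set H := adjSolve B m (0, lowCoeff h SX x) with hH
  have hH' := adjSolve_eq' 0 (lowCoeff h SX x) (A := B)
  rw [← hH, map_zero, zero_add] at hH'
  have hY := SX.isSol x
  have hX : Sum.elim (fun i => SX.comp i x) H =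
      Ring.inverse (1 - volterra (stateMat A B n m p) (memLp_stateMat h))
        (inputOp (stateIn A n m s p) (memLp_stateIn h) (SX.top x)) := by
    refine continuousMap_eq_inverse_iff.2 (funext fun k => ?_)
    rw [Pi.add_apply, volterra_apply, Fintype.sum_sum_type]
    rcases k with k | k
    · have h1 := congrFun hY k
      have h0 : constVec (Fin n) (fun i => SX.comp i x 0) = 0 := by
        simp only [hx]
        exact map_zero (constVec (Fin n))
      rw [h0, zero_add, Pi.add_apply, volterra_apply] at h1
      have h2 : ∀ l : Fin m, mulC (stateMat A B n m p (Sum.inl k) (Sum.inr l))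
          (memLp_stateMat h (Sum.inl k) (Sum.inr l)) (H l) = 0 := by
        intro l
        refine Lp.ext ((coeFn_mulC _ _ _).trans ?_)
        filter_upwards [Lp.coeFn_zero ℂ 1 (volume : Measure I)] with y hy
        rw [hy]
        simp [stateMat]
      simp only [Sum.elim_inl, Sum.elim_inr, h2, map_zero, Finset.sum_const_zero, add_zero]
      refine h1.trans ?_
      congr 1
      simp only [forcing, inputOp, ContinuousLinearMap.coe_pi']
      by_cases hk : (k : ℕ) + 1 = n
      · rw [if_pos hk]
        simp only [stateIn, if_pos hk]
      · rw [if_neg hk]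
        simp only [stateIn, if_neg hk, zero_apply, ContinuousLinearMap.comp_apply]
        have h3 : (mulLp (q := t) (0 : I → ℂ) MemLp.zero (SX.top x) : Lp ℂ 1 (volume : Measure I)) = 0 := by
          refine Lp.ext ((coeFn_mulLp (r := 1) (q := t) _ _ _).trans ?_)
          filter_upwards [Lp.coeFn_zero ℂ 1 (volume : Measure I)] with y hy
          rw [hy]
          simp
        rw [h3, map_zero]
    · have h1 := congrFun hH' k
      rw [Pi.add_apply, volterra_apply] at h1
      refine h1.trans ?_
      have h2 : lowCoeff h SX x k = mulLp (r := 1) (p n k) (h.col k) (SX.top x) +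
          ∑ i : Fin n, mulC (p i k) (h.inner i k) (SX.comp i x) := by
        simp [lowCoeff]
      rw [h2, map_add, map_sum]
      simp only [Sum.elim_inl, Sum.elim_inr, inputOp, ContinuousLinearMap.coe_pi',
        ContinuousLinearMap.comp_apply, stateMat, stateIn]
      abel
  have e : reduction h (SX.top x) = mulLp (p n m) h.main (SX.top x) + outputOp (stateOut B n m t p)
    (memLp_stateOut h) (Ring.inverse (1 - volterra (stateMat A B n m p) (memLp_stateMat h))
      (inputOp (stateIn A n m s p) (memLp_stateIn h) (SX.top x))) := rfl
  rw [e, ← hX]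
  simp only [outputOp, topCoeff, adjTop, add_apply, sum_apply, ContinuousLinearMap.comp_apply,
    ContinuousLinearMap.proj_apply, Fintype.sum_sum_type, Sum.elim_inl, Sum.elim_inr]
  rw [add_sub_assoc]
  congr 1
  rw [sub_eq_add_neg, ← Finset.sum_neg_distrib]
  congr 1
  refine Finset.sum_congr rfl fun j _ => ?_
  by_cases hj : (j : ℕ) + 1 = m
  · rw [if_pos hj]
    refine Lp.ext ?_
    filter_upwards [coeFn_mulC (stateOut B n m t p (Sum.inr j)) (memLp_stateOut h (Sum.inr j))
      (H j), coeFn_mulC (fun x => conj (lead B m t x)) (memLp_lead B m t (q := s)).star (H j),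
      Lp.coeFn_neg (mulC (fun x => conj (lead B m t x)) (memLp_lead B m t (q := s)).star (H j))]
      with y h1 h2 h3
    rw [h1]
    refine Eq.trans ?_ h3.symm
    rw [Pi.neg_apply, h2]
    simp only [stateOut, if_pos hj]
    ring
  · rw [if_neg hj]
    refine Lp.ext ?_
    filter_upwards [coeFn_mulC (stateOut B n m t p (Sum.inr j)) (memLp_stateOut h (Sum.inr j))
      (H j), Lp.coeFn_zero ℂ s (volume : Measure I)] with y h1 h2
    rw [h1, zero_apply, neg_zero, h2]
    simp [stateOut, if_neg hj]

variable {V : Matrix (Fin m ⊕ Fin m) (Fin m ⊕ Fin m) ℂ} {Z : Type*}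
  [NormedAddCommGroup Z] [NormedSpace ℂ Z] (SZ : SolSpace B m t s V Z)

/-- The operator that corresponds to the sesquilinear expression, with values in the space of all
the bounded functionals. -/
def formOp (Q : Matrix (Fin m ⊕ Fin m) (Fin n ⊕ Fin n) ℂ) : X →L[ℂ] (Z →L⋆[ℂ] ℂ) :=
  SZ.functional.comp ((lowCoeff h SX).prod (topCoeff h SX)) +
    SZ.bdryFunctional.comp (Q.mulVecLin.toContinuousLinearMap.comp SX.bdry)

theorem formOp_apply (Q : Matrix (Fin m ⊕ Fin m) (Fin n ⊕ Fin n) ℂ) (x : X) :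
    formOp h SX SZ Q x = SZ.functional (lowCoeff h SX x, topCoeff h SX x) +
      SZ.bdryFunctional (Q *ᵥ SX.bdry x) := rfl

theorem formOp_mem (Q : Matrix (Fin m ⊕ Fin m) (Fin n ⊕ Fin n) ℂ) (x : X) :
    formOp h SX SZ Q x ∈ SZ.dual :=
  add_mem (SZ.mem_dual.2 ⟨_, _, topCoeff_mem_vanishing h SX x, rfl⟩) (SZ.bdryFunctional_mem _)

theorem formOp_test (Q : Matrix (Fin m ⊕ Fin m) (Fin n ⊕ Fin n) ℂ) {x : X} (hx : SX.bdry x = 0)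
    (z : SolSpace.nullSpace B m t s) : formOp h SX SZ Q x (SZ.test z) =
      sesq (weighted (integrable_top B m) t) (reduction h (SX.top x)) z := by
  have h0 : ∀ i, SX.comp i x 0 = 0 := fun i => congrFun hx (Sum.inl i)
  rw [formOp_apply, hx, Matrix.mulVec_zero, map_zero, add_zero, reduction_top h SX h0]
  exact SZ.functional_test _ _ _

end State

end QuasiSobolev
end

noncomputable section

namespace QuasiSobolev

/-! ### The Fredholm property and the index -/

section Main

variable {A B : CoeffSystem} {n m : ℕ} {s t : ℝ≥0∞} {p : ℕ → ℕ → I → ℂ}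
  [Fact (1 ≤ s)] [Fact (1 ≤ t)] [s.HolderConjugate t]
  {U : Matrix (Fin n ⊕ Fin n) (Fin n ⊕ Fin n) ℂ} {X : Type*}
  [NormedAddCommGroup X] [NormedSpace ℂ X]
  {V : Matrix (Fin m ⊕ Fin m) (Fin m ⊕ Fin m) ℂ} {Z : Type*}
  [NormedAddCommGroup Z] [NormedSpace ℂ Z]
  {D : Type*} [NormedAddCommGroup D] [NormedSpace ℂ D]

/-- The norm of an element with zero initial values is controlled by its last component. -/
theorem SolSpace.norm_le_norm_top (SX : SolSpace A n s t U X) {x : X} (hx : SX.bdry x = 0) :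
    ‖x‖ ≤ (n * ‖solve A n s t‖ + 1) * ‖SX.top x‖ := by
  have h0 : ∀ i, SX.comp i x 0 = 0 := fun i => congrFun hx (Sum.inl i)
  have h1 := (SX.isSol x).eq_solve
  refine (SX.norm_le _).trans ?_
  rw [add_mul, one_mul]
  refine add_le_add ?_ le_rfl
  have h : ∀ i, ‖SX.comp i x‖ ≤ ‖solve A n s t‖ * ‖SX.top x‖ := by
    intro i
    refine (norm_le_pi_norm (fun i => SX.comp i x) i).trans ?_
    rw [h1]
    refine ((solve A n s t).le_opNorm _).trans ?_
    have h2 : (fun i => SX.comp i x 0) = 0 := funext h0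
    rw [h2]
    simp [Prod.norm_def]
  refine (Finset.sum_le_sum fun i _ => h i).trans ?_
  simp [mul_assoc]

/-- The boundary values fill the kernel of `U`. -/
theorem finrank_quotient_ker_bdry (hA : A.StrictMonoUpTo n) (SX : SolSpace A n s t U X) :
    FiniteDimensional ℂ (X ⧸ LinearMap.ker SX.bdry.toLinearMap) ∧
      Module.finrank ℂ (X ⧸ LinearMap.ker SX.bdry.toLinearMap) + U.rank = 2 * n := by
  have hr : LinearMap.range SX.bdry.toLinearMap = LinearMap.ker U.mulVecLin := by
    apply le_antisymm
    · rintro _ ⟨x, rfl⟩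
      change U *ᵥ SX.bdry x = 0
      rw [SX.bdry_apply]
      exact SX.bc x
    · intro v hv
      obtain ⟨x, hx⟩ := SX.exists_bdry_eq hA v hv
      exact ⟨x, hx⟩
  have e := SX.bdry.toLinearMap.quotKerEquivRange
  refine ⟨Module.Finite.equiv e.symm, ?_⟩
  rw [e.finrank_eq, hr, finrank_ker_add_rank]
  simp [two_mul]

variable [t.HolderConjugate s] (h : Admissible A B n m s t p)

/-- `reduction` as a linear map from the elements with zero boundary values. -/
def reductionTop (SX : SolSpace A n s t U X) :
    LinearMap.ker SX.bdry.toLinearMap →ₗ[ℂ] vanishing (B.top m) s where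
  toFun x := ⟨reduction h (SX.top x), (reduction_mem_vanishing_iff h).2 (SX.top_mem x)⟩
  map_add' x y := Subtype.ext (by simp)
  map_smul' c x := Subtype.ext (by simp)

theorem injective_reductionTop (SX : SolSpace A n s t U X) :
    Function.Injective (reductionTop h SX) := by
  rw [injective_iff_map_eq_zero]
  intro x hx
  have h1 : reduction h (SX.top x) = reduction h 0 := by
    rw [map_zero]
    exact congrArg Subtype.val hx
  have h2 := SX.norm_le_norm_top (x := x) (LinearMap.mem_ker.1 x.2)
  rw [(bijective_reduction h).1 h1, norm_zero, mul_zero, norm_le_zero_iff] at h2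
  exact Subtype.ext h2

/-- The range consists of those `reduction u` for which the solution with `Y(0) = 0` and
`|A_{n-1,n}|^{1/s} Y_n = u` satisfies `Y(1) = 0`. -/
theorem finrank_quotient_range_reductionTop (hA : A.StrictMonoUpTo n)
    (hs : s ≠ ∞) (SX : SolSpace A n s t U X)
    (hX : ∀ u ∈ vanishing (A.top n) s, ∀ Y, IsSol A n s (q := t) u Y → U *ᵥ boundary Y = 0 →
      ∃ x, (∀ i, SX.comp i x = Y i) ∧ SX.top x = u) :
    FiniteDimensional ℂ (vanishing (B.top m) s ⧸ LinearMap.range (reductionTop h SX)) ∧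
      Module.finrank ℂ (vanishing (B.top m) s ⧸ LinearMap.range (reductionTop h SX)) = n := by
  set L := LinearEquiv.ofBijective (reduction h).toLinearMap (bijective_reduction h) with hL
  have hLr : ∀ u, L u = reduction h u := fun u => rfl
  set θ : vanishing (B.top m) s →ₗ[ℂ] (Fin n → ℂ) :=
    (endpoint A n s t).toLinearMap ∘ₗ L.symm.toLinearMap ∘ₗ (vanishing (B.top m) s).subtype with hθ
  have hker : LinearMap.range (reductionTop h SX) = LinearMap.ker θ := by
    apply le_antisymm
    · rintro _ ⟨x, rfl⟩
      rw [LinearMap.mem_ker]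
      change endpoint A n s t (L.symm (reduction h (SX.top x))) = 0
      rw [← hLr, L.symm_apply_apply]
      have hx : SX.bdry x = 0 := LinearMap.mem_ker.1 x.2
      have h1 := (SX.isSol x).eq_solve
      have h2 : (fun i => SX.comp i (x : X) 0) = 0 := funext fun i => congrFun hx (Sum.inl i)
      rw [h2] at h1
      funext i
      rw [endpoint_apply, ← h1]
      exact congrFun hx (Sum.inr i)
    · intro g hg
      have hg' : endpoint A n s t (L.symm g) = 0 := LinearMap.mem_ker.1 hg
      have hu : L.symm g ∈ vanishing (A.top n) s := by
        rw [← reduction_mem_vanishing_iff h, ← hLr, L.apply_symm_apply]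
        exact g.2
      have hb : boundary (solve A n s t (0, L.symm g)) = 0 := by
        funext k
        rcases k with k | k
        · exact solve_initial _ _ _
        · exact congrFun hg' k
      obtain ⟨x, h1, h2⟩ := hX _ hu _ (isSol_solve 0 _) (by rw [hb, Matrix.mulVec_zero])
      have hx : SX.bdry x = 0 := by
        rw [SX.bdry_apply, ← hb]
        congr 1
        exact funext h1
      refine ⟨⟨x, LinearMap.mem_ker.2 hx⟩, Subtype.ext ?_⟩
      change reduction h (SX.top x) = g
      rw [h2, ← hLr, L.apply_symm_apply]
  have hsurj : Function.Surjective θ := by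
    intro v
    obtain ⟨z, hz⟩ := surjective_endpoint_weighted hA s (q := t) v
    have hz' : reduction h (weighted (integrable_top A n) s z) ∈ vanishing (B.top m) s :=
      (reduction_mem_vanishing_iff h).2 (weighted_mem_vanishing _ hs z)
    refine ⟨⟨_, hz'⟩, ?_⟩
    rw [← hz]
    change endpoint A n s t (L.symm (reduction h _)) = _
    rw [← hLr, L.symm_apply_apply]
    rfl
  have e := θ.quotKerEquivOfSurjective hsurj
  rw [hker]
  exact ⟨Module.Finite.equiv e.symm, by rw [e.finrank_eq]; simp⟩

/-- An a priori estimate on a subspace of finite codimension. The conditions `φ x = 0` are that the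
boundary values are zero, and that the reduced functional `∫ g conj(|B_{m-1,m}|^{1/t} z)` vanishes
on a complement of the null space, so that testing with zero boundary values yields `‖g‖`. -/
theorem exists_norm_le_of_finite_conditions (hB : B.StrictMonoUpTo m) (hs : s ≠ ∞)
    (SX : SolSpace A n s t U X) (SZ : SolSpace B m t s V Z) (j : D →ₗᵢ[ℂ] (Z →L⋆[ℂ] ℂ))
    (Q : Matrix (Fin m ⊕ Fin m) (Fin n ⊕ Fin n) ℂ) (T : X →L[ℂ] D)
    (hT : ∀ x, j (T x) = formOp h SX SZ Q x) :
    ∃ (φ : X →L[ℂ] (Fin n ⊕ Fin n → ℂ) × (Fin m → ℂ)) (C : ℝ),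
      ∀ x, φ x = 0 → ‖x‖ ≤ C * ‖T x‖ := by
  set W := weighted (integrable_top B m) t with hW
  set Ev := (endpoint B m t s).comp W with hEv
  obtain ⟨r₀, hr₀⟩ := Ev.toLinearMap.exists_rightInverse_of_surjective
    (LinearMap.range_eq_top.2 (surjective_endpoint_weighted hB t))
  set r : (Fin m → ℂ) →L[ℂ] C(I, ℂ) := LinearMap.toContinuousLinearMap r₀ with hr
  have hr' : ∀ v, Ev (r v) = v := fun v => LinearMap.congr_fun hr₀ v
  set L := ContinuousLinearEquiv.ofBijective (reduction h)
    (LinearMap.ker_eq_bot.2 (bijective_reduction h).1)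
    (LinearMap.range_eq_top.2 (bijective_reduction h).2) with hL
  have hLr : ∀ u, L u = reduction h u := fun u => rfl
  set φ : X →L[ℂ] (Fin n ⊕ Fin n → ℂ) × (Fin m → ℂ) := SX.bdry.prod
    (ContinuousLinearMap.pi fun k => (ContinuousLinearMap.apply' ℂ (starRingEnd ℂ)
      (r (Pi.single k 1))).comp ((sesq W).comp ((reduction h).comp SX.top))) with hφ
  set C₁ : ℝ := m * ‖solve B m t s‖ + 1 with hC₁
  set C₂ : ℝ := 1 + ‖(W.comp r).comp (endpoint B m t s)‖ with hC₂
  set C₃ : ℝ := n * ‖solve A n s t‖ + 1 with hC₃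
  refine ⟨φ, C₃ * (‖(L.symm : Lp ℂ s (volume : Measure I) →L[ℂ] Lp ℂ s (volume : Measure I))‖ *
    (C₁ * C₂)), fun x hx => ?_⟩
  have hx1 : SX.bdry x = 0 := congrArg Prod.fst hx
  set g := reduction h (SX.top x) with hg
  have hx2 : ∀ v, sesq W g (r v) = 0 := by
    intro v
    rw [← Finset.univ_sum_single v, map_sum, map_sum]
    refine Finset.sum_eq_zero fun k _ => ?_
    have h3 : Pi.single k (v k) = v k • (Pi.single k 1 : Fin m → ℂ) := by
      rw [← Pi.single_smul]; simp
    have h4 : sesq W g (r (Pi.single k 1)) = 0 := congrFun (congrArg Prod.snd hx) k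
    rw [h3, map_smul, ContinuousLinearMap.map_smulₛₗ, h4, smul_zero]
  have hgn : ‖g‖ ≤ C₁ * C₂ * ‖T x‖ := by
    refine norm_le_of_forall_sesq_weighted_le (t := t) hs (integrable_top B m)
      ((reduction_mem_vanishing_iff h).2 (SX.top_mem x)) (by positivity) fun z => ?_
    -- subtraction of `r (Ev z)` makes the endpoint values vanish
    set z' : SolSpace.nullSpace B m t s := ⟨z - r (Ev z), by
      change Ev (z - r (Ev z)) = 0
      rw [map_sub, hr', sub_self]⟩ with hz'
    have h1 : sesq W g z = j (T x) (SZ.test z') := by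
      rw [hT, formOp_test h SX SZ Q hx1]
      change _ = sesq W g (z - r (Ev z))
      rw [map_sub, hx2, sub_zero]
    have h2 : ‖W z'‖ ≤ C₂ * ‖W z‖ := by
      have : W z' = W z - (W.comp r).comp (endpoint B m t s) (W z) := by
        change W (z - r (Ev z)) = _
        rw [map_sub]
        rfl
      rw [this, hC₂, add_mul, one_mul]
      exact (norm_sub_le _ _).trans (add_le_add le_rfl (ContinuousLinearMap.le_opNorm _ _))
    rw [← hW, h1]
    calc ‖j (T x) (SZ.test z')‖ ≤ ‖j (T x)‖ * ‖SZ.test z'‖ := (j (T x)).le_opNorm _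
      _ ≤ ‖T x‖ * (C₁ * (C₂ * ‖W z‖)) := by
        rw [j.norm_map]
        refine mul_le_mul_of_nonneg_left ((SZ.norm_test_le z').trans ?_) (norm_nonneg _)
        exact mul_le_mul_of_nonneg_left h2 (by positivity)
      _ = C₁ * C₂ * ‖T x‖ * ‖W z‖ := by ring
  have htop : ‖SX.top x‖ ≤
      ‖(L.symm : Lp ℂ s (volume : Measure I) →L[ℂ] Lp ℂ s (volume : Measure I))‖ * ‖g‖ := by
    have : SX.top x = L.symm g := by rw [hg, ← hLr, L.symm_apply_apply]
    rw [this]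
    exact (L.symm : Lp ℂ s (volume : Measure I) →L[ℂ] Lp ℂ s (volume : Measure I)).le_opNorm g
  calc ‖x‖ ≤ C₃ * ‖SX.top x‖ := SX.norm_le_norm_top hx1
    _ ≤ C₃ * (‖(L.symm : Lp ℂ s (volume : Measure I) →L[ℂ] Lp ℂ s (volume : Measure I))‖ *
        (C₁ * C₂ * ‖T x‖)) := by
      refine mul_le_mul_of_nonneg_left (htop.trans ?_) (by positivity)
      exact mul_le_mul_of_nonneg_left hgn (norm_nonneg _)
    _ = _ := by ring

/-- The theorem for abstract spaces of solutions. Here `hX` says that `X` contains all the solutions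
with last component in the weighted space, and `hj` that `D` consists of the integral functionals. -/
theorem isFredholm_and_index_eq [CompleteSpace X] (hA : A.StrictMonoUpTo n)
    (hB : B.StrictMonoUpTo m) (hs : s ≠ ∞) (SX : SolSpace A n s t U X)
    (hX : ∀ u ∈ vanishing (A.top n) s, ∀ Y, IsSol A n s (q := t) u Y → U *ᵥ boundary Y = 0 →
      ∃ x, (∀ i, SX.comp i x = Y i) ∧ SX.top x = u)
    (SZ : SolSpace B m t s V Z) {j : D →ₗᵢ[ℂ] (Z →L⋆[ℂ] ℂ)}
    (hj : ∀ F, F ∈ SZ.dual ↔ ∃ d, j d = F)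
    (Q : Matrix (Fin m ⊕ Fin m) (Fin n ⊕ Fin n) ℂ) (T : X →L[ℂ] D)
    (hT : ∀ x, j (T x) = formOp h SX SZ Q x) :
    T.IsFredholm ∧ T.toLinearMap.index = (n : ℤ) - m - U.rank + V.rank := by
  set X₀ := LinearMap.ker SX.bdry.toLinearMap with hX₀
  obtain ⟨f1, d1⟩ := finrank_quotient_ker_bdry hA SX
  obtain ⟨f2, d2⟩ := finrank_quotient_range_reductionTop h hA hs SX hX
  obtain ⟨f3, d3⟩ := SolSpace.finrank_ker_reduced (t := t) (s := s) hB
  obtain ⟨f4, d4⟩ := SZ.finrank_ker_restrict hB hj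
  have f5 : FiniteDimensional ℂ (X ⧸ LinearMap.range X₀.subtype) := by
    rw [Submodule.range_subtype]
    exact f1
  obtain ⟨hcofg, hindex⟩ := index_eq_of_factorization X₀.subtype T.toLinearMap (SZ.restrict j)
    (reductionTop h SX) (SolSpace.reduced B m t s) (fun x => by
      funext z
      change j (T x) (SZ.test z) = _
      rw [hT, formOp_test h SX SZ Q (LinearMap.mem_ker.1 x.2)]
      rfl) X₀.injective_subtype (injective_reductionTop h SX) (SZ.range_restrict hj)
  obtain ⟨φ, C, hC⟩ := exists_norm_le_of_finite_conditions h hB hs SX SZ j Q T hT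
  have hF := isFredholm_of_norm_le T φ C hC hcofg
  refine ⟨hF, ?_⟩
  have d5 : Module.finrank ℂ (X ⧸ LinearMap.range X₀.subtype) + U.rank = 2 * n := by
    rw [Submodule.range_subtype]
    exact d1
  rw [hindex hF.finite_ker, d2, d3]
  omega

/-- Existence of the operator with values in the space of the integral functionals. -/
theorem exists_form_operator (SX : SolSpace A n s t U X) (SZ : SolSpace B m t s V Z)
    {j : D →ₗᵢ[ℂ] (Z →L⋆[ℂ] ℂ)} (hj : ∀ F, F ∈ SZ.dual ↔ ∃ d, j d = F)
    (Q : Matrix (Fin m ⊕ Fin m) (Fin n ⊕ Fin n) ℂ) :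
    ∃ T : X →L[ℂ] D, ∀ x, j (T x) = formOp h SX SZ Q x := by
  choose T hT using fun x => (hj _).1 (formOp_mem h SX SZ Q x)
  refine ⟨LinearMap.mkContinuous
    { toFun := T
      map_add' := fun x y => j.injective (by rw [map_add, hT, hT, hT, map_add])
      map_smul' := fun c x => j.injective (by rw [RingHom.id_apply, map_smul, hT, hT, map_smul]) }
    ‖formOp h SX SZ Q‖ fun x => ?_, hT⟩
  rw [← j.norm_map]
  change ‖j (T x)‖ ≤ _
  rw [hT]
  exact (formOp h SX SZ Q).le_opNorm x

end Main

end QuasiSobolev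
end

noncomputable section

namespace QuasiSobolev

/-! ### The spaces of the theorem as spaces of solutions -/

section WSpace

variable (A : CoeffSystem) (n : ℕ) (p : ℝ≥0∞) [Fact (1 ≤ p)]

/-- The components of an element of the ambient space with numbers less than `n`. -/
def ambientComp (i : Fin n) : Ambient A n p →L[ℂ] C(I, ℂ) :=
  (PiLp.proj 1 (fun _ : Fin n => C(I, ℂ)) i).comp (WithLp.fstL 1 ℂ _ _)

variable {p} in
/-- The weighted last component of an element of the ambient space. -/
def ambientTop (hp : p ≠ ∞) : Ambient A n p →L[ℂ] Lp ℂ p (volume : Measure I) :=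
  (weightIso (integrable_top A n) p hp).toContinuousLinearMap.comp (WithLp.sndL 1 ℂ _ _)

variable {A n p}

theorem norm_ambient (hp : p ≠ ∞) (x : Ambient A n p) :
    ‖x‖ = (∑ i, ‖ambientComp A n p i x‖) + ‖ambientTop A n hp x‖ := by
  rw [WithLp.prod_norm_eq_of_L1, PiLp.norm_eq_of_L1]
  congr 1
  exact ((weightIso (integrable_top A n) p hp).norm_map _).symm

theorem ambientTop_toAmbient (hp : p ≠ ∞) (Y : Fin (n + 1) → C(I, ℂ)) :
    ambientTop A n hp (toAmbient A n p Y) = weighted (integrable_top A n) p (Y (Fin.last n)) :=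
  haveI : IsFiniteMeasure ((volume : Measure I).withDensity fun x => ‖A.top n x‖ₑ) :=
    isFiniteMeasure_withDensity (integrable_top A n).hasFiniteIntegral.ne
  (weighted_eq_weightIso (integrable_top A n) hp _).symm

/-- The completion consists of all the solutions with last component in the weighted space:
the set of solutions is closed, and the last component can be approximated by continuous
functions. -/
theorem mem_WSpace_iff {q : ℝ≥0∞} [Fact (1 ≤ q)] [p.HolderConjugate q] (hp : p ≠ ∞)
    (x : Ambient A n p) : x ∈ WSpace A n p ↔
      IsSol A n p (q := q) (ambientTop A n hp x) fun i => ambientComp A n p i x := by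
  constructor
  · intro hx
    have hclosed : IsClosed {x : Ambient A n p |
        IsSol A n p (q := q) (ambientTop A n hp x) fun i => ambientComp A n p i x} := by
      refine isClosed_eq ?_ ?_
      · fun_prop
      · fun_prop
    refine closure_minimal ?_ hclosed hx
    rintro _ ⟨Y, rfl⟩
    have h1 := (isSolution_iff p (q := q)).1 Y.2
    rw [← ambientTop_toAmbient hp] at h1
    exact h1
  · intro hx
    refine Metric.mem_closure_iff.2 fun ε hε => ?_
    set u := ambientTop A n hp x with hu
    set C : ℝ := n * ‖solve A n p q‖ + 1 with hC
    have hC0 : 0 < C := by positivity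
    have huv : ∀ᵐ y : I, A.top n y = 0 → u y = 0 := by
      filter_upwards [coeFn_weightIso (integrable_top A n) hp x.snd] with y hy h0
      refine hy.trans ?_
      rw [wpow_eq_zero hp h0, zero_mul]
    obtain ⟨z, hz⟩ := exists_weighted_near (integrable_top A n) hp u huv (div_pos hε hC0)
    set ξ : Fin n → ℂ := fun i => ambientComp A n p i x 0 with hξ
    set Y : Fin (n + 1) → C(I, ℂ) := Fin.snoc (α := fun _ => C(I, ℂ))
      (solve A n p q (ξ, weighted (integrable_top A n) p z)) z with hY
    have h1 : (fun i : Fin n => Y i.castSucc) =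
        solve A n p q (ξ, weighted (integrable_top A n) p z) := by
      funext i
      simp [hY]
    have h2 : Y (Fin.last n) = z := by simp [hY]
    have hmem : Y ∈ CSpace A n := by
      refine (isSolution_iff p (q := q)).2 ?_
      rw [h1, h2]
      exact isSol_solve _ _
    refine ⟨toAmbient A n p Y, ⟨⟨Y, hmem⟩, rfl⟩, ?_⟩
    rw [dist_eq_norm, norm_ambient hp, map_sub, ambientTop_toAmbient, h2]
    have h3 : ∀ i, ‖ambientComp A n p i (x - toAmbient A n p Y)‖ ≤
        ‖solve A n p q‖ * ‖u - weighted (integrable_top A n) p z‖ := by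
      intro i
      have e : ambientComp A n p i (x - toAmbient A n p Y) =
          solve A n p q (0, u - weighted (integrable_top A n) p z) i := by
        have e1 : ((0, u - weighted (integrable_top A n) p z) :
            (Fin n → ℂ) × Lp ℂ p (volume : Measure I)) =
            (ξ, u) - (ξ, weighted (integrable_top A n) p z) := by simp
        rw [e1, map_sub, map_sub, ← h1, ← hx.eq_solve]
        rfl
      rw [e]
      refine (norm_le_pi_norm _ i).trans (((solve A n p q).le_opNorm _).trans ?_)
      simp [Prod.norm_def]
    calc _ ≤ C * ‖u - weighted (integrable_top A n) p z‖ := by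
          rw [hC, add_mul, one_mul]
          refine add_le_add ((Finset.sum_le_sum fun i _ => h3 i).trans ?_) le_rfl
          simp [mul_assoc]
      _ < C * (ε / C) := by gcongr
      _ = ε := by field_simp

variable (U : Matrix (Fin n ⊕ Fin n) (Fin n ⊕ Fin n) ℂ)

variable (A n p) in
/-- The embedding of `W_{p,A,U}^n` into the ambient space. -/
def WSpaceBC.incl : WSpaceBC A n p U →L[ℂ] Ambient A n p := (WSubmoduleBC A n p U).subtypeL

/-- `W_{p,A,U}^n` as a space of solutions. -/
def WSpaceBC.solSpace (q : ℝ≥0∞) [Fact (1 ≤ q)] [p.HolderConjugate q] (hp : p ≠ ∞) :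
    SolSpace A n p q U (WSpaceBC A n p U) where
  comp i := (ambientComp A n p i).comp (WSpaceBC.incl A n p U)
  top := (ambientTop A n hp).comp (WSpaceBC.incl A n p U)
  top_mem x := by
    rw [mem_vanishing]
    filter_upwards [coeFn_weightIso (integrable_top A n) hp x.1.snd] with y hy h0
    refine hy.trans ?_
    rw [wpow_eq_zero hp h0, zero_mul]
  isSol x := (mem_WSpace_iff hp _).1 x.2.1
  bc x := x.2.2
  norm_le x := (norm_ambient hp x.1).le
  exists_of_mem Y hY := by
    refine ⟨⟨toAmbient A n p Y, ?_, hY.2⟩, fun i => rfl, ambientTop_toAmbient hp Y⟩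
    exact subset_closure ⟨⟨Y, hY.1⟩, rfl⟩

/-- All the solutions with `u = |A_{n-1,n}|^{1/p} Y_n` of class `L_p` belong to `W_{p,A,U}^n`. -/
theorem WSpaceBC.exists_eq {q : ℝ≥0∞} [Fact (1 ≤ q)] [p.HolderConjugate q] (hp : p ≠ ∞)
    (u : Lp ℂ p (volume : Measure I)) (hu : u ∈ vanishing (A.top n) p) (Y : Fin n → C(I, ℂ))
    (hY : IsSol A n p (q := q) u Y) (hU : U *ᵥ boundary Y = 0) :
    ∃ x : WSpaceBC A n p U, (∀ i, (WSpaceBC.solSpace U q hp).comp i x = Y i) ∧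
      (WSpaceBC.solSpace U q hp).top x = u := by
  obtain ⟨f, hf⟩ := exists_weightIso_eq (integrable_top A n) hp u hu
  set x : Ambient A n p := WithLp.toLp 1 (WithLp.toLp 1 Y, f) with hx
  refine ⟨⟨x, (mem_WSpace_iff (q := q) hp x).2 ?_, hU⟩, fun i => rfl, hf⟩
  have : ambientTop A n hp x = u := hf
  rw [this]
  exact hY

instance WSpaceBC.completeSpace : CompleteSpace (WSpaceBC A n p U) := by
  have hclosed : IsClosed (WSubmoduleBC A n p U : Set (Ambient A n p)) := by
    have h1 : IsClosed (WSpace A n p : Set (Ambient A n p)) := isClosed_closure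
    refine h1.inter (isClosed_eq (f := fun x : Ambient A n p =>
      U *ᵥ boundary fun k => ambientComp A n p k x) ?_ continuous_const)
    have h2 : Continuous fun x : Ambient A n p => boundary fun k => ambientComp A n p k x := by
      refine continuous_pi fun k => ?_
      rcases k with k | k
      · exact (ContinuousMap.evalCLM ℂ (0 : I)).continuous.comp (ambientComp A n p k).continuous
      · exact (ContinuousMap.evalCLM ℂ (1 : I)).continuous.comp (ambientComp A n p k).continuous
    exact continuous_const.matrix_mulVec h2
  exact hclosed.completeSpace_coe

end WSpace

section CSpace

/-- A continuous function that is bounded almost everywhere satisfies the same bound everywhere. -/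
theorem norm_le_norm_weighted_top {a : I → ℂ} (ha : Integrable a volume) (z : C(I, ℂ)) :
    ‖z‖ ≤ ‖weighted ha ∞ z‖ := by
  set c := ‖weighted ha ∞ z‖ with hc
  have h1 : ∀ᵐ x : I, ‖z x‖ ≤ c := by
    have h2 := ae_le_eLpNormEssSup (f := weighted ha ∞ z) (μ := (volume : Measure I))
    rw [← eLpNorm_exponent_top] at h2
    filter_upwards [coeFn_weighted ha ∞ z, h2] with x h1 h2
    have h3 := ENNReal.toReal_mono (Lp.eLpNorm_ne_top _) h2
    rwa [toReal_enorm, ← Lp.norm_def, h1, wpow_top, one_mul] at h3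
  set F : C(I, ℂ) := ⟨fun x => ((max (‖z x‖ - c) 0 : ℝ) : ℂ), by fun_prop⟩ with hF
  have hF0 : F = 0 := by
    refine eq_zero_of_strictMono (a := fun _ => 1) (integrable_const 1) ?_ ?_
    · intro x y hxy
      simpa [measureReal_def, unitInterval.volume_Iic, x.2.1, y.2.1] using hxy
    · filter_upwards [h1] with x hx
      right
      simp [hF, hx]
  refine (ContinuousMap.norm_le z (norm_nonneg _)).2 fun x => ?_
  have h2 : ((max (‖z x‖ - c) 0 : ℝ) : ℂ) = 0 := congrArg (fun G : C(I, ℂ) => G x) hF0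
  have h3 : max (‖z x‖ - c) 0 = 0 := by exact_mod_cast h2
  have := le_max_left (‖z x‖ - c) 0
  linarith

variable {A : CoeffSystem} {n : ℕ} (U : Matrix (Fin n ⊕ Fin n) (Fin n ⊕ Fin n) ℂ)

variable (A n) in
/-- The embedding of `C_{A,U}^n` into `C[0,1]^{n+1}`. -/
def CSpaceBC.incl : CSpaceBC A n U →L[ℂ] (Fin (n + 1) → C(I, ℂ)) := (CSubmoduleBC A n U).subtypeL

/-- `C_{A,U}^n` as a space of solutions. -/
def CSpaceBC.solSpace [(∞ : ℝ≥0∞).HolderConjugate 1] (h0 : ∀ᵐ x : I, A.top n x ≠ 0) :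
    SolSpace A n ∞ 1 U (CSpaceBC A n U) where
  comp i := (ContinuousLinearMap.proj i.castSucc).comp (CSpaceBC.incl A n U)
  top := (weighted (integrable_top A n) ∞).comp
    ((ContinuousLinearMap.proj (Fin.last n)).comp (CSpaceBC.incl A n U))
  top_mem x := by
    rw [mem_vanishing]
    filter_upwards [h0] with y h1 h2 using absurd h2 h1
  isSol x := (isSolution_iff ∞ (q := 1)).1 x.2.1
  bc x := x.2.2
  norm_le x := by
    change ‖x.1‖ ≤ (∑ i : Fin n, ‖x.1 i.castSucc‖) + ‖weighted (integrable_top A n) ∞ (x.1 (Fin.last n))‖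
    have h1 := norm_le_norm_weighted_top (integrable_top A n) (x.1 (Fin.last n))
    refine (pi_norm_le_iff_of_nonneg (by positivity)).2 fun i => ?_
    have h2 : ‖x.1 i‖ ≤ ∑ i, ‖x.1 i‖ :=
      Finset.single_le_sum (f := fun i => ‖x.1 i‖) (fun i _ => norm_nonneg _) (Finset.mem_univ i)
    rw [Fin.sum_univ_castSucc] at h2
    linarith
  exists_of_mem Y hY := ⟨⟨Y, hY⟩, fun i => rfl, rfl⟩

end CSpace

end QuasiSobolev
end

noncomputable section

namespace QuasiSobolev

/-! ### The spaces of functionals of the theorem -/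

section NegW

variable {B : CoeffSystem} {m : ℕ} {t s : ℝ≥0∞} [Fact (1 ≤ t)] [Fact (1 ≤ s)]
  [t.HolderConjugate s] {V : Matrix (Fin m ⊕ Fin m) (Fin m ⊕ Fin m) ℂ}

variable (B m t s V) in
/-- The embedding of `W_{s,B,V}^{-m}` into the space of all the bounded functionals. -/
def NegWSpaceBC.incl : NegWSpaceBC B m t s V →ₗᵢ[ℂ] (WSpaceBC B m t V →L⋆[ℂ] ℂ) :=
  (NegWSubmoduleBC B m t s V).subtypeₗᵢ

theorem coeFn_top_WSpaceBC (ht : t ≠ ∞) (z : WSpaceBC B m t V) :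
    ((WSpaceBC.solSpace V s ht).top z : I → ℂ) =ᵐ[volume]
      fun x => wpow (B.top m) t x * z.1.snd x :=
  coeFn_weightIso (integrable_top B m) ht z.1.snd

theorem NegWSpaceBC.mem_dual_iff (ht : t ≠ ∞) (F : WSpaceBC B m t V →L⋆[ℂ] ℂ) :
    F ∈ (WSpaceBC.solSpace V s ht).dual ↔ ∃ d, NegWSpaceBC.incl B m t s V d = F := by
  have key : ∀ (g : I → ℂ) (g' : Lp ℂ s (volume : Measure I)) (z : WSpaceBC B m t V),
      g' =ᵐ[volume] g → ∫ x, g' x * conj ((WSpaceBC.solSpace V s ht).top z x) =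
        ∫ x, ((‖B (m - 1) m x‖ ^ (1 / t.toReal) : ℝ) : ℂ) * g x * conj (z.1.snd x) := by
    intro g g' z hg
    refine integral_congr_ae ?_
    filter_upwards [hg, coeFn_top_WSpaceBC (s := s) ht z] with x h1 h2
    rw [h1, h2, map_mul, wpow, Complex.conj_ofReal]
    ring
  rw [SolSpace.mem_dual]
  constructor
  · rintro ⟨b, g, hg, rfl⟩
    refine ⟨⟨_, fun i => b i, g, fun i => L1.integrable_coeFn (b i), Lp.memLp g, hg,
      fun z => ?_⟩, rfl⟩
    refine (SolSpace.functional_apply _ _ _ _).trans ?_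
    rw [key g g z (ae_eq_refl _)]
    congr 1
    exact Finset.sum_congr rfl fun i _ => pairing_apply _ _
  · rintro ⟨⟨_, f, g, hf, hg, hg0, hF⟩, rfl⟩
    refine ⟨fun i => (memLp_one_iff_integrable.2 (hf i)).toLp _, hg.toLp g, ?_,
      ContinuousLinearMap.ext fun z => ?_⟩
    · rw [mem_vanishing]
      filter_upwards [hg.coeFn_toLp, hg0] with x h1 h2 h3
      rw [h1, h2 h3]
    · refine Eq.trans ?_ (hF z).symm
      rw [SolSpace.functional_apply, key g _ z hg.coeFn_toLp]
      congr 1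
      refine Finset.sum_congr rfl fun i _ => ?_
      rw [pairing_apply]
      refine integral_congr_ae ?_
      filter_upwards [MemLp.coeFn_toLp (memLp_one_iff_integrable.2 (hf i))] with x h1
      rw [h1]
      rfl

end NegW

section NegC

variable {B : CoeffSystem} {m : ℕ} [(∞ : ℝ≥0∞).HolderConjugate 1]
  {V : Matrix (Fin m ⊕ Fin m) (Fin m ⊕ Fin m) ℂ}

variable (B m V) in
/-- The embedding of `W_{1,B,V}^{-m}` into the space of all the bounded functionals. -/
def NegCSpaceBC.incl : NegCSpaceBC B m V →ₗᵢ[ℂ] (CSpaceBC B m V →L⋆[ℂ] ℂ) :=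
  (NegCSubmoduleBC B m V).subtypeₗᵢ

theorem coeFn_top_CSpaceBC (h0 : ∀ᵐ x : I, B.top m x ≠ 0) (z : CSpaceBC B m V) :
    ((CSpaceBC.solSpace V h0).top z : I → ℂ) =ᵐ[volume]
      fun x => wpow (B.top m) ∞ x * z.1 (Fin.last m) x :=
  coeFn_weighted (integrable_top B m) ∞ (z.1 (Fin.last m))

theorem NegCSpaceBC.mem_dual_iff (h0 : ∀ᵐ x : I, B.top m x ≠ 0) (F : CSpaceBC B m V →L⋆[ℂ] ℂ) :
    F ∈ (CSpaceBC.solSpace V h0).dual ↔ ∃ d, NegCSpaceBC.incl B m V d = F := by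
  have key : ∀ (g : I → ℂ) (g' : Lp ℂ 1 (volume : Measure I)) (z : CSpaceBC B m V),
      g' =ᵐ[volume] g → ∫ x, g' x * conj ((CSpaceBC.solSpace V h0).top z x) =
        ∫ x, g x * conj (z.1 (Fin.last m) x) := by
    intro g g' z hg
    refine integral_congr_ae ?_
    filter_upwards [hg, coeFn_top_CSpaceBC h0 z] with x h1 h2
    rw [h1, h2, wpow_top, one_mul]
  rw [SolSpace.mem_dual]
  constructor
  · rintro ⟨b, g, hg, rfl⟩
    refine ⟨⟨_, Fin.snoc (α := fun _ => I → ℂ) (fun i => b i) g, fun i => ?_, fun z => ?_⟩, rfl⟩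
    · refine Fin.lastCases ?_ (fun i => ?_) i
      · simpa using L1.integrable_coeFn g
      · simpa using L1.integrable_coeFn (b i)
    · refine (SolSpace.functional_apply _ _ _ _).trans ?_
      rw [key g g z (ae_eq_refl _), Fin.sum_univ_castSucc]
      simp only [Fin.snoc_castSucc, Fin.snoc_last]
      congr 1
      exact Finset.sum_congr rfl fun i _ => pairing_apply _ _
  · rintro ⟨⟨_, f, hf, hF⟩, rfl⟩
    refine ⟨fun i => (memLp_one_iff_integrable.2 (hf i.castSucc)).toLp _,
      (memLp_one_iff_integrable.2 (hf (Fin.last m))).toLp _, ?_,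
      ContinuousLinearMap.ext fun z => ?_⟩
    · rw [mem_vanishing]
      filter_upwards [h0] with x h1 h2 using absurd h2 h1
    · refine Eq.trans ?_ (hF z).symm
      rw [SolSpace.functional_apply, key _ _ z (MemLp.coeFn_toLp _), Fin.sum_univ_castSucc]
      congr 1
      refine Finset.sum_congr rfl fun i _ => ?_
      rw [pairing_apply]
      refine integral_congr_ae ?_
      filter_upwards [MemLp.coeFn_toLp (memLp_one_iff_integrable.2 (hf i.castSucc))] with x h1
      rw [h1]
      rfl

end NegC

/-! ### The sesquilinear expression in weighted coordinates -/

section Form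

variable {A B : CoeffSystem} {n m : ℕ} {s t : ℝ≥0∞} {p : ℕ → ℕ → I → ℂ}
  [Fact (1 ≤ s)] [Fact (1 ≤ t)] [s.HolderConjugate t] [t.HolderConjugate s]
  {U : Matrix (Fin n ⊕ Fin n) (Fin n ⊕ Fin n) ℂ} {X : Type*}
  [NormedAddCommGroup X] [NormedSpace ℂ X]
  {V : Matrix (Fin m ⊕ Fin m) (Fin m ⊕ Fin m) ℂ} {Z : Type*}
  [NormedAddCommGroup Z] [NormedSpace ℂ Z]

/-- The functions `y` and `w` are the unweighted last components of `x` and `z`. -/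
theorem formOp_eq_quasiForm (h : Admissible A B n m s t p) (hs : s ≠ ∞)
    (SX : SolSpace A n s t U X) (SZ : SolSpace B m t s V Z)
    (Q : Matrix (Fin m ⊕ Fin m) (Fin n ⊕ Fin n) ℂ) (x : X) (z : Z) {y w : I → ℂ}
    (hy : SX.top x =ᵐ[volume] fun a => wpow (A.top n) s a * y a)
    (hw : SZ.top z =ᵐ[volume] fun a => wpow (B.top m) t a * w a) :
    formOp h SX SZ Q x z = quasiForm A B s p Q (fun i => SX.comp i x) y
      (fun j => SZ.comp j z) w := by
  have hexp : (s.toReal - 1) / s.toReal = 1 / t.toReal := by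
    have hs0 : s ≠ 0 := (zero_lt_one.trans_le (Fact.out : 1 ≤ s)).ne'
    have hpos : 0 < s.toReal := ENNReal.toReal_pos hs0 hs
    have := one_div_toReal_add (p := s) (q := t)
    rw [sub_div, div_self hpos.ne']
    linarith
  have e1 : ∫ a, topCoeff h SX x a * conj (SZ.top z a) =
      (∫ a, ((‖A (n - 1) n a‖ ^ (1 / s.toReal) : ℝ) : ℂ) *
        ((‖B (m - 1) m a‖ ^ (1 / t.toReal) : ℝ) : ℂ) * p n m a * y a * conj (w a)) +
      ∑ i : Fin n, ∫ a, ((‖B (m - 1) m a‖ ^ (1 / t.toReal) : ℝ) : ℂ) *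
        p i m a * SX.comp i x a * conj (w a) := by
    rw [← sesq_apply SZ.top]
    simp only [topCoeff, add_apply, sum_apply, ContinuousLinearMap.comp_apply, map_add, map_sum]
    congr 1
    · rw [sesq_apply]
      refine integral_congr_ae ?_
      filter_upwards [coeFn_mulLp (r := s) (p n m) h.main (SX.top x), hy, hw] with a h1 h2 h3
      rw [h1, h2, h3, map_mul, wpow, wpow, Complex.conj_ofReal]
      ring
    · refine Finset.sum_congr rfl fun i _ => ?_
      rw [sesq_apply]
      refine integral_congr_ae ?_
      filter_upwards [coeFn_mulC (p i m) (h.row i) (SX.comp i x), hw] with a h1 h3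
      rw [h1, h3, map_mul, wpow, Complex.conj_ofReal]
      ring
  have e2 : ∀ j : Fin m, pairing (lowCoeff h SX x j) (SZ.comp j z) =
      (∫ a, ((‖A (n - 1) n a‖ ^ (1 / s.toReal) : ℝ) : ℂ) *
        p n j a * y a * conj (SZ.comp j z a)) +
      ∑ i : Fin n, ∫ a, p i j a * SX.comp i x a * conj (SZ.comp j z a) := by
    intro j
    have h2 : lowCoeff h SX x j = mulLp (r := 1) (p n j) (h.col j) (SX.top x) +
        ∑ i : Fin n, mulC (p i j) (h.inner i j) (SX.comp i x) := by
      simp [lowCoeff]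
    rw [h2]
    simp only [map_add, map_sum, add_apply, sum_apply]
    congr 1
    · rw [pairing_apply]
      refine integral_congr_ae ?_
      filter_upwards [coeFn_mulLp (r := 1) (p n j) (h.col j) (SX.top x), hy] with a h1 h2
      rw [h1, h2, wpow]
      ring
    · refine Finset.sum_congr rfl fun i _ => ?_
      rw [pairing_apply]
      refine integral_congr_ae ?_
      filter_upwards [coeFn_mulC (p i j) (h.inner i j) (SX.comp i x)] with a h1
      rw [h1]
  rw [formOp_apply, add_apply, SolSpace.functional_apply, SolSpace.bdryFunctional_apply, e1,
    Finset.sum_congr rfl fun j _ => e2 j, Finset.sum_add_distrib, quasiForm, hexp,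
    SX.bdry_apply, SZ.bdry_apply, dotProduct, Finset.sum_comm (s := Finset.univ (α := Fin m))]
  ring

end Form

end QuasiSobolev
end

theorem mainTheorem1 (n m : ℕ) (hn : 0 < n) (hm : 0 < m)
    (A B : QuasiSobolev.CoeffSystem)
    (hA : A.StrictMonoUpTo n) (hB : B.StrictMonoUpTo m)
    (hAB : ∀ᵐ x : I, A (n - 1) n x = 0 ↔ B (m - 1) m x = 0)
    (s t : ℝ≥0∞) [Fact (1 ≤ s)] [Fact (1 ≤ t)] [t.HolderConjugate s] (hs : s ≠ ∞)
    (hs1 : s = 1 → ∀ᵐ x : I, A (n - 1) n x ≠ 0)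
    (U : Matrix (Fin n ⊕ Fin n) (Fin n ⊕ Fin n) ℂ)
    (V : Matrix (Fin m ⊕ Fin m) (Fin m ⊕ Fin m) ℂ)
    (Q : Matrix (Fin m ⊕ Fin m) (Fin n ⊕ Fin n) ℂ)
    (p : ℕ → ℕ → I → ℂ)
    (hpnm : MemLp (p n m) ∞ volume)
    (hpnm0 : ∀ᵐ x : I, p n m x ≠ 0)
    (hpnm_inv : MemLp (fun x => (p n m x)⁻¹) ∞ volume)
    (hpim : ∀ i < n, MemLp (p i m) s volume)
    (hpim0 : s ≠ 1 → ∀ i < n, ∀ᵐ x : I, B (m - 1) m x = 0 → p i m x = 0)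
    (hpnj : ∀ j < m, MemLp (p n j) t volume)
    (hpnj0 : ∀ j < m, ∀ᵐ x : I, A (n - 1) n x = 0 → p n j x = 0)
    (hpij : ∀ i < n, ∀ j < m, Integrable (p i j) volume) :
    (s = 1 →
      (∃ T : QuasiSobolev.WSpaceBC A n s U →L[ℂ] QuasiSobolev.NegCSpaceBC B m V,
        ∀ Y Z, (T Y).1 Z = QuasiSobolev.quasiForm A B s p Q (fun i => Y.1.fst i) Y.1.snd
          (fun j => Z.1 j.castSucc) (Z.1 (Fin.last m))) ∧
      ∀ T : QuasiSobolev.WSpaceBC A n s U →L[ℂ] QuasiSobolev.NegCSpaceBC B m V,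
        (∀ Y Z, (T Y).1 Z = QuasiSobolev.quasiForm A B s p Q (fun i => Y.1.fst i) Y.1.snd
          (fun j => Z.1 j.castSucc) (Z.1 (Fin.last m))) →
        T.IsFredholm ∧ T.toLinearMap.index = (n : ℤ) - m - U.rank + V.rank) ∧
    (1 < s →
      (∃ T : QuasiSobolev.WSpaceBC A n s U →L[ℂ] QuasiSobolev.NegWSpaceBC B m t s V,
        ∀ Y Z, (T Y).1 Z = QuasiSobolev.quasiForm A B s p Q (fun i => Y.1.fst i) Y.1.snd
          (fun j => Z.1.fst j) Z.1.snd) ∧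
      ∀ T : QuasiSobolev.WSpaceBC A n s U →L[ℂ] QuasiSobolev.NegWSpaceBC B m t s V,
        (∀ Y Z, (T Y).1 Z = QuasiSobolev.quasiForm A B s p Q (fun i => Y.1.fst i) Y.1.snd
          (fun j => Z.1.fst j) Z.1.snd) →
        T.IsFredholm ∧ T.toLinearMap.index = (n : ℤ) - m - U.rank + V.rank) := by
  have hst : s.HolderConjugate t := ENNReal.HolderConjugate.symm
  have hpim0' : ∀ i : Fin n, ∀ᵐ x : I, B.top m x = 0 → p i m x = 0 := by
    intro i
    by_cases h1 : s = 1
    · filter_upwards [hs1 h1, hAB] with x h2 h3 h4 using absurd (h3.2 h4) h2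
    · exact hpim0 h1 i i.2
  have h : QuasiSobolev.Admissible A B n m s t p :=
    { main := hpnm
      main_ne := hpnm0
      main_inv := hpnm_inv
      row := fun i => hpim i i.2
      row_zero := hpim0'
      col := fun j => hpnj j j.2
      inner := fun i j => memLp_one_iff_integrable.2 (hpij i i.2 j j.2)
      zeros := hAB }
  set SX := QuasiSobolev.WSpaceBC.solSpace (A := A) (n := n) U t hs with hSX
  constructor
  · intro h1
    subst h1
    have ht : t = ∞ := by
      have h2 := ENNReal.HolderConjugate.inv_add_inv_eq_one t 1
      have h3 : t⁻¹ = 0 := by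
        rw [inv_one] at h2
        exact ENNReal.add_right_inj ENNReal.one_ne_top |>.1 (by rw [add_comm, h2, add_zero])
      exact ENNReal.inv_eq_zero.1 h3
    subst ht
    have hB0 : ∀ᵐ x : I, B.top m x ≠ 0 := by
      filter_upwards [hs1 rfl, hAB] with x h2 h3 h4 using h2 (h3.2 h4)
    set SZ := QuasiSobolev.CSpaceBC.solSpace V hB0 with hSZ
    have hform : ∀ Y Z, QuasiSobolev.formOp h SX SZ Q Y Z =
        QuasiSobolev.quasiForm A B 1 p Q (fun i => Y.1.fst i) Y.1.snd
          (fun j => Z.1 j.castSucc) (Z.1 (Fin.last m)) := fun Y Z =>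
      QuasiSobolev.formOp_eq_quasiForm h hs SX SZ Q Y Z
        (QuasiSobolev.coeFn_top_WSpaceBC hs Y) (QuasiSobolev.coeFn_top_CSpaceBC hB0 Z)
    constructor
    · obtain ⟨T, hT⟩ := QuasiSobolev.exists_form_operator h SX SZ
        (QuasiSobolev.NegCSpaceBC.mem_dual_iff hB0) Q
      refine ⟨T, fun Y Z => ?_⟩
      rw [← hform, ← hT]
      rfl
    · intro T hT
      refine QuasiSobolev.isFredholm_and_index_eq h hA hB hs SX
        (QuasiSobolev.WSpaceBC.exists_eq U hs) SZ
        (QuasiSobolev.NegCSpaceBC.mem_dual_iff hB0) Q T fun Y => ContinuousLinearMap.ext fun Z => ?_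
      rw [hform, ← hT]
      rfl
  · intro h1
    have ht : t ≠ ∞ := by
      rintro rfl
      have h2 := ENNReal.HolderConjugate.inv_add_inv_eq_one ∞ s
      rw [ENNReal.inv_top, zero_add, ENNReal.inv_eq_one] at h2
      exact h1.ne' h2
    set SZ := QuasiSobolev.WSpaceBC.solSpace (A := B) (n := m) V s ht with hSZ
    have hform : ∀ Y Z, QuasiSobolev.formOp h SX SZ Q Y Z =
        QuasiSobolev.quasiForm A B s p Q (fun i => Y.1.fst i) Y.1.snd
          (fun j => Z.1.fst j) Z.1.snd := fun Y Z =>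
      QuasiSobolev.formOp_eq_quasiForm h hs SX SZ Q Y Z
        (QuasiSobolev.coeFn_top_WSpaceBC hs Y) (QuasiSobolev.coeFn_top_WSpaceBC ht Z)
    constructor
    · obtain ⟨T, hT⟩ := QuasiSobolev.exists_form_operator h SX SZ
        (QuasiSobolev.NegWSpaceBC.mem_dual_iff ht) Q
      refine ⟨T, fun Y Z => ?_⟩
      rw [← hform, ← hT]
      rfl
    · intro T hT
      refine QuasiSobolev.isFredholm_and_index_eq h hA hB hs SX
        (QuasiSobolev.WSpaceBC.exists_eq U hs) SZ
        (QuasiSobolev.NegWSpaceBC.mem_dual_iff ht) Q T fun Y => ContinuousLinearMap.ext fun Z => ?_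
      rw [hform, ← hT]
      rfl
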